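/- Let $d\ge 2$ be an integer and $\kappa_0$ a real number. There are constants $\delta>0$ and $C>0$, depending only on $d$ and $\kappa_0$, such that the following holds. Let $u=u(x,t)>0$ be a classical solution on $\mathbb R\times[0,t_\#]$, $t_\#>0$ (smooth for $0<t<t_\#$, with $\partial_x^n u$, $n\le 4$, continuous on $\mathbb R\times[0,t_\#]$), of $$\partial_t u=\frac{\partial_x^2u}{1+(\partial_xu)^2}-\frac{d-1}{u}.$$ Let $a,b>0$ be $C^1$ functions on $[0,t_\#]$ and let $\lambda>0$ satisfy $-\lambda\partial_t\lambda=a$. Put $\tau(t)=\int_0^t\lambda(s)^{-2}ds$, $y=\lambda(t)^{-1}x$, $v(y,\tau(t))=\lambda(t)^{-1}u(\lambda(t)y,t)$, and $$\phi(y,\tau(t))=v(y,\tau(t))-\Big(\frac{2(d-1)+b(t)y^2}{a(t)+\frac12}\Big)^{1/2}.$$ Assume that for every $t\in[0,t_\#]$ the function $\phi(\cdot,\tau(t))$ is orthogonal to $1$ and to $1-a(t)y^2$ in $L^2(\mathbb R,e^{-a(t)y^2/2}dy)$. Below, $a$ and $b$ are also regarded as functions of $\tau$. Write $\langle y\rangle=(1+y^2)^{1/2}$,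 $\|f\|_{m,n}=\sup_y|\langle y\rangle^{-m}\partial_y^nf(y)|$, $\beta(\tau)=\big(\frac1{b(0)}+\frac{\tau}{d-1}\big)^{-1}$, $$M_{m,n}(S)=\sup_{0\le\tau\le S}\beta(\tau)^{-\frac{m+n+1}2}\|\phi(\cdot,\tau)\|_{m,n},\qquad |M|=M_{3,0}+M_{\frac{11}{10},0}+M_{1,2}+M_{2,1},$$ $$A(S)=\sup_{0\le\tau\le S}\beta(\tau)^{-2}\Big|a-\tfrac12+\tfrac{1}{d-1}b\Big|,\qquad B(S)=\sup_{0\le\tau\le S}\beta(\tau)^{-7/4}|b-\beta(\tau)|,$$ and let $g(y,b)=\frac9{10}\sqrt{2(d-1)}$ if $by^2<20(d-1)$ and $g(y,b)=4\sqrt{d-1}$ if $by^2\ge20(d-1)$. Suppose that $b(0)\le\delta$; that $v(y,0)\ge g(y,b(0))$, $v(\cdot,0)\in\langle y\rangle L^\infty$, $|v^{-1/2}\partial_yv|(y,0)\le\kappa_0\beta(0)^{1/2}$ and $|\partial_y^nv(y,0)|\le\kappa_0\beta(0)^{n/2}$ for $n=2,3,4$ and all $y$; and that for some $0<\tau_1\le\tau(t_\#)$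 and every $\tau\in[0,\tau_1]$ one has $|M(\tau)|,A(\tau),B(\tau)\le\beta(\tau)^{-1/4}$, $v(\cdot,\tau)\in\langle y\rangle L^\infty$, $\partial_yv(\cdot,\tau),\partial_y^2v(\cdot,\tau)\in L^\infty$, and $v(y,\tau)\ge c(\tau)$ for all $y$, for some $c(\tau)>0$. Then for all $\tau\in[0,\tau_1]$ and $y\in\mathbb R$, $$v(y,\tau)\ge g(y,\beta(\tau)),\qquad |v^{-1/2}\partial_yv|(y,\tau)\le C\beta(\tau)^{1/2},\qquad |\partial_y^nv(y,\tau)|\le C\beta(\tau)^{n/2}\ \ (n=2,3,4).$$ -/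

import Mathlib

open MeasureTheory Set

noncomputable section

namespace NeckPinch

/-- A positive classical solution on `ℝ × [0, T]` of the mean curvature flow equation for surfaces
of revolution, `∂ₜu = ∂ₓ²u / (1 + (∂ₓu)²) - (d - 1) / u`. The function `u x t` is smooth for
`0 < t < T`, and its `x`-derivatives of order at most four are continuous up to `t = 0` and
`t = T`. No growth at infinity is prescribed here. -/
structure IsMCFSolution (d : ℕ) (u : ℝ → ℝ → ℝ) (T : ℝ) : Prop where
  pos : ∀ t ∈ Icc 0 T, ∀ x, 0 < u x t
  contDiff_slice : ∀ t ∈ Icc 0 T, ContDiff ℝ 4 (fun x => u x t)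
  continuousOn_deriv : ∀ n ≤ 4, ContinuousOn
    (fun z : ℝ × ℝ => iteratedDeriv n (fun x => u x z.2) z.1) (univ ×ˢ Icc 0 T)
  smooth : ContDiffOn ℝ ((⊤ : ℕ∞) : WithTop ℕ∞) (fun z : ℝ × ℝ => u z.1 z.2) (univ ×ˢ Ioo 0 T)
  eqn : ∀ t ∈ Ioo 0 T, ∀ x,
    deriv (fun s => u x s) t =
      iteratedDeriv 2 (fun ξ => u ξ t) x / (1 + (deriv (fun ξ => u ξ t) x) ^ 2)
        - ((d : ℝ) - 1) / u x t

/-- The rescaled time `τ(t) = ∫₀ᵗ λ(s)⁻² ds`. -/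
def tau (lam : ℝ → ℝ) (t : ℝ) : ℝ := ∫ s in (0 : ℝ)..t, ((lam s) ^ 2)⁻¹

/-- The rescaled solution at the original time `t`:
`rescaled u lam t y` is `v(y, τ(t)) = λ(t)⁻¹ u(λ(t) y, t)`. -/
def rescaled (u : ℝ → ℝ → ℝ) (lam : ℝ → ℝ) (t y : ℝ) : ℝ := (lam t)⁻¹ * u (lam t * y) t

/-- The almost solution `V_{ab}(y) = ((2(d - 1) + b y²) / (a + 1/2))^{1/2}`. -/
def almostSol (d : ℕ) (a b y : ℝ) : ℝ :=
  Real.sqrt ((2 * ((d : ℝ) - 1) + b * y ^ 2) / (a + 1 / 2))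

/-- The fluctuation `φ(y, τ(t)) = v(y, τ(t)) - V_{a(t) b(t)}(y)`. -/
def fluct (d : ℕ) (u : ℝ → ℝ → ℝ) (lam a b : ℝ → ℝ) (t y : ℝ) : ℝ :=
  rescaled u lam t y - almostSol d (a t) (b t) y

/-- Orthogonality of `f` and `h` in the weighted space `L²(ℝ, e^{-a y²/2} dy)`. -/
def GaussOrth (a : ℝ) (f h : ℝ → ℝ) : Prop :=
  Integrable (fun y => f y * h y * Real.exp (-(a / 2) * y ^ 2)) ∧
    ∫ y, f y * h y * Real.exp (-(a / 2) * y ^ 2) = 0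

/-- Condition (A): on `[0, T]` there are positive `C¹` parameters `a`, `b` and a scale `λ > 0` with
`-λ ∂ₜλ = a` such that `u = λ (V_{ab} + φ)` with `φ` orthogonal to `1` and `1 - a y²`. -/
structure ConditionA (d : ℕ) (u : ℝ → ℝ → ℝ) (lam a b : ℝ → ℝ) (T : ℝ) : Prop where
  a_contDiff : ContDiffOn ℝ 1 a (Icc 0 T)
  b_contDiff : ContDiffOn ℝ 1 b (Icc 0 T)
  a_pos : ∀ t ∈ Icc 0 T, 0 < a t
  b_pos : ∀ t ∈ Icc 0 T, 0 < b t
  lam_pos : ∀ t ∈ Icc 0 T, 0 < lam t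
  lam_deriv : ∀ t ∈ Icc 0 T, HasDerivWithinAt lam (-(a t) / lam t) (Icc 0 T) t
  orth_one : ∀ t ∈ Icc 0 T, GaussOrth (a t) (fluct d u lam a b t) (fun _ => 1)
  orth_two : ∀ t ∈ Icc 0 T, GaussOrth (a t) (fluct d u lam a b t) (fun y => 1 - a t * y ^ 2)

/-- `⟨y⟩ = (1 + y²)^{1/2}`. -/
def bracket (y : ℝ) : ℝ := Real.sqrt (1 + y ^ 2)

/-- The norm `‖f‖_{m,n} = sup_y |⟨y⟩^{-m} ∂ⁿf(y)|`, with value `∞` if unbounded. -/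
def wnorm (m : ℝ) (n : ℕ) (f : ℝ → ℝ) : ENNReal :=
  ⨆ y : ℝ, ENNReal.ofReal |bracket y ^ (-m) * iteratedDeriv n f y|

/-- The function `β(τ) = 1 / (1/b₀ + τ/(d - 1))`. -/
def betaFun (d : ℕ) (b₀ τ : ℝ) : ℝ := 1 / (1 / b₀ + τ / ((d : ℝ) - 1))

/-- `sup_{τ ≤ S} β(τ)^{-p} F(t(τ))`, the pattern of all the majorants. The supremum runs over
the times `t ∈ [0, T]` with `τ(t) ≤ S`. -/
def majorant (d : ℕ) (lam b : ℝ → ℝ) (T p : ℝ) (F : ℝ → ENNReal) (S : ℝ) : ENNReal :=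
  ⨆ t ∈ {t : ℝ | t ∈ Icc 0 T ∧ tau lam t ≤ S},
    ENNReal.ofReal (betaFun d (b 0) (tau lam t) ^ (-p)) * F t

/-- `M_{m,n}(S)`, the majorant of `φ` in the norm `‖·‖_{m,n}`. -/
def majM (d : ℕ) (u : ℝ → ℝ → ℝ) (lam a b : ℝ → ℝ) (T m : ℝ) (n : ℕ) (S : ℝ) : ENNReal :=
  majorant d lam b T ((m + n + 1) / 2) (fun t => wnorm m n (fluct d u lam a b t)) S

/-- `|M(S)| = M_{3,0} + M_{11/10,0} + M_{1,2} + M_{2,1}`. -/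
def majMsum (d : ℕ) (u : ℝ → ℝ → ℝ) (lam a b : ℝ → ℝ) (T S : ℝ) : ENNReal :=
  majM d u lam a b T 3 0 S + majM d u lam a b T (11 / 10) 0 S
    + majM d u lam a b T 1 2 S + majM d u lam a b T 2 1 S

/-- `A(S) = sup_{τ ≤ S} β(τ)⁻² |a - 1/2 + b/(d - 1)|`. -/
def majA (d : ℕ) (lam a b : ℝ → ℝ) (T S : ℝ) : ENNReal :=
  majorant d lam b T 2 (fun t => ENNReal.ofReal |a t - 1 / 2 + 1 / ((d : ℝ) - 1) * b t|) S

/-- `B(S) = sup_{τ ≤ S} β(τ)^{-7/4} |b - β(τ)|`. -/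
def majB (d : ℕ) (lam b : ℝ → ℝ) (T S : ℝ) : ENNReal :=
  majorant d lam b T (7 / 4)
    (fun t => ENNReal.ofReal |b t - betaFun d (b 0) (tau lam t)|) S

/-- The barrier `g(y, b)`. -/
def barrier (d : ℕ) (y b : ℝ) : ℝ :=
  if b * y ^ 2 < 20 * ((d : ℝ) - 1) then 9 / 10 * Real.sqrt (2 * ((d : ℝ) - 1))
  else 4 * Real.sqrt ((d : ℝ) - 1)

/-- The initial conditions on `w = v(·, 0)`, with `b₀ = b(0) = β(0)`. -/
structure InitialBounds (d : ℕ) (κ₀ b₀ : ℝ) (w : ℝ → ℝ) : Prop where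
  lower : ∀ y, barrier d y b₀ ≤ w y
  growth : ∃ K : ℝ, ∀ y, |w y| ≤ K * bracket y
  deriv_one : ∀ y, |deriv w y * w y ^ (-(1 / 2) : ℝ)| ≤ κ₀ * b₀ ^ (1 / 2 : ℝ)
  deriv_higher : ∀ n ∈ Icc 2 4, ∀ y, |iteratedDeriv n w y| ≤ κ₀ * b₀ ^ ((n : ℝ) / 2)

/-- `w ∈ ⟨y⟩L^∞`, `∂w, ∂²w ∈ L^∞`, and `w ≥ c` for some `c > 0`. -/
structure SpaceCondition (w : ℝ → ℝ) : Prop where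
  growth : ∃ K : ℝ, ∀ y, |w y| ≤ K * bracket y
  deriv_one : ∃ K : ℝ, ∀ y, |deriv w y| ≤ K
  deriv_two : ∃ K : ℝ, ∀ y, |iteratedDeriv 2 w y| ≤ K
  lower : ∃ c : ℝ, 0 < c ∧ ∀ y, c ≤ w y

end NeckPinch

end

/-! Write m = d - 1. In the rescaled variables v solves ∂_τ v = ∂²v/(1 + (∂v)²) - a y ∂v + a v -
m/v, with a close to 1/2. The line is split at β y² = 20 m.

In the inner region the majorants suffice. The norms with m + n = 3 bound ∂ⁿφ by β^{7/4}⟨y⟩^{3-n},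
and β^{1/2}⟨y⟩ is bounded there, so ∂ⁿφ = O(β^{1/4 + n/2}). Hence v, ∂v and ∂²v are close to those
of the explicit almost solution (`inner_bounds`). On the interface v² > 16 m, which serves as
lateral boundary data for the outer region.

In the outer region the maximum principle takes over. The reaction a v - m/v pushes v up once v² is
large compared with m, so v² ≥ 16 m persists (`outer_lower`). Then m/v² ≤ 1/16, and the damping
coming from a ≈ 1/2 beats the destabilising term m/v² in the equations for (∂v)² - Gβv and (∂²v)² -
(Gβ)², where G = 9 + κ₀² (`deriv_one_sq_le`, `deriv_two_sq_le`). The majorants give polynomial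
growth of ∂v and ∂²v, which is enough for the linear maximum principle
`nonpos_of_polynomial_growth`; the cubic term in the equation for ∂²v is tamed by a preliminary,
non-uniform bound obtained from the equation for ∂ arctan(∂v) (`exists_deriv_two_bound`).

For ∂³v and ∂⁴v no growth at infinity is known. With g = ∂ⁿv already bounded and f = ∂g, the
Bernstein–Shi quantity f²(200Gβⁿ + g²) satisfies an inequality with a negative quadratic term
(`bernstein`). Comparison with barriers that blow up at |y| = R, and R → ∞, then needs no growth
condition (`nonpos_of_quadratic_absorption`). Here the damping -n a f, together with v² ≥ 81m/50, is
strong enough on the whole line, so no splitting is needed. -/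

section Auxiliary

open Filter Topology
open scoped ContDiff

/-! ### Maximum principles on the line -/

/-- The second derivative test at a local maximum. -/
theorem second_deriv_nonpos_of_isLocalMax {f f' : ℝ → ℝ} {f'' y : ℝ}
    (hf : ∀ᶠ x in 𝓝 y, HasDerivAt f (f' x) x) (hf' : HasDerivAt f' f'' y)
    (hmax : IsLocalMax f y) : f' y = 0 ∧ f'' ≤ 0 := by
  have h0 : f' y = 0 := hmax.hasDerivAt_eq_zero hf.self_of_nhds
  refine ⟨h0, ?_⟩
  -- A positive second derivative would make y a local minimum as well, so f would be locally
  -- constant and its second derivative zero.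
  by_contra! hpos
  have hd : deriv f =ᶠ[𝓝 y] f' := hf.mono fun x hx => hx.deriv
  have hdd : deriv (deriv f) y = f'' := by rw [hd.deriv_eq]; exact hf'.deriv
  have hmin : IsLocalMin f y :=
    isLocalMin_of_deriv_deriv_pos (by rw [hdd]; exact hpos) (by rw [hd.self_of_nhds, h0])
      hf.self_of_nhds.continuousAt
  have hconst : f =ᶠ[𝓝 y] fun _ => f y := by
    filter_upwards [hmax, hmin] with x h1 h2 using le_antisymm h1 h2
  have h2 : deriv f =ᶠ[𝓝 y] fun _ => 0 := by
    simpa using hconst.deriv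
  have : deriv (deriv f) y = 0 := by rw [h2.deriv_eq]; simp
  linarith

/-- A function that is smaller before time `t` has nonnegative derivative at `t`. -/
theorem deriv_nonneg_of_eventually_le_left {g : ℝ → ℝ} {g' t : ℝ} (hg : HasDerivAt g g' t)
    (h : ∀ᶠ s in 𝓝[<] t, g s ≤ g t) : 0 ≤ g' := by
  have h1 : Tendsto (slope g t) (𝓝[<] t) (𝓝 g') :=
    (hasDerivAt_iff_tendsto_slope.1 hg).mono_left
      (nhdsWithin_mono _ fun x hx => ne_of_lt hx)
  refine ge_of_tendsto h1 ?_
  filter_upwards [h, self_mem_nhdsWithin] with s hs hst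
  rw [slope_def_field]
  exact div_nonneg_of_nonpos (by linarith) (sub_nonpos.2 (le_of_lt hst))

/-- On a compact space-time set, a function that is somewhere nonnegative has a first time at which
this happens, and a maximum at that time. -/
theorem exists_first_touch {K : Set (ℝ × ℝ)} (hK : IsCompact K) {f : ℝ → ℝ → ℝ}
    (hf : ContinuousOn (fun z : ℝ × ℝ => f z.1 z.2) K) (h : ∃ z ∈ K, 0 ≤ f z.1 z.2) :
    ∃ y t, (y, t) ∈ K ∧ 0 ≤ f y t ∧ (∀ z ∈ K, z.2 < t → f z.1 z.2 < 0) ∧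
      ∀ x, (x, t) ∈ K → f x t ≤ f y t := by
  obtain ⟨z₀, hz₀, hz₀'⟩ := h
  have hK1 : IsCompact (K ∩ (fun z : ℝ × ℝ => f z.1 z.2) ⁻¹' Ici 0) := by
    refine hK.of_isClosed_subset (hf.preimage_isClosed_of_isClosed hK.isClosed isClosed_Ici)
      inter_subset_left
  obtain ⟨z₁, hz₁, hmin⟩ := hK1.exists_isMinOn ⟨z₀, hz₀, hz₀'⟩ continuous_snd.continuousOn
  have hK2 : IsCompact (K ∩ {z : ℝ × ℝ | z.2 = z₁.2}) :=
    hK.inter_right (isClosed_eq continuous_snd continuous_const)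
  obtain ⟨z₂, hz₂, hmax⟩ := hK2.exists_isMaxOn ⟨z₁, hz₁.1, rfl⟩ (hf.mono inter_subset_left)
  have h2 : z₂.2 = z₁.2 := hz₂.2
  refine ⟨z₂.1, z₂.2, hz₂.1, le_trans hz₁.2 (hmax ⟨hz₁.1, rfl⟩), ?_, ?_⟩
  · intro z hz hlt
    by_contra! hge
    have : z₁.2 ≤ z.2 := hmin ⟨hz, hge⟩
    linarith
  · intro x hx
    exact hmax (show (x, z₂.2) ∈ _ from ⟨hx, h2⟩)

/-- The weak maximum principle in contrapositive form: `f` stays negative on a compact space-time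
set if a first zero of `f` is impossible. -/
theorem neg_of_no_first_touch {K : Set (ℝ × ℝ)} (hK : IsCompact K) {f ft fy fyy : ℝ → ℝ → ℝ}
    (hf : ContinuousOn (fun z : ℝ × ℝ => f z.1 z.2) K)
    (hint : ∀ y t, (y, t) ∈ K → 0 ≤ f y t →
      (∀ᶠ x in 𝓝 y, (x, t) ∈ K) ∧ ∀ᶠ s in 𝓝[<] t, (y, s) ∈ K)
    (ht : ∀ y t, (y, t) ∈ K → 0 ≤ f y t → HasDerivAt (f y) (ft y t) t)
    (hy : ∀ y t, (y, t) ∈ K → 0 ≤ f y t → ∀ᶠ x in 𝓝 y, HasDerivAt (fun x => f x t) (fy x t) x)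
    (hyy : ∀ y t, (y, t) ∈ K → 0 ≤ f y t → HasDerivAt (fun x => fy x t) (fyy y t) y)
    (hno : ∀ y t, (y, t) ∈ K → f y t = 0 → fy y t = 0 → fyy y t ≤ 0 → 0 ≤ ft y t → False) :
    ∀ z ∈ K, f z.1 z.2 < 0 := by
  by_contra! h
  obtain ⟨y, t, hyt, h0, hbefore, hmax⟩ := exists_first_touch hK hf h
  obtain ⟨hx, hs⟩ := hint y t hyt h0
  have hloc : IsLocalMax (fun x => f x t) y := hx.mono fun x h => hmax x h
  obtain ⟨h1, h2⟩ := second_deriv_nonpos_of_isLocalMax (hy y t hyt h0) (hyy y t hyt h0) hloc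
  have hneg : ∀ᶠ s in 𝓝[<] t, f y s < 0 := by
    filter_upwards [hs, self_mem_nhdsWithin] with s h3 h4 using hbefore _ h3 h4
  have hle : f y t ≤ 0 := by
    have := (ht y t hyt h0).continuousAt.continuousWithinAt (s := Iio t)
    exact le_of_tendsto this (hneg.mono fun s h => h.le)
  exact hno y t hyt (le_antisymm hle h0) h1 h2
    (deriv_nonneg_of_eventually_le_left (ht y t hyt h0) (hneg.mono fun s h => by linarith))

/-- The box version of `neg_of_no_first_touch`. -/
theorem neg_on_box_of_no_first_touch {R S : ℝ} {f ft fy fyy : ℝ → ℝ → ℝ}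
    (hf : ContinuousOn (fun z : ℝ × ℝ => f z.1 z.2) (Icc (-R) R ×ˢ Icc 0 S))
    (h0 : ∀ y ∈ Icc (-R) R, f y 0 < 0)
    (hbd : ∀ t ∈ Icc 0 S, f R t < 0 ∧ f (-R) t < 0)
    (ht : ∀ y ∈ Ioo (-R) R, ∀ t ∈ Ioc 0 S, HasDerivAt (f y) (ft y t) t)
    (hy : ∀ y ∈ Ioo (-R) R, ∀ t ∈ Ioc 0 S, HasDerivAt (fun x => f x t) (fy y t) y)
    (hyy : ∀ y ∈ Ioo (-R) R, ∀ t ∈ Ioc 0 S, HasDerivAt (fun x => fy x t) (fyy y t) y)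
    (hno : ∀ y ∈ Ioo (-R) R, ∀ t ∈ Ioc 0 S,
      f y t = 0 → fy y t = 0 → fyy y t ≤ 0 → 0 ≤ ft y t → False) :
    ∀ y ∈ Icc (-R) R, ∀ t ∈ Icc 0 S, f y t < 0 := by
  have key : ∀ y t, (y, t) ∈ Icc (-R) R ×ˢ Icc 0 S → 0 ≤ f y t → y ∈ Ioo (-R) R ∧ t ∈ Ioc 0 S := by
    rintro y t ⟨hy', ht'⟩ hge
    simp only at hy' ht'
    refine ⟨⟨lt_of_le_of_ne hy'.1 ?_, lt_of_le_of_ne hy'.2 ?_⟩, lt_of_le_of_ne ht'.1 ?_, ht'.2⟩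
    · rintro rfl; linarith [(hbd t ht').2]
    · rintro rfl; linarith [(hbd t ht').1]
    · rintro rfl; linarith [h0 y hy']
  have := neg_of_no_first_touch (isCompact_Icc.prod isCompact_Icc) hf
    (ft := ft) (fy := fy) (fyy := fyy) ?_ ?_ ?_ ?_ ?_
  · exact fun y hy t ht => this (y, t) ⟨hy, ht⟩
  · intro y t h h'
    obtain ⟨h1, h2⟩ := key y t h h'
    refine ⟨?_, ?_⟩
    · filter_upwards [Ioo_mem_nhds h1.1 h1.2] with x hx using ⟨Ioo_subset_Icc_self hx, h.2⟩
    · filter_upwards [Ioo_mem_nhdsLT h2.1] with s hs using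
        ⟨h.1, hs.1.le, hs.2.le.trans h2.2⟩
  · exact fun y t h h' => ht y (key y t h h').1 t (key y t h h').2
  · intro y t h h'
    obtain ⟨h1, h2⟩ := key y t h h'
    filter_upwards [Ioo_mem_nhds h1.1 h1.2] with x hx using hy x hx t h2
  · exact fun y t h h' => hyy y (key y t h h').1 t (key y t h h').2
  · exact fun y t h h' => hno y (key y t h h'.ge).1 t (key y t h h'.ge).2 h'

/-- The evolution equations hold only on the open time interval, so the maximum principles are run
up to a time t₀ < S; continuity then recovers the closing time. -/
theorem nonpos_on_Icc_of_Ico {S : ℝ} (hS : 0 < S) {g : ℝ → ℝ} (hg : ContinuousOn g (Icc 0 S))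
    (h : ∀ t ∈ Ico 0 S, g t ≤ 0) : ∀ t ∈ Icc 0 S, g t ≤ 0 := by
  intro t ht
  have h1 : t ∈ closure (Ico 0 S) := by rw [closure_Ico hS.ne]; exact ht
  exact (closure_minimal (s := Ico 0 S) (t := Icc 0 S ∩ g ⁻¹' Iic 0)
    (fun s hs => ⟨Ico_subset_Icc_self hs, h s hs⟩)
    (hg.preimage_isClosed_of_isClosed isClosed_Icc isClosed_Iic) h1).2

/-- The linear maximum principle on `ℝ × [0, S]` for functions of polynomial growth. Time derivatives
are taken with respect to the clock `τ`, whose rate is `σ`. -/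
theorem nonpos_of_polynomial_growth {S C : ℝ} (hS : 0 < S) (hC : 0 ≤ C) {σ τ : ℝ → ℝ}
    {f ft fy fyy A B : ℝ → ℝ → ℝ}
    (hf : ContinuousOn (fun z : ℝ × ℝ => f z.1 z.2) (univ ×ˢ Icc 0 S))
    (hgrow : ∀ t ∈ Icc 0 S, ∀ y, f y t ≤ C * (1 + y ^ 2) ^ 2)
    (h0 : ∀ y, f y 0 ≤ 0)
    (hσ : ∀ t ∈ Ioo 0 S, 0 < σ t)
    (hτc : ContinuousOn τ (Icc 0 S)) (hτ0 : ∀ t ∈ Icc 0 S, 0 ≤ τ t)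
    (hτ : ∀ t ∈ Ioo 0 S, HasDerivAt τ (σ t) t)
    (ht : ∀ t ∈ Ioo 0 S, ∀ y, HasDerivAt (f y) (ft y t * σ t) t)
    (hy : ∀ t ∈ Ioo 0 S, ∀ y, HasDerivAt (fun x => f x t) (fy y t) y)
    (hyy : ∀ t ∈ Ioo 0 S, ∀ y, HasDerivAt (fun x => fy x t) (fyy y t) y)
    (hA : ∀ t ∈ Ioo 0 S, ∀ y, 0 ≤ A y t ∧ A y t ≤ 1)
    (hB : ∀ t ∈ Ioo 0 S, ∀ y, |B y t| ≤ C * (1 + |y|))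
    (hpde : ∀ t ∈ Ioo 0 S, ∀ y, 0 < f y t →
      ft y t ≤ A y t * fyy y t + B y t * fy y t + C * f y t) :
    ∀ t ∈ Icc 0 S, ∀ y, f y t ≤ 0 := by
  -- The comparison function is G = ε e^{Kτ} (1 + y²)³, one power above the allowed growth. At a
  -- first touch the diffusion costs at most 30 G, the drift 12 C G and the zeroth order term C G;
  -- the remaining G makes the contradiction strict.
  set K : ℝ := 31 + 13 * C with hK
  intro t₁ ht₁ y₁
  have hcy : ContinuousOn (f y₁) (Icc 0 S) := by
    have : ContinuousOn (fun t : ℝ => ((y₁, t) : ℝ × ℝ)) (Icc 0 S) := by fun_prop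
    exact hf.comp this fun t ht => ⟨mem_univ _, ht⟩
  refine nonpos_on_Icc_of_Ico hS hcy ?_ t₁ ht₁
  intro t₀ ht₀
  have key : ∀ ε > 0, f y₁ t₀ < ε * (Real.exp (K * τ t₀) * (1 + y₁ ^ 2) ^ 3) := by
    intro ε hε
    -- This gives C < ε R, hence C(1 + R²)² < ε(1 + R²)³, so f lies below the comparison function on
    -- the lateral boundary.
    set R : ℝ := |y₁| + C / ε + 1 with hR
    have hCε : 0 ≤ C / ε := by positivity
    have hR1 : 1 ≤ R := by have := abs_nonneg y₁; linarith
    have hRC : C < ε * R := by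
      have h1 : ε * R = ε * |y₁| + C + ε := by rw [hR]; field_simp
      have := mul_nonneg hε.le (abs_nonneg y₁); linarith
    have hsub : Icc 0 t₀ ⊆ Icc 0 S := Icc_subset_Icc le_rfl ht₀.2.le
    have hsub' : Ioc 0 t₀ ⊆ Ioo 0 S := fun t h => ⟨h.1, h.2.trans_lt ht₀.2⟩
    have hbd : ∀ t ∈ Icc 0 t₀, ∀ x, x ^ 2 = R ^ 2 →
        f x t - ε * (Real.exp (K * τ t) * (1 + x ^ 2) ^ 3) < 0 := by
      intro t htt x hx
      have h1 := hgrow t (hsub htt) x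
      have h2 : 1 ≤ Real.exp (K * τ t) :=
        Real.one_le_exp (mul_nonneg (by positivity) (hτ0 t (hsub htt)))
      rw [hx] at h1 ⊢
      have h3 : C < ε * (1 + R ^ 2) := by nlinarith
      have h4 : C * (1 + R ^ 2) ^ 2 < ε * (1 + R ^ 2) * (1 + R ^ 2) ^ 2 := by gcongr
      have h5 : ε * (1 * (1 + R ^ 2) ^ 3) ≤ ε * (Real.exp (K * τ t) * (1 + R ^ 2) ^ 3) := by gcongr
      nlinarith
    have hmain := neg_on_box_of_no_first_touch (R := R) (S := t₀)
      (f := fun y t => f y t - ε * (Real.exp (K * τ t) * (1 + y ^ 2) ^ 3))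
      (ft := fun y t => (ft y t - ε * (K * Real.exp (K * τ t) * (1 + y ^ 2) ^ 3)) * σ t)
      (fy := fun y t => fy y t - ε * (Real.exp (K * τ t) * (6 * y * (1 + y ^ 2) ^ 2)))
      (fyy := fun y t => fyy y t -
        ε * (Real.exp (K * τ t) * (6 * (1 + y ^ 2) ^ 2 + 24 * y ^ 2 * (1 + y ^ 2))))
      ?_ ?_ ?_ ?_ ?_ ?_ ?_
    · have hyR : y₁ ∈ Icc (-R) R := abs_le.1 (by linarith)
      have := hmain y₁ hyR t₀ ⟨ht₀.1, le_rfl⟩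
      linarith
    · refine (hf.mono (prod_mono (subset_univ _) hsub)).sub ?_
      have h1 : ContinuousOn (fun z : ℝ × ℝ => τ z.2) (Icc (-R) R ×ˢ Icc 0 t₀) :=
        (hτc.mono hsub).comp continuousOn_snd fun z hz => hz.2
      exact continuousOn_const.mul ((continuousOn_const.mul h1).rexp.mul (by fun_prop))
    · intro y _
      have h1 : 0 < ε * (Real.exp (K * τ 0) * (1 + y ^ 2) ^ 3) := by positivity
      have := h0 y
      linarith
    · exact fun t htt => ⟨hbd t htt R rfl, hbd t htt (-R) (by ring)⟩
    · intro y _ t htt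
      have h1 := ((((hτ t (hsub' htt)).const_mul K).exp.mul_const ((1 + y ^ 2) ^ 3)).const_mul ε)
      exact ((ht t (hsub' htt) y).sub h1).congr_deriv (by ring)
    · intro y _ t htt
      have h1 : HasDerivAt (fun x : ℝ => (1 + x ^ 2) ^ 3) (6 * y * (1 + y ^ 2) ^ 2) y := by
        exact ((((hasDerivAt_id' y).pow 2).const_add 1).pow 3).congr_deriv (by simp; ring)
      exact (hy t (hsub' htt) y).sub ((h1.const_mul _).const_mul ε)
    · intro y _ t htt
      have h1 : HasDerivAt (fun x : ℝ => 6 * x * (1 + x ^ 2) ^ 2)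
          (6 * (1 + y ^ 2) ^ 2 + 24 * y ^ 2 * (1 + y ^ 2)) y := by
        exact (((hasDerivAt_id' y).const_mul 6).mul
          ((((hasDerivAt_id' y).pow 2).const_add 1).pow 2)).congr_deriv (by simp; ring)
      exact (hyy t (hsub' htt) y).sub ((h1.const_mul _).const_mul ε)
    · intro y _ t htt e0 e1 e2 e3
      have hs := hσ t (hsub' htt)
      set E : ℝ := ε * Real.exp (K * τ t) with hE
      have hEpos : 0 < E := by positivity
      have e0' : f y t = E * (1 + y ^ 2) ^ 3 := by rw [hE]; linarith
      have e1' : fy y t = E * (6 * y * (1 + y ^ 2) ^ 2) := by rw [hE]; linarith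
      have e2' : fyy y t ≤ E * (6 * (1 + y ^ 2) ^ 2 + 24 * y ^ 2 * (1 + y ^ 2)) := by
        rw [hE]; linarith
      have e3' : K * (E * (1 + y ^ 2) ^ 3) ≤ ft y t := by
        have := nonneg_of_mul_nonneg_left e3 hs
        rw [hE]; linarith
      have hfpos : 0 < f y t := by rw [e0']; positivity
      have hp := hpde t (hsub' htt) y hfpos
      obtain ⟨hA0, hA1⟩ := hA t (hsub' htt) y
      have hB' := hB t (hsub' htt) y
      set G : ℝ := E * (1 + y ^ 2) ^ 3 with hG
      have hGpos : 0 < G := by positivity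
      have b1 : A y t * fyy y t ≤ 30 * G := by
        have h1 : E * (6 * (1 + y ^ 2) ^ 2 + 24 * y ^ 2 * (1 + y ^ 2)) ≤ 30 * G := by
          have : 6 * (1 + y ^ 2) ^ 2 + 24 * y ^ 2 * (1 + y ^ 2) ≤ 30 * (1 + y ^ 2) ^ 3 := by
            have := sq_nonneg y
            nlinarith [mul_nonneg this this, mul_nonneg this (mul_nonneg this this)]
          rw [hG]; nlinarith
        calc A y t * fyy y t ≤ A y t * (30 * G) := by gcongr; linarith
          _ ≤ 1 * (30 * G) := by gcongr
          _ = 30 * G := one_mul _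
      have b2 : B y t * fy y t ≤ 12 * C * G := by
        calc B y t * fy y t ≤ |B y t * fy y t| := le_abs_self _
          _ = |B y t| * (E * (6 * |y| * (1 + y ^ 2) ^ 2)) := by
            rw [abs_mul, e1', abs_mul E, abs_mul (6 * y), abs_mul 6 y, abs_of_pos hEpos,
              abs_of_pos (show (0 : ℝ) < (1 + y ^ 2) ^ 2 by positivity),
              abs_of_pos (show (0 : ℝ) < 6 by norm_num)]
          _ ≤ C * (1 + |y|) * (E * (6 * |y| * (1 + y ^ 2) ^ 2)) := by gcongr
          _ = 6 * C * (E * (1 + y ^ 2) ^ 2) * ((1 + |y|) * |y|) := by ring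
          _ ≤ 6 * C * (E * (1 + y ^ 2) ^ 2) * (2 * (1 + y ^ 2)) := by
            have : (1 + |y|) * |y| ≤ 2 * (1 + y ^ 2) := by
              rw [← sq_abs y]; nlinarith [sq_nonneg (|y| - 1)]
            exact mul_le_mul_of_nonneg_left this (by positivity)
          _ = 12 * C * G := by rw [hG]; ring
      rw [e0'] at hp
      have b3 : K * G = 31 * G + 13 * C * G := by rw [hK]; ring
      linarith
  refine le_of_forall_pos_le_add fun ε hε => ?_
  have h1 : 0 < Real.exp (K * τ t₀) * (1 + y₁ ^ 2) ^ 3 := by positivity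
  have := key (ε / (Real.exp (K * τ t₀) * (1 + y₁ ^ 2) ^ 3)) (by positivity)
  rw [div_mul_cancel₀ _ h1.ne'] at this
  linarith

/-- A maximum principle on `ℝ × [0, S]` that needs no growth condition, thanks to a quadratic
absorption term. -/
theorem nonpos_of_quadratic_absorption {S c₀ c₁ : ℝ} (hS : 0 < S) (hc₀ : 0 < c₀) (hc₁ : 0 < c₁)
    {σ a : ℝ → ℝ} {f ft fy fyy A : ℝ → ℝ → ℝ}
    (hf : ContinuousOn (fun z : ℝ × ℝ => f z.1 z.2) (univ ×ˢ Icc 0 S))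
    (h0 : ∀ y, f y 0 ≤ 0)
    (hσ : ∀ t ∈ Ioo 0 S, 0 < σ t) (ha : ∀ t ∈ Ioo 0 S, 0 ≤ a t)
    (ht : ∀ t ∈ Ioo 0 S, ∀ y, HasDerivAt (f y) (ft y t * σ t) t)
    (hy : ∀ t ∈ Ioo 0 S, ∀ y, HasDerivAt (fun x => f x t) (fy y t) y)
    (hyy : ∀ t ∈ Ioo 0 S, ∀ y, HasDerivAt (fun x => fy x t) (fyy y t) y)
    (hA : ∀ t ∈ Ioo 0 S, ∀ y, 0 ≤ A y t)
    (hpde : ∀ t ∈ Ioo 0 S, ∀ y, 0 < f y t →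
      ft y t ≤ A y t * fyy y t - a t * y * fy y t - c₀ * A y t * f y t ^ 2 - c₁ * f y t) :
    ∀ t ∈ Icc 0 S, ∀ y, f y t ≤ 0 := by
  intro t₁ ht₁ y₁
  have hcy : ContinuousOn (f y₁) (Icc 0 S) := by
    have : ContinuousOn (fun t : ℝ => ((y₁, t) : ℝ × ℝ)) (Icc 0 S) := by fun_prop
    exact hf.comp this fun t ht => ⟨mem_univ _, ht⟩
  refine nonpos_on_Icc_of_Ico hS hcy ?_ t₁ ht₁
  intro t₀ ht₀
  -- The barrier ψ = N R²/(R² - y²)² blows up at |y| = R and satisfies ψ'' ≤ 24 N R⁴/(R² - y²)⁴ =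
  -- c₀ψ² exactly when c₀N = 24. The drift helps, since y ψ' ≥ 0, and the term in c₁ makes the
  -- inequality strict.
  set N : ℝ := 24 / c₀ with hN
  have hNpos : 0 < N := by positivity
  have hNc : c₀ * N = 24 := by rw [hN]; field_simp
  have hsub : Icc 0 t₀ ⊆ Icc 0 S := Icc_subset_Icc le_rfl ht₀.2.le
  have hsub' : Ioc 0 t₀ ⊆ Ioo 0 S := fun t h => ⟨h.1, h.2.trans_lt ht₀.2⟩
  have key : ∀ R : ℝ, |y₁| + 1 ≤ R → f y₁ t₀ < N * R ^ 2 / (R ^ 2 - y₁ ^ 2) ^ 2 := by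
    intro R hR
    have hRpos : 0 < R := by have := abs_nonneg y₁; linarith
    -- f is bounded by some P on the compact box, so the barrier exceeds f at |y| = r for r close
    -- enough to R. The size of P is irrelevant: it only affects the choice of r, not the resulting
    -- bound.
    obtain ⟨P, hP⟩ := (isCompact_Icc.prod isCompact_Icc).bddAbove_image
      (hf.mono (prod_mono (subset_univ (Icc (-R) R)) hsub))
    have hP' : ∀ y ∈ Icc (-R) R, ∀ t ∈ Icc 0 t₀, f y t ≤ P := fun y hy t ht =>
      hP ⟨(y, t), ⟨hy, ht⟩, rfl⟩
    have hlim : Tendsto (fun r : ℝ => N * R ^ 2 - (P + 1) * (R ^ 2 - r ^ 2) ^ 2) (𝓝[<] R)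
        (𝓝 (N * R ^ 2 - (P + 1) * (R ^ 2 - R ^ 2) ^ 2)) := by
      apply Continuous.continuousWithinAt; fun_prop
    have hev : ∀ᶠ r in 𝓝[<] R, 0 < N * R ^ 2 - (P + 1) * (R ^ 2 - r ^ 2) ^ 2 := by
      refine hlim.eventually (lt_mem_nhds ?_)
      have : 0 < N * R ^ 2 := by positivity
      simpa using this
    obtain ⟨r, hr, hrI⟩ := (hev.and (Ioo_mem_nhdsLT (show |y₁| < R by linarith))).exists
    have hrpos : 0 < r := (abs_nonneg y₁).trans_lt hrI.1
    have hin : ∀ y ∈ Icc (-r) r, 0 < R ^ 2 - y ^ 2 := by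
      intro y hy
      nlinarith [hy.1, hy.2, hrI.2]
    have hinR : Icc (-r) r ⊆ Icc (-R) R := Icc_subset_Icc (by linarith [hrI.2]) hrI.2.le
    have hbd : ∀ t ∈ Icc 0 t₀, ∀ x ∈ Icc (-r) r, x ^ 2 = r ^ 2 →
        f x t - N * R ^ 2 / (R ^ 2 - x ^ 2) ^ 2 < 0 := by
      intro t htt x hx hxr
      have h1 := hP' x (hinR hx) t htt
      have h2 := hin x hx
      rw [hxr] at h2 ⊢
      have : P + 1 < N * R ^ 2 / (R ^ 2 - r ^ 2) ^ 2 := by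
        rw [lt_div_iff₀ (by positivity)]; linarith
      linarith
    have hmain := neg_on_box_of_no_first_touch (R := r) (S := t₀)
      (f := fun y t => f y t - N * R ^ 2 / (R ^ 2 - y ^ 2) ^ 2)
      (ft := fun y t => ft y t * σ t)
      (fy := fun y t => fy y t - 4 * N * R ^ 2 * y / (R ^ 2 - y ^ 2) ^ 3)
      (fyy := fun y t => fyy y t -
        N * R ^ 2 * (4 * (R ^ 2 - y ^ 2) + 24 * y ^ 2) / (R ^ 2 - y ^ 2) ^ 4)
      ?_ ?_ ?_ ?_ ?_ ?_ ?_
    · have hyR : y₁ ∈ Icc (-r) r := abs_le.1 hrI.1.le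
      have := hmain y₁ hyR t₀ ⟨ht₀.1, le_rfl⟩
      linarith
    · refine (hf.mono (prod_mono (subset_univ _) hsub)).sub ?_
      refine ContinuousOn.div (by fun_prop) (by fun_prop) ?_
      intro z hz
      have := hin z.1 hz.1
      positivity
    · intro y hy
      have h1 := hin y hy
      have h2 : 0 < N * R ^ 2 / (R ^ 2 - y ^ 2) ^ 2 := by positivity
      have := h0 y
      linarith
    · exact fun t htt => ⟨hbd t htt r ⟨by linarith, le_rfl⟩ rfl,
        hbd t htt (-r) ⟨le_rfl, by linarith⟩ (by ring)⟩
    · intro y _ t htt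
      exact (ht t (hsub' htt) y).sub_const _
    · intro y hyr t htt
      have h0 := hin y (Ioo_subset_Icc_self hyr)
      have h1 : HasDerivAt (fun x : ℝ => N * R ^ 2 / (R ^ 2 - x ^ 2) ^ 2)
          (4 * N * R ^ 2 * y / (R ^ 2 - y ^ 2) ^ 3) y := by
        refine ((hasDerivAt_const y (N * R ^ 2)).div
          ((((hasDerivAt_id' y).pow 2).const_sub (R ^ 2)).pow 2) (by simp; positivity)).congr_deriv ?_
        simp; field_simp; ring
      exact (hy t (hsub' htt) y).sub h1
    · intro y hyr t htt
      have h0 := hin y (Ioo_subset_Icc_self hyr)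
      have h1 : HasDerivAt (fun x : ℝ => 4 * N * R ^ 2 * x / (R ^ 2 - x ^ 2) ^ 3)
          (N * R ^ 2 * (4 * (R ^ 2 - y ^ 2) + 24 * y ^ 2) / (R ^ 2 - y ^ 2) ^ 4) y := by
        refine (((hasDerivAt_id' y).const_mul (4 * N * R ^ 2)).div
          ((((hasDerivAt_id' y).pow 2).const_sub (R ^ 2)).pow 3) (by simp; positivity)).congr_deriv ?_
        simp; field_simp; ring
      exact (hyy t (hsub' htt) y).sub h1
    · intro y hyr t htt e0 e1 e2 e3
      have hs := hσ t (hsub' htt)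
      have hD := hin y (Ioo_subset_Icc_self hyr)
      have e3' : 0 ≤ ft y t := nonneg_of_mul_nonneg_left e3 hs
      have e0' : f y t = N * R ^ 2 / (R ^ 2 - y ^ 2) ^ 2 := by linarith
      have hfpos : 0 < f y t := by rw [e0']; positivity
      have hp := hpde t (hsub' htt) y hfpos
      have hA0 := hA t (hsub' htt) y
      have ha0 := ha t (hsub' htt)
      have e1' : 0 ≤ a t * y * fy y t := by
        have : fy y t = 4 * N * R ^ 2 * y / (R ^ 2 - y ^ 2) ^ 3 := by linarith
        rw [this]
        have : a t * y * (4 * N * R ^ 2 * y / (R ^ 2 - y ^ 2) ^ 3) =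
          a t * (4 * N * R ^ 2 * y ^ 2 / (R ^ 2 - y ^ 2) ^ 3) := by ring
        rw [this]; positivity
      have e2' : fyy y t ≤ c₀ * f y t ^ 2 := by
        have h1 : c₀ * f y t ^ 2 = N * R ^ 2 * (24 * R ^ 2) / (R ^ 2 - y ^ 2) ^ 4 := by
          rw [e0', ← hNc]; field_simp
        rw [h1]
        have h2 : N * R ^ 2 * (4 * (R ^ 2 - y ^ 2) + 24 * y ^ 2) / (R ^ 2 - y ^ 2) ^ 4 ≤
            N * R ^ 2 * (24 * R ^ 2) / (R ^ 2 - y ^ 2) ^ 4 := by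
          gcongr; nlinarith
        linarith
      have e4 := mul_le_mul_of_nonneg_left e2' hA0
      have e5 := mul_pos hc₁ hfpos
      nlinarith
  -- At fixed y₁ the barrier is of order N/R², so it disappears as R → ∞.
  have hlim : Tendsto (fun R : ℝ => N * R ^ 2 / (R ^ 2 - y₁ ^ 2) ^ 2) atTop (𝓝 0) := by
    have h1 : Tendsto (fun R : ℝ => 4 * N / R ^ 2) atTop (𝓝 0) :=
      tendsto_const_nhds.div_atTop (tendsto_pow_atTop two_ne_zero)
    refine tendsto_of_tendsto_of_tendsto_of_le_of_le' tendsto_const_nhds h1 ?_ ?_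
    · exact Eventually.of_forall fun R => by positivity
    · filter_upwards [eventually_ge_atTop (2 * |y₁| + 1)] with R hR
      have h0 := abs_nonneg y₁
      have h2 : R ^ 2 / 2 ≤ R ^ 2 - y₁ ^ 2 := by rw [← sq_abs y₁]; nlinarith
      have h3 : 0 < R := by linarith
      rw [div_le_div_iff₀ (by have : 0 < R ^ 2 / 2 := by positivity
                              have := this.trans_le h2
                              positivity) (by positivity)]
      have h4 : (R ^ 2 / 2) ^ 2 ≤ (R ^ 2 - y₁ ^ 2) ^ 2 := by gcongr
      nlinarith
  exact ge_of_tendsto hlim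
    (by filter_upwards [eventually_ge_atTop (|y₁| + 1)] with R hR using (key R hR).le)

/-! ### The ellipticity coefficient and its derivatives -/

/-- The ellipticity coefficient `1 / (1 + w²)`; `ellip₁`, …, `ellip₄` are its derivatives. -/
noncomputable def ellip (w : ℝ) : ℝ := (1 + w ^ 2)⁻¹
noncomputable def ellip₁ (w : ℝ) : ℝ := -2 * w * ellip w ^ 2
noncomputable def ellip₂ (w : ℝ) : ℝ := (6 * w ^ 2 - 2) * ellip w ^ 3
noncomputable def ellip₃ (w : ℝ) : ℝ := 24 * w * (1 - w ^ 2) * ellip w ^ 4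
noncomputable def ellip₄ (w : ℝ) : ℝ := 24 * (1 - 10 * w ^ 2 + 5 * w ^ 4) * ellip w ^ 5

theorem ellip_pos (w : ℝ) : 0 < ellip w := by unfold ellip; positivity

theorem ellip_mul (w : ℝ) : ellip w * (1 + w ^ 2) = 1 := by
  unfold ellip; exact inv_mul_cancel₀ (by positivity)

theorem ellip_le_one (w : ℝ) : ellip w ≤ 1 := by
  nlinarith [ellip_mul w, ellip_pos w, mul_nonneg (ellip_pos w).le (sq_nonneg w)]

theorem sq_mul_ellip_le_one (w : ℝ) : w ^ 2 * ellip w ≤ 1 := by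
  nlinarith [ellip_mul w, ellip_pos w]

theorem hasDerivAt_ellip (w : ℝ) : HasDerivAt ellip (ellip₁ w) w := by
  refine ((((hasDerivAt_id' w).pow 2).const_add 1).inv (by simp; positivity)).congr_deriv ?_
  simp [ellip₁, ellip]; field_simp

theorem hasDerivAt_ellip₁ (w : ℝ) : HasDerivAt ellip₁ (ellip₂ w) w := by
  refine (((hasDerivAt_id' w).const_mul (-2)).mul ((hasDerivAt_ellip w).pow 2)).congr_deriv ?_
  simp only [ellip₁, ellip₂, Pi.pow_apply]
  have h : 1 = ellip w * (1 + w ^ 2) := (ellip_mul w).symm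
  norm_num
  linear_combination (-2 * ellip w ^ 2) * h

theorem hasDerivAt_ellip₂ (w : ℝ) : HasDerivAt ellip₂ (ellip₃ w) w := by
  refine (((((hasDerivAt_id' w).pow 2).const_mul 6).sub_const 2).mul
    ((hasDerivAt_ellip w).pow 3)).congr_deriv ?_
  simp only [ellip₁, ellip₃, Pi.pow_apply]
  have h : 1 = ellip w * (1 + w ^ 2) := (ellip_mul w).symm
  norm_num
  linear_combination (12 * w * ellip w ^ 3) * h

theorem hasDerivAt_ellip₃ (w : ℝ) : HasDerivAt ellip₃ (ellip₄ w) w := by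
  refine ((((hasDerivAt_id' w).const_mul 24).mul (((hasDerivAt_id' w).pow 2).const_sub 1)).mul
    ((hasDerivAt_ellip w).pow 4)).congr_deriv ?_
  simp only [ellip₁, ellip₄, Pi.pow_apply, Pi.mul_apply]
  have h : 1 = ellip w * (1 + w ^ 2) := (ellip_mul w).symm
  norm_num
  linear_combination (24 * (1 - 3 * w ^ 2) * ellip w ^ 4) * h

/-- Since 2|w| ≤ 1 + w². The factor `ellip` is kept on the right because the good terms of the
Bernstein argument degenerate with it where the gradient is large, and the error terms must
degenerate at the same rate. -/
theorem abs_ellip₁_le (w : ℝ) : |ellip₁ w| ≤ ellip w := by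
  have h := ellip_mul w
  have h0 := ellip_pos w
  have : ellip w = ellip w ^ 2 * (1 + w ^ 2) := by linear_combination (-ellip w) * h
  rw [abs_le]; unfold ellip₁
  constructor <;> nlinarith [mul_nonneg (sq_nonneg (ellip w)) (sq_nonneg (w - 1)),
    mul_nonneg (sq_nonneg (ellip w)) (sq_nonneg (w + 1))]

theorem abs_ellip₂_le (w : ℝ) : |ellip₂ w| ≤ 6 := by
  have h := ellip_pos w
  have h1 := ellip_le_one w
  have h2 := sq_mul_ellip_le_one w
  have h3 : ellip w ^ 2 ≤ 1 := pow_le_one₀ h.le h1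
  have e : ellip₂ w = (6 * (w ^ 2 * ellip w) - 2 * ellip w) * ellip w ^ 2 := by
    unfold ellip₂; ring
  have h4 : 0 ≤ w ^ 2 * ellip w := by positivity
  rw [e, abs_mul, abs_of_nonneg (sq_nonneg (ellip w))]
  have h5 : |6 * (w ^ 2 * ellip w) - 2 * ellip w| ≤ 6 := abs_le.2 ⟨by linarith, by linarith⟩
  calc _ ≤ (6 : ℝ) * 1 := by gcongr
    _ = 6 := by norm_num

theorem abs_ellip₃_le (w : ℝ) : |ellip₃ w| ≤ 24 := by
  have h := ellip_pos w
  have h1 := ellip_le_one w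
  have h2 := sq_mul_ellip_le_one w
  have h4 : 0 ≤ w ^ 2 * ellip w := by positivity
  have e : ellip₃ w = -12 * ellip₁ w * (ellip w - w ^ 2 * ellip w) * ellip w := by
    unfold ellip₃ ellip₁; ring
  have h5 : |ellip w - w ^ 2 * ellip w| ≤ 1 := abs_le.2 ⟨by linarith, by linarith⟩
  rw [e, abs_mul, abs_mul, abs_mul, abs_of_pos h]
  calc _ ≤ |(-12 : ℝ)| * 1 * 1 * 1 := by gcongr; exact (abs_ellip₁_le w).trans h1
    _ ≤ 24 := by norm_num

theorem abs_ellip₄_le (w : ℝ) : |ellip₄ w| ≤ 384 := by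
  have h := ellip_pos w
  have h1 := ellip_le_one w
  have h2 := sq_mul_ellip_le_one w
  have h4 : 0 ≤ w ^ 2 * ellip w := by positivity
  have e : ellip₄ w = 24 * (ellip w ^ 2 - 10 * ((w ^ 2 * ellip w) * ellip w)
      + 5 * (w ^ 2 * ellip w) ^ 2) * ellip w ^ 3 := by unfold ellip₄; ring
  have h3 : ellip w ^ 3 ≤ 1 := pow_le_one₀ h.le h1
  have h6 : ellip w ^ 2 ≤ 1 := pow_le_one₀ h.le h1
  have h7 : (w ^ 2 * ellip w) ^ 2 ≤ 1 := pow_le_one₀ h4 h2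
  have h8 : (w ^ 2 * ellip w) * ellip w ≤ 1 := mul_le_one₀ h2 h.le h1
  have h9 : 0 ≤ (w ^ 2 * ellip w) * ellip w := by positivity
  have h5 : |ellip w ^ 2 - 10 * ((w ^ 2 * ellip w) * ellip w) + 5 * (w ^ 2 * ellip w) ^ 2| ≤ 16 :=
    abs_le.2 ⟨by nlinarith [sq_nonneg (ellip w), sq_nonneg (w ^ 2 * ellip w)], by linarith⟩
  rw [e, abs_mul, abs_mul, abs_of_pos (pow_pos h 3)]
  calc _ ≤ |(24 : ℝ)| * 16 * 1 := by gcongr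
    _ ≤ 384 := by norm_num

/-! ### The rescaled flow and the equations for its derivatives -/

/-- The rescaled flow on `[0, S]` in the original time `t`, whose rescaled clock runs at the rate `σ`:
`V n` is the `n`-th space derivative of the solution, and `N n` the `n`-th space derivative of the
right hand side `∂²v / (1 + (∂v)²) - m / v`. -/
structure RescaledFlow (m S : ℝ) (σ a : ℝ → ℝ) (V N : ℕ → ℝ → ℝ → ℝ) : Prop where
  time_pos : 0 < S
  rate_pos : ∀ t ∈ Ioo 0 S, 0 < σ t
  pos : ∀ t ∈ Icc 0 S, ∀ y, 0 < V 0 y t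
  cont : ∀ n ≤ 4, ContinuousOn (fun z : ℝ × ℝ => V n z.1 z.2) (univ ×ˢ Icc 0 S)
  dy : ∀ t ∈ Ioo 0 S, ∀ n y, HasDerivAt (fun x => V n x t) (V (n + 1) y t) y
  dyN : ∀ t ∈ Ioo 0 S, ∀ n y, HasDerivAt (fun x => N n x t) (N (n + 1) y t) y
  N_zero : ∀ t ∈ Ioo 0 S, ∀ y, N 0 y t = ellip (V 1 y t) * V 2 y t - m / V 0 y t
  -- The commutator [∂ⁿ, y∂] = n∂ⁿ turns -a y ∂v + a v into -a y ∂ⁿ⁺¹v + (1 - n) a ∂ⁿv, so each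
  -- derivative brings one more unit of damping.
  dt : ∀ t ∈ Ioo 0 S, ∀ n y, HasDerivAt (V n y)
    ((N n y t - a t * y * V (n + 1) y t + (1 - n) * a t * V n y t) * σ t) t

namespace RescaledFlow

variable {m S : ℝ} {σ a : ℝ → ℝ} {V N : ℕ → ℝ → ℝ → ℝ}

/-- `dyN` determines each `N (n + 1)` as the derivative of `N n`, so uniqueness of derivatives
yields the formulas for `N 1` to `N 4` successively from `N_zero`. The leading term is always the
diffusion `ellip (V 1) * V (n + 2)`. -/
theorem N_one (h : RescaledFlow m S σ a V N) {t : ℝ} (ht : t ∈ Ioo 0 S) (y : ℝ) :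
    N 1 y t = ellip (V 1 y t) * V 3 y t + ellip₁ (V 1 y t) * V 2 y t ^ 2
      + m * V 1 y t / V 0 y t ^ 2 := by
  have hv := (h.pos t (Ioo_subset_Icc_self ht) y).ne'
  have e : (fun x => N 0 x t) = fun x => ellip (V 1 x t) * V 2 x t - m / V 0 x t :=
    funext fun x => h.N_zero t ht x
  have h1 := h.dyN t ht 0 y
  rw [e] at h1
  refine h1.unique ?_
  refine ((((hasDerivAt_ellip _).comp y (h.dy t ht 1 y)).mul (h.dy t ht 2 y)).sub
    ((hasDerivAt_const y m).div (h.dy t ht 0 y) hv)).congr_deriv ?_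
  simp only [Function.comp_apply, Nat.reduceAdd]; field_simp; ring

theorem N_two (h : RescaledFlow m S σ a V N) {t : ℝ} (ht : t ∈ Ioo 0 S) (y : ℝ) :
    N 2 y t = ellip (V 1 y t) * V 4 y t + 3 * (ellip₁ (V 1 y t) * V 2 y t * V 3 y t)
      + ellip₂ (V 1 y t) * V 2 y t ^ 3 + m * V 2 y t / V 0 y t ^ 2
      - 2 * m * V 1 y t ^ 2 / V 0 y t ^ 3 := by
  have hv := (h.pos t (Ioo_subset_Icc_self ht) y).ne'
  have h1 := h.dyN t ht 1 y
  rw [show (fun x => N 1 x t) = _ from funext fun x => h.N_one ht x] at h1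
  refine h1.unique ?_
  refine (((((hasDerivAt_ellip _).comp y (h.dy t ht 1 y)).mul (h.dy t ht 3 y)).add
    (((hasDerivAt_ellip₁ _).comp y (h.dy t ht 1 y)).mul ((h.dy t ht 2 y).pow 2))).add
    (((h.dy t ht 1 y).const_mul m).div ((h.dy t ht 0 y).pow 2) (pow_ne_zero 2 hv))).congr_deriv ?_
  simp only [Function.comp_apply, Nat.reduceAdd, Pi.pow_apply]; field_simp; norm_num; ring

theorem N_three (h : RescaledFlow m S σ a V N) {t : ℝ} (ht : t ∈ Ioo 0 S) (y : ℝ) :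
    N 3 y t = ellip (V 1 y t) * V 5 y t + 4 * (ellip₁ (V 1 y t) * V 2 y t * V 4 y t)
      + 3 * (ellip₁ (V 1 y t) * V 3 y t ^ 2) + 6 * (ellip₂ (V 1 y t) * V 2 y t ^ 2 * V 3 y t)
      + ellip₃ (V 1 y t) * V 2 y t ^ 4 + m * V 3 y t / V 0 y t ^ 2
      - 6 * m * (V 1 y t * V 2 y t) / V 0 y t ^ 3 + 6 * m * V 1 y t ^ 3 / V 0 y t ^ 4 := by
  have hv := (h.pos t (Ioo_subset_Icc_self ht) y).ne'
  have h1 := h.dyN t ht 2 y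
  rw [show (fun x => N 2 x t) = _ from funext fun x => h.N_two ht x] at h1
  refine h1.unique ?_
  have d0 := h.dy t ht 0 y
  have d1 := h.dy t ht 1 y
  have d2 := h.dy t ht 2 y
  have d3 := h.dy t ht 3 y
  have d4 := h.dy t ht 4 y
  refine ((((((hasDerivAt_ellip _).comp y d1).mul d4).add
    (((((hasDerivAt_ellip₁ _).comp y d1).mul d2).mul d3).const_mul 3)).add
    (((hasDerivAt_ellip₂ _).comp y d1).mul (d2.pow 3))).add
    ((d2.const_mul m).div (d0.pow 2) (pow_ne_zero 2 hv))).sub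
    (((d1.pow 2).const_mul (2 * m)).div (d0.pow 3) (pow_ne_zero 3 hv)) |>.congr_deriv ?_
  simp only [Function.comp_apply, Nat.reduceAdd, Pi.pow_apply, Pi.mul_apply]
  field_simp; norm_num; ring

theorem N_four (h : RescaledFlow m S σ a V N) {t : ℝ} (ht : t ∈ Ioo 0 S) (y : ℝ) :
    N 4 y t = ellip (V 1 y t) * V 6 y t + 5 * (ellip₁ (V 1 y t) * V 2 y t * V 5 y t)
      + 10 * (ellip₁ (V 1 y t) * V 3 y t * V 4 y t)
      + 10 * (ellip₂ (V 1 y t) * V 2 y t ^ 2 * V 4 y t)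
      + 15 * (ellip₂ (V 1 y t) * V 2 y t * V 3 y t ^ 2)
      + 10 * (ellip₃ (V 1 y t) * V 2 y t ^ 3 * V 3 y t) + ellip₄ (V 1 y t) * V 2 y t ^ 5
      + m * V 4 y t / V 0 y t ^ 2 - 8 * m * (V 1 y t * V 3 y t) / V 0 y t ^ 3
      - 6 * m * V 2 y t ^ 2 / V 0 y t ^ 3 + 36 * m * (V 1 y t ^ 2 * V 2 y t) / V 0 y t ^ 4
      - 24 * m * V 1 y t ^ 4 / V 0 y t ^ 5 := by
  have hv := (h.pos t (Ioo_subset_Icc_self ht) y).ne'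
  have h1 := h.dyN t ht 3 y
  rw [show (fun x => N 3 x t) = _ from funext fun x => h.N_three ht x] at h1
  refine h1.unique ?_
  have d0 := h.dy t ht 0 y
  have d1 := h.dy t ht 1 y
  have d2 := h.dy t ht 2 y
  have d3 := h.dy t ht 3 y
  have d4 := h.dy t ht 4 y
  have d5 := h.dy t ht 5 y
  have e1 := (hasDerivAt_ellip₁ _).comp y d1
  have e2 := (hasDerivAt_ellip₂ _).comp y d1
  refine (((((((((hasDerivAt_ellip _).comp y d1).mul d5).add
    (((e1.mul d2).mul d4).const_mul 4)).add ((e1.mul (d3.pow 2)).const_mul 3)).add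
    (((e2.mul (d2.pow 2)).mul d3).const_mul 6)).add
    (((hasDerivAt_ellip₃ _).comp y d1).mul (d2.pow 4))).add
    ((d3.const_mul m).div (d0.pow 2) (pow_ne_zero 2 hv))).sub
    (((d1.mul d2).const_mul (6 * m)).div (d0.pow 3) (pow_ne_zero 3 hv))).add
    (((d1.pow 3).const_mul (6 * m)).div (d0.pow 4) (pow_ne_zero 4 hv)) |>.congr_deriv ?_
  simp only [Function.comp_apply, Nat.reduceAdd, Pi.pow_apply, Pi.mul_apply]
  field_simp; norm_num; ring

end RescaledFlow

/-! ### Neck flows: lower bound and gradient estimate -/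

/-- A rescaled flow together with the clock `τ`, the comparison function `β`, a priori bounds in the
inner region `β y² ≤ 20 m`, and initial bounds in terms of `κ`. -/
structure NeckFlow (m S κ : ℝ) (σ a τ β : ℝ → ℝ) (V N : ℕ → ℝ → ℝ → ℝ) : Prop
    extends RescaledFlow m S σ a V N where
  one_le : 1 ≤ m
  clock_cont : ContinuousOn τ (Icc 0 S)
  clock_nonneg : ∀ t ∈ Icc 0 S, 0 ≤ τ t
  clock_deriv : ∀ t ∈ Ioo 0 S, HasDerivAt τ (σ t) t
  beta_cont : ContinuousOn β (Icc 0 S)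
  beta_pos : ∀ t ∈ Icc 0 S, 0 < β t
  beta_anti : AntitoneOn β (Icc 0 S)
  beta_deriv : ∀ t ∈ Ioo 0 S, HasDerivAt β (-(β t ^ 2 / m) * σ t) t
  a_near : ∀ t ∈ Icc 0 S, |a t - 1 / 2| ≤ 1 / 100
  inner_lower : ∀ t ∈ Icc 0 S, ∀ y, β t * y ^ 2 ≤ 20 * m → 81 / 50 * m ≤ V 0 y t ^ 2
  inner_one : ∀ t ∈ Icc 0 S, ∀ y, β t * y ^ 2 ≤ 20 * m → V 1 y t ^ 2 ≤ 9 * β t * V 0 y t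
  inner_two : ∀ t ∈ Icc 0 S, ∀ y, β t * y ^ 2 ≤ 20 * m → |V 2 y t| ≤ 4 * β t
  boundary : ∀ t ∈ Icc 0 S, ∀ y, β t * y ^ 2 = 20 * m → 16 * m < V 0 y t ^ 2
  growth : ∃ C : ℝ, ∀ t ∈ Icc 0 S, ∀ y,
    |V 1 y t| ≤ C * (1 + y ^ 2) ∧ |V 2 y t| ≤ C * (1 + |y|)
  init_lower : ∀ y, 20 * m ≤ β 0 * y ^ 2 → 16 * m ≤ V 0 y 0 ^ 2
  init_one : ∀ y, V 1 y 0 ^ 2 ≤ κ ^ 2 * β 0 * V 0 y 0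
  init_bdd : ∃ W : ℝ, ∀ y, |V 1 y 0| ≤ W
  init_higher : ∀ n ∈ Icc 2 4, ∀ y, V n y 0 ^ 2 ≤ κ ^ 2 * β 0 ^ n

namespace NeckFlow

variable {m S κ : ℝ} {σ a τ β : ℝ → ℝ} {V N : ℕ → ℝ → ℝ → ℝ}

theorem continuousOn_time (h : NeckFlow m S κ σ a τ β V N) {n : ℕ} (hn : n ≤ 4) (y : ℝ) :
    ContinuousOn (V n y) (Icc 0 S) := by
  have : ContinuousOn (fun t : ℝ => ((y, t) : ℝ × ℝ)) (Icc 0 S) := by fun_prop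
  exact (h.cont n hn).comp this fun t ht => ⟨mem_univ _, ht⟩

theorem a_bounds (h : NeckFlow m S κ σ a τ β V N) {t : ℝ} (ht : t ∈ Icc 0 S) :
    49 / 100 ≤ a t ∧ a t ≤ 51 / 100 := by
  have := abs_le.1 (h.a_near t ht)
  constructor <;> linarith [this.1, this.2]

theorem continuousOn_clock_fst (h : NeckFlow m S κ σ a τ β V N) :
    ContinuousOn (fun z : ℝ × ℝ => τ z.2) (univ ×ˢ Icc 0 S) :=
  h.clock_cont.comp continuousOn_snd fun _ hz => hz.2

theorem continuousOn_beta_fst (h : NeckFlow m S κ σ a τ β V N) :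
    ContinuousOn (fun z : ℝ × ℝ => β z.2) (univ ×ˢ Icc 0 S) :=
  h.beta_cont.comp continuousOn_snd fun _ hz => hz.2

/-- The lower bound outside the inner region, up to a small error. -/
theorem outer_lower_aux (h : NeckFlow m S κ σ a τ β V N) {t₀ y₀ ε : ℝ} (ht₀ : t₀ ∈ Ioo 0 S)
    (hy₀ : 20 * m ≤ β t₀ * y₀ ^ 2) (hε : 0 < ε) :
    16 * m - ε * (Real.exp (7 * τ t₀) * (1 + y₀ ^ 2)) < V 0 y₀ t₀ ^ 2 := by
  have hm := h.one_le
  -- With 16 m < ε R the modified lower bound is already negative at |y| = R, so no touching can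
  -- occur there.
  set R : ℝ := |y₀| + 16 * m / ε + 1 with hR
  have hmε : 0 ≤ 16 * m / ε := by positivity
  have hR1 : 1 ≤ R := by have := abs_nonneg y₀; linarith
  have hRm : 16 * m < ε * R := by
    have h1 : ε * R = ε * |y₀| + 16 * m + ε := by rw [hR]; field_simp
    have := mul_nonneg hε.le (abs_nonneg y₀); linarith
  have hsub : Icc 0 t₀ ⊆ Icc 0 S := Icc_subset_Icc le_rfl ht₀.2.le
  have hsub' : Ioc 0 t₀ ⊆ Ioo 0 S := fun t h => ⟨h.1, h.2.trans_lt ht₀.2⟩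
  have hbox : Icc (-R) R ×ˢ Icc 0 t₀ ⊆ univ ×ˢ Icc 0 S := prod_mono (subset_univ _) hsub
  have hexp : ∀ t ∈ Icc 0 t₀, 1 ≤ Real.exp (7 * τ t) := fun t ht =>
    Real.one_le_exp (mul_nonneg (by norm_num) (h.clock_nonneg t (hsub ht)))
  have hcv := h.cont 0 (by norm_num)
  have hKc : IsCompact ((Icc (-R) R ×ˢ Icc 0 t₀) ∩
      (fun z : ℝ × ℝ => β z.2 * z.1 ^ 2) ⁻¹' Ici (20 * m)) := by
    refine (isCompact_Icc.prod isCompact_Icc).of_isClosed_subset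
      (ContinuousOn.preimage_isClosed_of_isClosed ?_ (isClosed_Icc.prod isClosed_Icc) isClosed_Ici)
      inter_subset_left
    exact (h.continuousOn_beta_fst.mono hbox).mul (by fun_prop)
  -- A touching point avoids the whole parabolic boundary: the sides by the choice of R, the initial
  -- time by `init_lower`, and the moving interface β y² = 20 m by `boundary`.
  have key : ∀ y t, (y, t) ∈ (Icc (-R) R ×ˢ Icc 0 t₀) ∩
      (fun z : ℝ × ℝ => β z.2 * z.1 ^ 2) ⁻¹' Ici (20 * m) →
      0 ≤ 16 * m - ε * (Real.exp (7 * τ t) * (1 + y ^ 2)) - V 0 y t ^ 2 →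
      y ∈ Ioo (-R) R ∧ t ∈ Ioc 0 t₀ ∧ 20 * m < β t * y ^ 2 := by
    rintro y t ⟨⟨hy, ht⟩, hβ⟩ hge
    simp only [mem_preimage, mem_Ici] at hy ht hβ
    have hv := h.pos t (hsub ht) y
    have hE := hexp t ht
    have hE' : ε * (1 * (1 + y ^ 2)) ≤ ε * (Real.exp (7 * τ t) * (1 + y ^ 2)) := by gcongr
    have hyR : y ^ 2 ≠ R ^ 2 := by
      intro e
      rw [e] at hE' hge
      nlinarith [sq_nonneg (V 0 y t)]
    refine ⟨⟨lt_of_le_of_ne hy.1 ?_, lt_of_le_of_ne hy.2 ?_⟩, ⟨lt_of_le_of_ne ht.1 ?_, ht.2⟩,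
      lt_of_le_of_ne hβ ?_⟩
    · rintro rfl; exact hyR (by ring)
    · rintro rfl; exact hyR rfl
    · rintro rfl
      have := h.init_lower y hβ
      have : 0 < ε * (1 * (1 + y ^ 2)) := by positivity
      linarith
    · intro e
      have := h.boundary t (hsub ht) y e.symm
      have : 0 < ε * (1 * (1 + y ^ 2)) := by positivity
      linarith
  have hmain := neg_of_no_first_touch hKc
    (f := fun y t => 16 * m - ε * (Real.exp (7 * τ t) * (1 + y ^ 2)) - V 0 y t ^ 2)
    (ft := fun y t => (-(ε * (7 * Real.exp (7 * τ t) * (1 + y ^ 2))) -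
      2 * V 0 y t * (N 0 y t - a t * y * V 1 y t + a t * V 0 y t)) * σ t)
    (fy := fun y t => -(ε * (Real.exp (7 * τ t) * (2 * y))) - 2 * V 0 y t * V 1 y t)
    (fyy := fun y t => -(ε * (Real.exp (7 * τ t) * 2)) -
      (2 * V 1 y t * V 1 y t + 2 * V 0 y t * V 2 y t))
    ?_ ?_ ?_ ?_ ?_ ?_
  · have hyR : y₀ ∈ Icc (-R) R := abs_le.1 (by linarith)
    have := hmain (y₀, t₀) ⟨⟨hyR, ht₀.1.le, le_rfl⟩, hy₀⟩
    simp only at this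
    linarith
  · have h1 := h.continuousOn_clock_fst.mono hbox
    have h2 := hcv.mono hbox
    refine ContinuousOn.mono ?_ inter_subset_left
    exact (continuousOn_const.sub (continuousOn_const.mul
      ((continuousOn_const.mul h1).rexp.mul (by fun_prop)))).sub (h2.pow 2)
  · intro y t hyt hge
    obtain ⟨h1, h2, h3⟩ := key y t hyt hge
    constructor
    · have : ∀ᶠ x in 𝓝 y, 20 * m < β t * x ^ 2 :=
        (show Continuous fun x : ℝ => β t * x ^ 2 by fun_prop).continuousAt.eventually
          (lt_mem_nhds h3)
      filter_upwards [Ioo_mem_nhds h1.1 h1.2, this] with x hx hx' using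
        ⟨⟨Ioo_subset_Icc_self hx, hyt.1.2⟩, hx'.le⟩
    · have hc := (h.beta_deriv t (hsub' h2)).continuousAt
      have : ∀ᶠ s in 𝓝 t, 20 * m < β s * y ^ 2 :=
        (hc.mul continuousAt_const).eventually (lt_mem_nhds h3)
      filter_upwards [Ioo_mem_nhdsLT h2.1, nhdsWithin_le_nhds this] with s hs hs' using
        ⟨⟨hyt.1.1, hs.1.le, hs.2.le.trans h2.2⟩, hs'.le⟩
  · intro y t hyt hge
    obtain ⟨h1, h2, h3⟩ := key y t hyt hge
    have e1 := (((h.clock_deriv t (hsub' h2)).const_mul 7).exp.mul_const (1 + y ^ 2)).const_mul ε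
    exact ((e1.const_sub (16 * m)).sub ((h.dt t (hsub' h2) 0 y).pow 2)).congr_deriv
      (by push_cast; ring)
  · intro y t hyt hge
    obtain ⟨h1, h2, h3⟩ := key y t hyt hge
    refine Eventually.of_forall fun x => ?_
    have e1 := (((((hasDerivAt_id' x).pow 2).const_add 1).const_mul
      (Real.exp (7 * τ t))).const_mul ε).const_sub (16 * m)
    exact (e1.sub ((h.dy t (hsub' h2) 0 x).pow 2)).congr_deriv (by push_cast; ring)
  · intro y t hyt hge
    obtain ⟨h1, h2, h3⟩ := key y t hyt hge
    have e1 := ((((hasDerivAt_id' y).const_mul 2).const_mul (Real.exp (7 * τ t))).const_mul ε).neg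
    exact (e1.sub (((h.dy t (hsub' h2) 0 y).const_mul 2).mul (h.dy t (hsub' h2) 1 y))).congr_deriv
      (by ring)
  · intro y t hyt e0 e1 e2 e3
    obtain ⟨h1, h2, h3⟩ := key y t hyt e0.ge
    have ht := hsub' h2
    have hv := h.pos t (Ioo_subset_Icc_self ht) y
    have e3' := nonneg_of_mul_nonneg_left e3 (h.rate_pos t ht)
    rw [h.N_zero t ht y] at e3'
    obtain ⟨ha1, ha2⟩ := h.a_bounds (Ioo_subset_Icc_self ht)
    have hA := ellip_pos (V 1 y t)
    have hA1 := ellip_le_one (V 1 y t)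
    have hA2 := sq_mul_ellip_le_one (V 1 y t)
    set v := V 0 y t
    set w := V 1 y t
    set z := V 2 y t
    set A := ellip w
    set E : ℝ := ε * Real.exp (7 * τ t) with hE
    have hEpos : 0 < E := by positivity
    have f0 : v ^ 2 = 16 * m - E * (1 + y ^ 2) := by rw [hE]; linarith
    have f1 : v * w = -(E * y) := by rw [hE]; linarith
    have f2 : -E - w ^ 2 ≤ v * z := by rw [hE]; linarith
    have f3 : 0 ≤ -7 * (E * (1 + y ^ 2)) - 2 * (A * (v * z)) + 2 * m
        + 2 * a t * (y * (v * w)) - 2 * a t * v ^ 2 := by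
      have : 2 * v * (A * z - m / v - a t * y * w + a t * v) =
        2 * (A * (v * z)) - 2 * m - 2 * a t * (y * (v * w)) + 2 * a t * v ^ 2 := by
        field_simp
      rw [hE]; linarith
    rw [f1] at f3
    have f4 : A * (-E - w ^ 2) ≤ A * (v * z) := mul_le_mul_of_nonneg_left f2 hA.le
    have f5 : A * E ≤ E := by nlinarith
    have f6 : 0 ≤ a t * (E * y ^ 2) := by
      have : 0 ≤ a t := by linarith
      positivity
    have f7 : 0 ≤ E * y ^ 2 := by positivity
    have f8 : 49 / 100 * v ^ 2 ≤ a t * v ^ 2 := by gcongr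
    -- In terms of E the touching conditions read v² = 16m - E(1 + y²) and v w = -E y. If v² ≥ 15m,
    -- then E y² ≤ m, which forces 15w² ≤ E, and the reaction m - a v² is negative. Otherwise E(1 +
    -- y²) > m, and the rate 7 pays for everything: -5m + 2m + 2 < 0, since m ≥ 1 and `ellip w * w ^
    -- 2 ≤ 1`.
    rcases le_or_gt (15 * m) (v ^ 2) with hbig | hsmall
    · have g1 : v ^ 2 * w ^ 2 = E * (E * y ^ 2) := by
        calc v ^ 2 * w ^ 2 = (v * w) ^ 2 := by ring
          _ = _ := by rw [f1]; ring
      have g2 : 15 * m * w ^ 2 ≤ E * m := by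
        have : 15 * m * w ^ 2 ≤ v ^ 2 * w ^ 2 := by gcongr
        have : E * (E * y ^ 2) ≤ E * m := by gcongr; linarith
        linarith
      have g3 : 15 * w ^ 2 ≤ E := by
        have : m * (15 * w ^ 2) ≤ m * E := by linarith
        exact le_of_mul_le_mul_left this (by linarith)
      have g4 : A * w ^ 2 ≤ w ^ 2 := by nlinarith [sq_nonneg w]
      linarith
    · linarith [sq_nonneg v]

theorem outer_lower (h : NeckFlow m S κ σ a τ β V N) :
    ∀ t ∈ Icc 0 S, ∀ y, 20 * m ≤ β t * y ^ 2 → 16 * m ≤ V 0 y t ^ 2 := by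
  intro t₁ ht₁ y hy
  have hS := h.time_pos
  -- Since β decreases, the outer region shrinks in time: a point that is outer at t₁ was outer at
  -- all earlier times, which is needed for the limit t → S.
  have hout : ∀ t ∈ Icc 0 S, t ≤ t₁ → 20 * m ≤ β t * y ^ 2 := fun t ht htt =>
    hy.trans (mul_le_mul_of_nonneg_right (h.beta_anti ht ht₁ htt) (sq_nonneg y))
  have hlt : ∀ t ∈ Ico 0 S, t ≤ t₁ → 16 * m ≤ V 0 y t ^ 2 := by
    intro t ht htt
    rcases ht.1.eq_or_lt with rfl | h0
    · exact h.init_lower y (hout _ ⟨le_rfl, hS.le⟩ htt)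
    · refine le_of_forall_pos_le_add fun ε hε => ?_
      have hpos : 0 < Real.exp (7 * τ t) * (1 + y ^ 2) := by positivity
      have := h.outer_lower_aux ⟨h0, ht.2⟩ (hout t (Ico_subset_Icc_self ht) htt)
        (div_pos hε hpos)
      rw [div_mul_cancel₀ _ hpos.ne'] at this
      linarith
  rcases ht₁.2.eq_or_lt with rfl | hlt'
  · have hc : ContinuousOn (fun t => 16 * m - V 0 y t ^ 2) (Icc 0 t₁) :=
      continuousOn_const.sub ((h.continuousOn_time (by norm_num) y).pow 2)
    have := nonpos_on_Icc_of_Ico hS hc (fun t ht => by linarith [hlt t ht ht.2.le]) t₁ ht₁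
    linarith
  · exact hlt t₁ ⟨ht₁.1, hlt'⟩ le_rfl

/-- The constants 81/50 = 2(9/10)² and 16 = 4² come from squaring the two values of the barrier. -/
theorem lower (h : NeckFlow m S κ σ a τ β V N) :
    ∀ t ∈ Icc 0 S, ∀ y, 81 / 50 * m ≤ V 0 y t ^ 2 := by
  intro t ht y
  rcases le_total (β t * y ^ 2) (20 * m) with h1 | h1
  · exact h.inner_lower t ht y h1
  · have := h.outer_lower t ht y h1
    linarith [h.one_le]

theorem one_le_v (h : NeckFlow m S κ σ a τ β V N) {t : ℝ} (ht : t ∈ Icc 0 S) (y : ℝ) :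
    1 ≤ V 0 y t := by
  have h1 := h.lower t ht y
  have h2 := h.pos t ht y
  have h3 := h.one_le
  nlinarith

theorem div_sq_le (h : NeckFlow m S κ σ a τ β V N) {t : ℝ} (ht : t ∈ Icc 0 S) (y : ℝ) :
    0 ≤ m / V 0 y t ^ 2 ∧ m / V 0 y t ^ 2 ≤ 50 / 81 := by
  have h1 := h.lower t ht y
  have h2 := h.pos t ht y
  have h3 := h.one_le
  refine ⟨by positivity, ?_⟩
  rw [div_le_iff₀ (by positivity)]; linarith

theorem outer_div_sq_le (h : NeckFlow m S κ σ a τ β V N) {t : ℝ} (ht : t ∈ Icc 0 S) {y : ℝ}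
    (hy : 20 * m ≤ β t * y ^ 2) : m / V 0 y t ^ 2 ≤ 1 / 16 := by
  have h1 := h.outer_lower t ht y hy
  have h2 := h.pos t ht y
  rw [div_le_iff₀ (by positivity)]; linarith

/-- The gradient is bounded on the time interval, by a constant that depends on the solution. -/
theorem exists_deriv_one_bound (h : NeckFlow m S κ σ a τ β V N) :
    ∃ W : ℝ, ∀ t ∈ Icc 0 S, ∀ y, V 1 y t ^ 2 ≤ W := by
  obtain ⟨C, hC⟩ := h.growth
  obtain ⟨W, hW⟩ := h.init_bdd
  -- The only growth mechanism for (∂v)² is 2(m/v²)(∂v)², and m/v² ≤ 50/81, so the exponential rate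
  -- 2 dominates it.
  have hmain := nonpos_of_polynomial_growth (C := C ^ 2 + 2) h.time_pos (by positivity)
    (σ := σ) (τ := τ) (f := fun y t => V 1 y t ^ 2 - W ^ 2 * Real.exp (2 * τ t))
    (ft := fun y t => 2 * V 1 y t * (N 1 y t - a t * y * V 2 y t)
      - W ^ 2 * (2 * Real.exp (2 * τ t)))
    (fy := fun y t => 2 * V 1 y t * V 2 y t)
    (fyy := fun y t => 2 * V 2 y t * V 2 y t + 2 * V 1 y t * V 3 y t)
    (A := fun y t => ellip (V 1 y t)) (B := fun y t => -(a t * y))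
    ?_ ?_ ?_ h.rate_pos h.clock_cont h.clock_nonneg h.clock_deriv ?_ ?_ ?_ ?_ ?_ ?_
  · obtain ⟨P, hP⟩ := (isCompact_Icc.image_of_continuousOn
      ((continuousOn_const (c := (2 : ℝ))).mul h.clock_cont).rexp).bddAbove
    refine ⟨W ^ 2 * P, fun t ht y => ?_⟩
    have h1 := hmain t ht y
    have h2 : Real.exp (2 * τ t) ≤ P := hP ⟨t, ht, rfl⟩
    have h3 := mul_le_mul_of_nonneg_left h2 (sq_nonneg W)
    linarith
  · exact ((h.cont 1 (by norm_num)).pow 2).sub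
      (continuousOn_const.mul (continuousOn_const.mul h.continuousOn_clock_fst).rexp)
  · intro t ht y
    have h1 := (hC t ht y).1
    have h2 : V 1 y t ^ 2 ≤ C ^ 2 * (1 + y ^ 2) ^ 2 := by
      rw [← sq_abs, ← mul_pow]; gcongr
    have h3 : 0 < W ^ 2 * Real.exp (2 * τ t) + 2 * (1 + y ^ 2) ^ 2 := by positivity
    linarith
  · intro y
    have h1 : V 1 y 0 ^ 2 ≤ W ^ 2 := by rw [← sq_abs]; gcongr; exact hW y
    have h2 : 1 ≤ Real.exp (2 * τ 0) :=
      Real.one_le_exp (mul_nonneg (by norm_num) (h.clock_nonneg 0 ⟨le_rfl, h.time_pos.le⟩))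
    nlinarith [sq_nonneg W]
  · intro t ht y
    exact (((h.dt t ht 1 y).pow 2).sub
      (((h.clock_deriv t ht).const_mul 2).exp.const_mul (W ^ 2))).congr_deriv (by push_cast; ring)
  · intro t ht y
    exact (((h.dy t ht 1 y).pow 2).sub_const _).congr_deriv (by push_cast; ring)
  · intro t ht y
    exact (((h.dy t ht 1 y).const_mul 2).mul (h.dy t ht 2 y)).congr_deriv (by ring)
  · exact fun t _ y => ⟨(ellip_pos _).le, ellip_le_one _⟩
  · intro t ht y
    obtain ⟨ha1, ha2⟩ := h.a_bounds (Ioo_subset_Icc_self ht)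
    rw [abs_neg, abs_mul, abs_of_nonneg (by linarith)]
    nlinarith [abs_nonneg y, sq_nonneg C, mul_nonneg (sq_nonneg C) (abs_nonneg y)]
  · intro t ht y hpos
    have hm := h.div_sq_le (Ioo_subset_Icc_self ht) y
    rw [h.N_one ht y]
    have e1 : ellip₁ (V 1 y t) * V 1 y t ≤ 0 := by
      unfold ellip₁; nlinarith [mul_nonneg (sq_nonneg (V 1 y t)) (sq_nonneg (ellip (V 1 y t)))]
    have e2 := mul_nonneg (neg_nonneg.2 e1) (sq_nonneg (V 2 y t))
    have e3 := mul_nonneg (ellip_pos (V 1 y t)).le (sq_nonneg (V 2 y t))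
    have e4 : m / V 0 y t ^ 2 * V 1 y t ^ 2 ≤ 1 * V 1 y t ^ 2 := by gcongr; linarith [hm.2]
    have e5 := mul_nonneg (sq_nonneg C) hpos.le
    have e6 : m * V 1 y t / V 0 y t ^ 2 * V 1 y t = m / V 0 y t ^ 2 * V 1 y t ^ 2 := by ring
    linarith

/-- The gradient estimate `(∂v)² ≤ C β v`. -/
theorem deriv_one_sq_le (h : NeckFlow m S κ σ a τ β V N) (hδ : ∀ t ∈ Icc 0 S, β t ≤ 1 / 20) :
    ∀ t ∈ Icc 0 S, ∀ y, V 1 y t ^ 2 ≤ (9 + κ ^ 2) * β t * V 0 y t := by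
  obtain ⟨C, hC⟩ := h.growth
  -- The 9 covers the inner region and κ² the initial time, so positivity of f = w² - Gβv can only
  -- occur in the outer region.
  set G : ℝ := 9 + κ ^ 2 with hG
  have hGpos : 0 < G := by positivity
  have hm1 := h.one_le
  have hmain := nonpos_of_polynomial_growth (C := C ^ 2 + 2) h.time_pos (by positivity)
    (σ := σ) (τ := τ) (f := fun y t => V 1 y t ^ 2 - G * β t * V 0 y t)
    (ft := fun y t => 2 * V 1 y t * (N 1 y t - a t * y * V 2 y t)
      + G * (β t ^ 2 / m) * V 0 y t - G * β t * (N 0 y t - a t * y * V 1 y t + a t * V 0 y t))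
    (fy := fun y t => 2 * V 1 y t * V 2 y t - G * β t * V 1 y t)
    (fyy := fun y t => 2 * V 2 y t * V 2 y t + 2 * V 1 y t * V 3 y t - G * β t * V 2 y t)
    (A := fun y t => ellip (V 1 y t)) (B := fun y t => -(a t * y))
    ?_ ?_ ?_ h.rate_pos h.clock_cont h.clock_nonneg h.clock_deriv ?_ ?_ ?_ ?_ ?_ ?_
  · intro t ht y
    have := hmain t ht y
    linarith
  · exact ((h.cont 1 (by norm_num)).pow 2).sub
      ((continuousOn_const.mul h.continuousOn_beta_fst).mul (h.cont 0 (by norm_num)))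
  · intro t ht y
    have h1 := (hC t ht y).1
    have h2 : V 1 y t ^ 2 ≤ C ^ 2 * (1 + y ^ 2) ^ 2 := by
      rw [← sq_abs, ← mul_pow]; gcongr
    have h4 := h.beta_pos t ht
    have h5 := h.pos t ht y
    have h3 : 0 < G * β t * V 0 y t + 2 * (1 + y ^ 2) ^ 2 := by positivity
    linarith
  · intro y
    have h1 := h.init_one y
    have h0 : (0 : ℝ) ∈ Icc 0 S := ⟨le_rfl, h.time_pos.le⟩
    have h4 := h.beta_pos 0 h0
    have h5 := h.pos 0 h0 y
    have h6 : κ ^ 2 * β 0 * V 0 y 0 ≤ G * β 0 * V 0 y 0 := by gcongr; linarith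
    linarith
  · intro t ht y
    exact (((h.dt t ht 1 y).pow 2).sub
      (((h.beta_deriv t ht).const_mul G).mul (h.dt t ht 0 y))).congr_deriv (by push_cast; ring)
  · intro t ht y
    exact (((h.dy t ht 1 y).pow 2).sub ((h.dy t ht 0 y).const_mul _)).congr_deriv
      (by push_cast; ring)
  · intro t ht y
    exact ((((h.dy t ht 1 y).const_mul 2).mul (h.dy t ht 2 y)).sub
      ((h.dy t ht 1 y).const_mul _)).congr_deriv (by ring)
  · exact fun t _ y => ⟨(ellip_pos _).le, ellip_le_one _⟩
  · intro t ht y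
    obtain ⟨ha1, ha2⟩ := h.a_bounds (Ioo_subset_Icc_self ht)
    rw [abs_neg, abs_mul, abs_of_nonneg (by linarith)]
    nlinarith [abs_nonneg y, sq_nonneg C, mul_nonneg (sq_nonneg C) (abs_nonneg y)]
  · intro t ht y hpos
    have ht' := Ioo_subset_Icc_self ht
    have hβ := h.beta_pos t ht'
    have hv := h.pos t ht' y
    obtain ⟨ha1, ha2⟩ := h.a_bounds ht'
    have hout : 20 * m ≤ β t * y ^ 2 := by
      by_contra! hin
      have h1 := h.inner_one t ht' y hin.le
      have h2 : 9 * β t * V 0 y t ≤ G * β t * V 0 y t := by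
        gcongr; rw [hG]; nlinarith [sq_nonneg κ]
      linarith
    have hm := h.outer_div_sq_le ht' hout
    have hm0 := (h.div_sq_le ht' y).1
    rw [h.N_one ht y, h.N_zero t ht y]
    set v := V 0 y t
    set w := V 1 y t
    set z := V 2 y t
    set b := β t
    set A := ellip w
    have e1 : ellip₁ w * w ≤ 0 := by
      unfold ellip₁; nlinarith [mul_nonneg (sq_nonneg w) (sq_nonneg (ellip w))]
    have e2 : ellip₁ w * w * z ^ 2 ≤ 0 := mul_nonpos_of_nonpos_of_nonneg e1 (sq_nonneg z)
    have e3 := mul_nonneg (ellip_pos w).le (sq_nonneg z)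
    set f := w ^ 2 - G * b * v with hf
    have e4 : m / v ^ 2 * f ≤ 1 / 16 * f := by gcongr
    have e5 : 0 ≤ C ^ 2 * f := by positivity
    have e6 : b ^ 2 / m * v ≤ 1 / 20 * (b * v) := by
      rw [div_mul_eq_mul_div, div_le_iff₀ (by linarith)]
      have h1 : b * (b * v) ≤ 1 / 20 * (b * v) := by gcongr; exact hδ t ht'
      have h2 : 1 / 20 * (b * v) * 1 ≤ 1 / 20 * (b * v) * m := by gcongr
      nlinarith
    have e7 : m / v = m / v ^ 2 * v := by field_simp
    have e8 : b * (m / v) ≤ 1 / 16 * (b * v) := by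
      rw [e7]
      have : m / v ^ 2 * (b * v) ≤ 1 / 16 * (b * v) := by gcongr
      linarith
    have e9 : 49 / 100 * (b * v) ≤ a t * (b * v) := by gcongr
    have e10 : 0 ≤ b * v := by positivity
    -- Of the three copies of Gβm/v, two come from writing 2m w²/v² as 2(m/v²)f + 2Gβm/v and one
    -- from the equation for v. The sign follows from 3/16 + 1/20 < 49/100.
    have e11 : G * (3 * (b * (m / v)) + b ^ 2 / m * v - a t * (b * v)) ≤ 0 :=
      mul_nonpos_of_nonneg_of_nonpos hGpos.le (by linarith)
    have e12 : m * w / v ^ 2 * w = m / v ^ 2 * f + G * (b * (m / v)) := by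
      rw [hf]; field_simp; ring
    have e13 : 2 * w * (A * V 3 y t + ellip₁ w * z ^ 2 + m * w / v ^ 2 - a t * y * z) =
      2 * (A * w * V 3 y t) + 2 * (ellip₁ w * w * z ^ 2) + 2 * (m * w / v ^ 2 * w)
        - 2 * w * (a t * y * z) := by ring
    rw [e13, e12]
    linarith

end NeckFlow

/-! ### The second derivative -/

namespace NeckFlow

variable {m S κ : ℝ} {σ a τ β : ℝ → ℝ} {V N : ℕ → ℝ → ℝ → ℝ}

/-- The second derivative is bounded on the time interval, by a constant that depends on the
solution. The maximum principle is applied to `∂²v / (1 + (∂v)²)`. -/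
theorem exists_deriv_two_bound (h : NeckFlow m S κ σ a τ β V N) :
    ∃ Z : ℝ, ∀ t ∈ Icc 0 S, ∀ y, V 2 y t ^ 2 ≤ Z := by
  obtain ⟨C, hC⟩ := h.growth
  obtain ⟨W, hW⟩ := h.exists_deriv_one_bound
  have h00 : (0 : ℝ) ∈ Icc 0 S := ⟨le_rfl, h.time_pos.le⟩
  have hC0 : 0 ≤ C := by
    have := (hC 0 h00 0).1
    have := abs_nonneg (V 1 0 0)
    linarith
  set Z : ℝ := 1 + κ ^ 2 * β 0 ^ 2 with hZ
  have hZ1 : 1 ≤ Z := by rw [hZ]; nlinarith [mul_nonneg (sq_nonneg κ) (sq_nonneg (β 0))]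
  have hcA : Continuous ellip := continuous_iff_continuousAt.2 fun w =>
    (hasDerivAt_ellip w).continuousAt
  have hκ1 : ∀ t ∈ Icc 0 S, ∀ y, (ellip (V 1 y t) * V 2 y t) ^ 2 ≤ V 2 y t ^ 2 := by
    intro t _ y
    have h1 := ellip_pos (V 1 y t)
    have h2 : ellip (V 1 y t) ^ 2 ≤ 1 := pow_le_one₀ h1.le (ellip_le_one _)
    rw [mul_pow]
    nlinarith [sq_nonneg (V 2 y t)]
  -- The quantity k = `ellip (V 1) * V 2` is ∂ arctan(∂v). In its equation the cubic term `ellip₂ *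
  -- V 2 ^ 3` becomes part of the diffusion of k, whereas in the equation for ∂²v it could not be
  -- controlled under linear growth. The m/v² terms contribute at most 4k² + 2, and 4k² + 2 - 6E ≤
  -- 4(k² - E) because E ≥ 1; hence the rate 6 and the requirement Z ≥ 1.
  have hmain := nonpos_of_polynomial_growth (C := 4 * C ^ 2 + C + 4) h.time_pos (by positivity)
    (σ := σ) (τ := τ)
    (f := fun y t => (ellip (V 1 y t) * V 2 y t) ^ 2 - Z * Real.exp (6 * τ t))
    (ft := fun y t => 2 * (ellip (V 1 y t) * V 2 y t) *
      (ellip₁ (V 1 y t) * (N 1 y t - a t * y * V 2 y t) * V 2 y t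
        + ellip (V 1 y t) * (N 2 y t - a t * y * V 3 y t - a t * V 2 y t))
      - Z * (6 * Real.exp (6 * τ t)))
    (fy := fun y t => 2 * (ellip (V 1 y t) * V 2 y t) *
      (ellip₁ (V 1 y t) * V 2 y t ^ 2 + ellip (V 1 y t) * V 3 y t))
    (fyy := fun y t => 2 * (ellip₁ (V 1 y t) * V 2 y t ^ 2 + ellip (V 1 y t) * V 3 y t) *
        (ellip₁ (V 1 y t) * V 2 y t ^ 2 + ellip (V 1 y t) * V 3 y t)
      + 2 * (ellip (V 1 y t) * V 2 y t) * (ellip₂ (V 1 y t) * V 2 y t ^ 3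
        + 3 * (ellip₁ (V 1 y t) * V 2 y t * V 3 y t) + ellip (V 1 y t) * V 4 y t))
    (A := fun y t => ellip (V 1 y t))
    (B := fun y t => ellip₁ (V 1 y t) * V 2 y t - a t * y)
    ?_ ?_ ?_ h.rate_pos h.clock_cont h.clock_nonneg h.clock_deriv ?_ ?_ ?_ ?_ ?_ ?_
  · obtain ⟨P, hP⟩ := (isCompact_Icc.image_of_continuousOn
      ((continuousOn_const (c := (6 : ℝ))).mul h.clock_cont).rexp).bddAbove
    refine ⟨Z * P * (1 + W) ^ 2, fun t ht y => ?_⟩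
    have h1 := hmain t ht y
    have h2 : Real.exp (6 * τ t) ≤ P := hP ⟨t, ht, rfl⟩
    have h3 : Z * Real.exp (6 * τ t) ≤ Z * P := mul_le_mul_of_nonneg_left h2 (by linarith)
    have h4 : (ellip (V 1 y t) * V 2 y t) ^ 2 ≤ Z * P := by linarith
    -- Returning from k to ∂²v costs a factor (1 + (∂v)²)², which the gradient bound W controls.
    have h5 : V 2 y t ^ 2 = (ellip (V 1 y t) * V 2 y t) ^ 2 * (1 + V 1 y t ^ 2) ^ 2 := by
      linear_combination (-(V 2 y t ^ 2) * (ellip (V 1 y t) * (1 + V 1 y t ^ 2) + 1)) *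
        ellip_mul (V 1 y t)
    have h6 := hW t ht y
    rw [h5]
    gcongr
    exact (sq_nonneg _).trans h4
  · exact (((hcA.comp_continuousOn (h.cont 1 (by norm_num))).mul (h.cont 2 (by norm_num))).pow 2).sub
      (continuousOn_const.mul (continuousOn_const.mul h.continuousOn_clock_fst).rexp)
  · intro t ht y
    have h1 := (hC t ht y).2
    have h2 : V 2 y t ^ 2 ≤ C ^ 2 * (1 + |y|) ^ 2 := by
      rw [← sq_abs, ← mul_pow]; gcongr
    have h3 : (1 + |y|) ^ 2 ≤ 4 * (1 + y ^ 2) ^ 2 := by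
      rw [← sq_abs y]
      nlinarith [sq_nonneg (|y| - 1), sq_nonneg (|y| ^ 2)]
    have h4 : C ^ 2 * (1 + |y|) ^ 2 ≤ C ^ 2 * (4 * (1 + y ^ 2) ^ 2) := by gcongr
    have h5 := hκ1 t ht y
    have h6 : 0 ≤ Z * Real.exp (6 * τ t) + (C + 4) * (1 + y ^ 2) ^ 2 := by positivity
    linarith
  · intro y
    have h1 := h.init_higher 2 ⟨le_rfl, by norm_num⟩ y
    have h2 : 1 ≤ Real.exp (6 * τ 0) :=
      Real.one_le_exp (mul_nonneg (by norm_num) (h.clock_nonneg 0 h00))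
    have h3 : Z * 1 ≤ Z * Real.exp (6 * τ 0) := by gcongr
    have h5 := hκ1 0 h00 y
    linarith
  · intro t ht y
    exact (((((hasDerivAt_ellip _).comp t (h.dt t ht 1 y)).mul (h.dt t ht 2 y)).pow 2).sub
      (((h.clock_deriv t ht).const_mul 6).exp.const_mul Z)).congr_deriv
      (by simp only [Function.comp_apply, Pi.mul_apply]; push_cast; ring)
  · intro t ht y
    exact (((((hasDerivAt_ellip _).comp y (h.dy t ht 1 y)).mul (h.dy t ht 2 y)).pow 2).sub_const
      _).congr_deriv (by simp only [Function.comp_apply, Pi.mul_apply]; push_cast; ring)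
  · intro t ht y
    have d0 := (hasDerivAt_ellip _).comp y (h.dy t ht 1 y)
    have d1 := (hasDerivAt_ellip₁ _).comp y (h.dy t ht 1 y)
    have d2 := h.dy t ht 2 y
    exact (((d0.mul d2).const_mul 2).mul ((d1.mul (d2.pow 2)).add
      (d0.mul (h.dy t ht 3 y)))).congr_deriv
      (by simp only [Function.comp_apply, Pi.mul_apply, Pi.pow_apply, Pi.add_apply]
          push_cast; ring)
  · exact fun t _ y => ⟨(ellip_pos _).le, ellip_le_one _⟩
  · intro t ht y
    have ht' := Ioo_subset_Icc_self ht
    obtain ⟨ha1, ha2⟩ := h.a_bounds ht'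
    have h1 := (hC t ht' y).2
    have h2 : |ellip₁ (V 1 y t) * V 2 y t| ≤ 1 * (C * (1 + |y|)) := by
      rw [abs_mul]; gcongr; exact (abs_ellip₁_le _).trans (ellip_le_one _)
    have h3 : |a t * y| ≤ 1 * |y| := by
      rw [abs_mul, abs_of_nonneg (by linarith)]; gcongr; linarith
    refine (abs_sub _ _).trans ?_
    nlinarith [abs_nonneg y, sq_nonneg C, mul_nonneg (sq_nonneg C) (abs_nonneg y)]
  · intro t ht y hpos
    have ht' := Ioo_subset_Icc_self ht
    obtain ⟨ha1, ha2⟩ := h.a_bounds ht'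
    obtain ⟨hm0, hm1⟩ := h.div_sq_le ht' y
    have hv1 := h.one_le_v ht' y
    have hE1 : 1 ≤ Real.exp (6 * τ t) :=
      Real.one_le_exp (mul_nonneg (by norm_num) (h.clock_nonneg t ht'))
    rw [h.N_one ht y, h.N_two ht y]
    have hA := ellip_pos (V 1 y t)
    have hAw := sq_mul_ellip_le_one (V 1 y t)
    have hA1 : ellip₁ (V 1 y t) * V 1 y t = -2 * (V 1 y t ^ 2 * ellip (V 1 y t)) *
      ellip (V 1 y t) := by unfold ellip₁; ring
    set v := V 0 y t
    set w := V 1 y t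
    set z := V 2 y t
    set p := V 3 y t
    set A := ellip w
    set k := A * z with hk
    set k1 := ellip₁ w * z ^ 2 + A * p with hk1
    set E := Z * Real.exp (6 * τ t) with hE
    have hE1' : 1 ≤ E := by rw [hE]; nlinarith
    have id1 : 2 * k * (ellip₁ w * (A * p + ellip₁ w * z ^ 2 + m * w / v ^ 2 - a t * y * z) * z
        + A * (A * V 4 y t + 3 * (ellip₁ w * z * p) + ellip₂ w * z ^ 3 + m * z / v ^ 2
          - 2 * m * w ^ 2 / v ^ 3 - a t * y * p - a t * z)) =
        A * (2 * k * (ellip₂ w * z ^ 3 + 3 * (ellip₁ w * z * p) + A * V 4 y t))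
        + (ellip₁ w * z - a t * y) * (2 * k * k1)
        + 2 * (m / v ^ 2) * (k * ((ellip₁ w * w) * z + k)) - 4 * (m / v ^ 2) * ((w ^ 2 * A) * (k / v))
        - 2 * a t * k ^ 2 := by
      rw [hk1, hk]; field_simp; ring
    have e1 : k * ((ellip₁ w * w) * z + k) ≤ k ^ 2 := by
      rw [hA1, show -2 * (w ^ 2 * A) * A * z = -2 * (w ^ 2 * A) * k by rw [hk]; ring]
      have : 0 ≤ w ^ 2 * A := by positivity
      nlinarith [mul_nonneg this (sq_nonneg k)]
    have e2 : 2 * (m / v ^ 2) * (k * ((ellip₁ w * w) * z + k)) ≤ 2 * k ^ 2 := by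
      have h1 : m / v ^ 2 * (k * ((ellip₁ w * w) * z + k)) ≤ m / v ^ 2 * k ^ 2 := by gcongr
      have h2 : m / v ^ 2 * k ^ 2 ≤ 1 * k ^ 2 := by gcongr; linarith
      linarith
    have e3 : -(4 * (m / v ^ 2) * ((w ^ 2 * A) * (k / v))) ≤ 2 * k ^ 2 + 2 := by
      have h1 : |m / v ^ 2 * ((w ^ 2 * A) * (k / v))| ≤ 1 * (1 * (|k| / 1)) := by
        rw [abs_mul, abs_mul (w ^ 2 * A), abs_div k, abs_of_nonneg hm0, abs_of_pos (by linarith : 0 < v),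
          abs_of_nonneg (by positivity : 0 ≤ w ^ 2 * A)]
        gcongr; linarith
      have h2 := neg_le_of_abs_le h1
      nlinarith [sq_nonneg (|k| - 1), sq_abs k]
    have e4 : 0 ≤ a t * k ^ 2 := by
      have : 0 ≤ a t := by linarith
      positivity
    have e5 : 0 ≤ A * (k1 * k1) := mul_nonneg hA.le (mul_self_nonneg k1)
    have e6 : 0 ≤ (4 * C ^ 2 + C) * (k ^ 2 - E) := mul_nonneg (by positivity) hpos.le
    rw [id1]
    linarith

/-- The estimate `|∂²v| ≤ C β`. -/
theorem deriv_two_sq_le (h : NeckFlow m S κ σ a τ β V N)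
    (hδ : ∀ t ∈ Icc 0 S, (9 + κ ^ 2) * β t ≤ 1 / 20) :
    ∀ t ∈ Icc 0 S, ∀ y, V 2 y t ^ 2 ≤ ((9 + κ ^ 2) * β t) ^ 2 := by
  obtain ⟨C, hC⟩ := h.growth
  obtain ⟨Z, hZ⟩ := h.exists_deriv_two_bound
  have h00 : (0 : ℝ) ∈ Icc 0 S := ⟨le_rfl, h.time_pos.le⟩
  have hC0 : 0 ≤ C := by
    have := (hC 0 h00 0).1
    have := abs_nonneg (V 1 0 0)
    linarith
  have hZ0 : 0 ≤ Z := (sq_nonneg _).trans (hZ 0 h00 0)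
  set G : ℝ := 9 + κ ^ 2 with hG
  have hG9 : 9 ≤ G := by rw [hG]; nlinarith [sq_nonneg κ]
  have hm1 := h.one_le
  have hδ' : ∀ t ∈ Icc 0 S, β t ≤ 1 / 20 := by
    intro t ht
    nlinarith [hδ t ht, h.beta_pos t ht]
  have hgrad := h.deriv_one_sq_le hδ'
  rw [← hG] at hgrad
  have hmain := nonpos_of_polynomial_growth (C := 3 * C + 1 + Z + 12 * Z) h.time_pos (by positivity)
    (σ := σ) (τ := τ) (f := fun y t => V 2 y t ^ 2 - (G * β t) ^ 2)
    (ft := fun y t => 2 * V 2 y t * (N 2 y t - a t * y * V 3 y t - a t * V 2 y t)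
      + 2 * (G * β t) * (G * (β t ^ 2 / m)))
    (fy := fun y t => 2 * V 2 y t * V 3 y t)
    (fyy := fun y t => 2 * V 3 y t * V 3 y t + 2 * V 2 y t * V 4 y t)
    (A := fun y t => ellip (V 1 y t))
    (B := fun y t => 3 * (ellip₁ (V 1 y t) * V 2 y t) - a t * y)
    ?_ ?_ ?_ h.rate_pos h.clock_cont h.clock_nonneg h.clock_deriv ?_ ?_ ?_ ?_ ?_ ?_
  · intro t ht y
    have := hmain t ht y
    linarith
  · exact ((h.cont 2 (by norm_num)).pow 2).sub
      ((continuousOn_const.mul h.continuousOn_beta_fst).pow 2)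
  · intro t ht y
    have h1 := hZ t ht y
    have h2 := sq_nonneg (G * β t)
    have h3 : 1 ≤ (1 + y ^ 2) ^ 2 := one_le_pow₀ (by nlinarith [sq_nonneg y])
    have h4 : (3 * C + 1 + Z + 12 * Z) * 1 ≤ (3 * C + 1 + Z + 12 * Z) * (1 + y ^ 2) ^ 2 := by gcongr
    linarith
  · intro y
    have h1 := h.init_higher 2 ⟨le_rfl, by norm_num⟩ y
    have h2 : κ ^ 2 * β 0 ^ 2 ≤ G ^ 2 * β 0 ^ 2 := by
      refine mul_le_mul_of_nonneg_right ?_ (sq_nonneg _)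
      rw [hG]; nlinarith [sq_nonneg κ, sq_nonneg (κ ^ 2)]
    linarith
  · intro t ht y
    exact (((h.dt t ht 2 y).pow 2).sub
      (((h.beta_deriv t ht).const_mul G).pow 2)).congr_deriv (by push_cast; ring)
  · intro t ht y
    exact (((h.dy t ht 2 y).pow 2).sub_const _).congr_deriv (by push_cast; ring)
  · intro t ht y
    exact (((h.dy t ht 2 y).const_mul 2).mul (h.dy t ht 3 y)).congr_deriv (by ring)
  · exact fun t _ y => ⟨(ellip_pos _).le, ellip_le_one _⟩
  · intro t ht y
    have ht' := Ioo_subset_Icc_self ht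
    obtain ⟨ha1, ha2⟩ := h.a_bounds ht'
    have h1 := (hC t ht' y).2
    have h2 : |ellip₁ (V 1 y t) * V 2 y t| ≤ 1 * (C * (1 + |y|)) := by
      rw [abs_mul]; gcongr; exact (abs_ellip₁_le _).trans (ellip_le_one _)
    have h3 : |a t * y| ≤ 1 * |y| := by
      rw [abs_mul, abs_of_nonneg (by linarith)]; gcongr; linarith
    have h4 : |3 * (ellip₁ (V 1 y t) * V 2 y t)| = 3 * |ellip₁ (V 1 y t) * V 2 y t| := by
      rw [abs_mul 3, abs_of_pos (by norm_num : (0 : ℝ) < 3)]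
    refine (abs_sub _ _).trans ?_
    nlinarith [abs_nonneg y, mul_nonneg hZ0 (abs_nonneg y)]
  · intro t ht y hpos
    have ht' := Ioo_subset_Icc_self ht
    obtain ⟨ha1, ha2⟩ := h.a_bounds ht'
    have hβ := h.beta_pos t ht'
    have hβδ := hδ t ht'
    have hβ20 := hδ' t ht'
    have hv1 := h.one_le_v ht' y
    have hg := hgrad t ht' y
    have hZy := hZ t ht' y
    have hzG : G * β t < |V 2 y t| := by
      rw [← sq_abs] at hpos
      exact lt_of_pow_lt_pow_left₀ 2 (abs_nonneg _) (by linarith)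
    have hout : 20 * m ≤ β t * y ^ 2 := by
      by_contra! hin
      have h1 := h.inner_two t ht' y hin.le
      nlinarith
    have hm := h.outer_div_sq_le ht' hout
    have hm0 := (h.div_sq_le ht' y).1
    rw [h.N_two ht y]
    have hA := ellip_pos (V 1 y t)
    have hA2 := abs_ellip₂_le (V 1 y t)
    set v := V 0 y t
    set w := V 1 y t
    set z := V 2 y t
    set p := V 3 y t
    set b := β t
    set A := ellip w
    set f := z ^ 2 - (G * b) ^ 2 with hf
    have id1 : 2 * z * (A * V 4 y t + 3 * (ellip₁ w * z * p) + ellip₂ w * z ^ 3 + m * z / v ^ 2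
          - 2 * m * w ^ 2 / v ^ 3 - a t * y * p - a t * z) =
        A * (2 * z * V 4 y t) + (3 * (ellip₁ w * z) - a t * y) * (2 * z * p)
        + 2 * (ellip₂ w * (z ^ 2 * z ^ 2)) + 2 * (m / v ^ 2) * z ^ 2
        - 4 * (m / v ^ 2 * (w ^ 2 / v * z)) - 2 * (a t * z ^ 2) := by
      field_simp; ring
    have e1 : ellip₂ w * (z ^ 2 * z ^ 2) ≤ 6 * (z ^ 2 * z ^ 2) := by
      gcongr; exact (le_abs_self _).trans hA2
    -- The non-uniform bound Z multiplies only f, so it enters the constant of the maximum principle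
    -- but not the final estimate; the rest of the quartic term is small because Gβ ≤ 1/20.
    have e2 : z ^ 2 * z ^ 2 ≤ Z * f + 1 / 400 * z ^ 2 := by
      have h1 : z ^ 2 * f ≤ Z * f := by gcongr
      have h2 : z ^ 2 * (G * b) ^ 2 ≤ z ^ 2 * (1 / 20) ^ 2 := by gcongr
      have h3 : z ^ 2 * z ^ 2 = z ^ 2 * f + z ^ 2 * (G * b) ^ 2 := by rw [hf]; ring
      linarith
    have e3 : m / v ^ 2 * z ^ 2 ≤ 1 / 16 * z ^ 2 := by gcongr
    -- Where f > 0, the gradient estimate gives w²/v ≤ Gβ < |z|, so this source is also quadratic in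
    -- z.
    have e4 : -(m / v ^ 2 * (w ^ 2 / v * z)) ≤ 1 / 16 * z ^ 2 := by
      have h0 : w ^ 2 / v ≤ |z| := by
        rw [div_le_iff₀ (by linarith)]
        have : G * b * v ≤ |z| * v := by gcongr
        linarith
      have h1 : |m / v ^ 2 * (w ^ 2 / v * z)| ≤ 1 / 16 * (|z| * |z|) := by
        rw [abs_mul, abs_mul, abs_of_nonneg hm0, abs_of_nonneg (by positivity : 0 ≤ w ^ 2 / v)]
        gcongr
      have h2 := neg_le_of_abs_le h1
      rw [← sq, sq_abs] at h2
      linarith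
    have e5 : 49 / 100 * z ^ 2 ≤ a t * z ^ 2 := by gcongr
    have e6 : G * b * (G * (b ^ 2 / m)) ≤ 1 / 20 * z ^ 2 := by
      have h1 : b ^ 2 / m ≤ 1 / 20 * b := by
        rw [div_le_iff₀ (by linarith)]
        have h1 : b * b ≤ 1 / 20 * b := by gcongr
        have h2 : 1 / 20 * b * 1 ≤ 1 / 20 * b * m := by gcongr
        nlinarith
      have h2 : G * b * (G * (b ^ 2 / m)) ≤ G * b * (G * (1 / 20 * b)) := by gcongr
      have h3 : (G * b) ^ 2 ≤ z ^ 2 := by linarith [hpos.le]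
      linarith
    have e7 : 0 ≤ A * (p * p) := mul_nonneg hA.le (mul_self_nonneg p)
    have e8 : 0 ≤ (3 * C + 1 + Z) * f := mul_nonneg (by positivity) hpos.le
    rw [id1]
    linarith [sq_nonneg z]

end NeckFlow

/-! ### The Bernstein–Shi argument -/

/-- The algebra behind the Bernstein estimate for `f² (200 G c + g²)`, where `f` is the derivative of
`g` and `h` that of `f`. -/
theorem bernstein_algebra {A f g h H c G Df Dg : ℝ} (hA0 : 0 < A) (hA1 : A ≤ 1)
    (hg : g ^ 2 ≤ G * c) (hH : H = 200 * G * c + g ^ 2) (hHs : H ≤ 1 / 360)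
    (hf : f * Df ≤ -(1 / 5) * f ^ 2 + 1 / 20 * A * (|f| * |h|) + 3 * A * |f| ^ 3)
    (hg' : |g * Dg| ≤ 5 * G * c + 1 / 20 * A * (|g| * |f|)) :
    2 * H * (f * Df) + 2 * f ^ 2 * (g * Dg)
      - A * (2 * h ^ 2 * H + 8 * (f ^ 2 * (h * g)) + 2 * f ^ 4)
      ≤ -(6 / 25) * (f ^ 2 * H) - 1 / 2 * (A * f ^ 4) := by
  have hGc : 0 ≤ G * c := (sq_nonneg g).trans hg
  have hH0 : 0 ≤ H := by rw [hH]; nlinarith [sq_nonneg g]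
  have hHg : 200 * g ^ 2 ≤ H := by rw [hH]; nlinarith [sq_nonneg g]
  have hHc : 200 * (G * c) ≤ H := by rw [hH]; nlinarith [sq_nonneg g]
  have e1 : 2 * H * (f * Df) ≤
      2 * H * (-(1 / 5) * f ^ 2 + 1 / 20 * A * (|f| * |h|) + 3 * A * |f| ^ 3) := by gcongr
  have e2 : 2 * f ^ 2 * (g * Dg) ≤ 2 * f ^ 2 * (5 * G * c + 1 / 20 * A * (|g| * |f|)) := by
    gcongr; exact (le_abs_self _).trans hg'
  -- The weight 200 ensures H ≥ 200g² ≥ 64g², so the cross term costs only part of -2Hh² and of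
  -- -2f⁴. The surviving multiple of -A f⁴ is the absorption.
  have e3 : -(8 * (f ^ 2 * (h * g))) ≤ 1 / 2 * (H * h ^ 2) + 1 / 2 * f ^ 4 := by
    have : 64 * (g ^ 2 * h ^ 2) ≤ H * h ^ 2 := by nlinarith [sq_nonneg h, sq_nonneg g]
    nlinarith [sq_nonneg (8 * (g * h) + f ^ 2)]
  have e4 : A * -(8 * (f ^ 2 * (h * g))) ≤ A * (1 / 2 * (H * h ^ 2) + 1 / 2 * f ^ 4) := by gcongr
  have e5 : |f| * |h| ≤ f ^ 2 / 2 + h ^ 2 / 2 := by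
    nlinarith [sq_nonneg (|f| - |h|), sq_abs f, sq_abs h]
  have e6 : A * (H * (|f| * |h|)) ≤ A * (H * (f ^ 2 / 2 + h ^ 2 / 2)) := by gcongr
  have e7 : A * (H * f ^ 2) ≤ 1 * (H * f ^ 2) := by gcongr
  have e8 : 6 * (H * |f| ^ 3) ≤ 1 / 2 * f ^ 4 + 18 * (H * (H * f ^ 2)) := by
    have : |f| ^ 4 = f ^ 4 := by rw [← abs_pow]; exact abs_of_nonneg (by positivity)
    rw [← this, ← sq_abs f]
    nlinarith [sq_nonneg (|f| ^ 2 - 6 * (H * |f|))]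
  have e9 : H * (H * f ^ 2) ≤ 1 / 360 * (H * f ^ 2) := by gcongr
  have e10 : A * (6 * (H * |f| ^ 3)) ≤ A * (1 / 2 * f ^ 4 + 18 * (1 / 360 * (H * f ^ 2))) := by
    gcongr; linarith
  have e11 : f ^ 2 * (|g| * |f|) ≤ f ^ 4 / 2 + f ^ 2 * g ^ 2 / 2 := by
    have h1 : |g| * |f| ≤ f ^ 2 / 2 + g ^ 2 / 2 := by
      nlinarith [sq_nonneg (|f| - |g|), sq_abs f, sq_abs g]
    have := mul_le_mul_of_nonneg_left h1 (sq_nonneg f)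
    linarith
  have e12 : f ^ 2 * g ^ 2 ≤ f ^ 2 * (H / 200) := by gcongr; linarith
  have e13 : A * (f ^ 2 * (|g| * |f|)) ≤ A * (f ^ 4 / 2 + f ^ 2 * (H / 200) / 2) := by
    gcongr; linarith
  have e14 : f ^ 2 * (200 * (G * c)) ≤ f ^ 2 * H := by gcongr
  have e15 : 0 ≤ H * f ^ 2 := by positivity
  have e16 : 0 ≤ A * f ^ 4 := by positivity
  have e17 : 0 ≤ A * (H * h ^ 2) := by positivity
  linarith

namespace NeckFlow

variable {m S κ : ℝ} {σ a τ β : ℝ → ℝ} {V N : ℕ → ℝ → ℝ → ℝ}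

theorem beta_pow_deriv (h : NeckFlow m S κ σ a τ β V N) {t : ℝ} (ht : t ∈ Ioo 0 S) (n : ℕ) :
    HasDerivAt (fun t => β t ^ n) (-(n / m * β t ^ (n + 1)) * σ t) t := by
  refine ((h.beta_deriv t ht).pow n).congr_deriv ?_
  cases n with
  | zero => simp
  | succ k => push_cast; ring_nf

/-- The Bernstein–Shi estimate: a bound for the derivative `V n` yields one for `V (n + 1)`, without
any assumption on the growth of the latter. -/
theorem bernstein (h : NeckFlow m S κ σ a τ β V N) {n : ℕ} (hn : n ≤ 3) {G K : ℝ} (hG : 0 < G)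
    (hK : 0 ≤ K) (hg : ∀ t ∈ Icc 0 S, ∀ y, V n y t ^ 2 ≤ G * β t ^ n)
    (h0 : ∀ y, V (n + 1) y 0 ^ 2 ≤ K * β 0 ^ (n + 1))
    (hs : ∀ t ∈ Icc 0 S, 201 * (G * β t ^ n) ≤ 1 / 360) (hβ : ∀ t ∈ Icc 0 S, 7 * β t ≤ 1 / 100)
    (hDf : ∀ t ∈ Ioo 0 S, ∀ y, K * β t ^ (n + 1) < V (n + 1) y t ^ 2 →
      V (n + 1) y t * (N (n + 1) y t - ellip (V 1 y t) * V (n + 3) y t - n * a t * V (n + 1) y t) ≤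
        -(1 / 5) * V (n + 1) y t ^ 2
          + 1 / 20 * ellip (V 1 y t) * (|V (n + 1) y t| * |V (n + 2) y t|)
          + 3 * ellip (V 1 y t) * |V (n + 1) y t| ^ 3)
    (hDg : ∀ t ∈ Ioo 0 S, ∀ y,
      |V n y t * (N n y t - ellip (V 1 y t) * V (n + 2) y t + (1 - n) * a t * V n y t)| ≤
        5 * G * β t ^ n + 1 / 20 * ellip (V 1 y t) * (|V n y t| * |V (n + 1) y t|)) :
    ∀ t ∈ Icc 0 S, ∀ y, V (n + 1) y t ^ 2 ≤ 2 * K * β t ^ (n + 1) := by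
  have h00 : (0 : ℝ) ∈ Icc 0 S := ⟨le_rfl, h.time_pos.le⟩
  have hm1 := h.one_le
  have hH : ∀ t ∈ Icc 0 S, ∀ y, 200 * G * β t ^ n + V n y t ^ 2 ≤ 201 * (G * β t ^ n) := by
    intro t ht y; linarith [hg t ht y]
  have hmain := nonpos_of_quadratic_absorption (c₀ := 1 / 2) (c₁ := 1 / 5) h.time_pos
    (by norm_num) (by norm_num) (σ := σ) (a := a)
    (f := fun y t => V (n + 1) y t ^ 2 * (200 * G * β t ^ n + V n y t ^ 2)
      - 201 * G * K * β t ^ (2 * n + 1))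
    (ft := fun y t => 2 * V (n + 1) y t * (N (n + 1) y t - a t * y * V (n + 2) y t
        - n * a t * V (n + 1) y t) * (200 * G * β t ^ n + V n y t ^ 2)
      + V (n + 1) y t ^ 2 * (-(200 * G * (n / m * β t ^ (n + 1)))
        + 2 * V n y t * (N n y t - a t * y * V (n + 1) y t + (1 - n) * a t * V n y t))
      + 201 * G * K * ((2 * n + 1) / m * β t ^ (2 * n + 2)))
    (fy := fun y t => 2 * V (n + 1) y t * V (n + 2) y t * (200 * G * β t ^ n + V n y t ^ 2)
      + 2 * (V (n + 1) y t ^ 3 * V n y t))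
    (fyy := fun y t => (2 * V (n + 2) y t * V (n + 2) y t + 2 * V (n + 1) y t * V (n + 3) y t) *
        (200 * G * β t ^ n + V n y t ^ 2)
      + 10 * (V (n + 1) y t ^ 2 * (V (n + 2) y t * V n y t)) + 2 * V (n + 1) y t ^ 4)
    (A := fun y t => ellip (V 1 y t))
    ?_ ?_ h.rate_pos ?_ ?_ ?_ ?_ ?_ ?_
  · intro t ht y
    have h1 := hmain t ht y
    have hb := h.beta_pos t ht
    have h2 : V (n + 1) y t ^ 2 * (200 * G * β t ^ n + V n y t ^ 2) ≤
        201 * G * K * β t ^ (2 * n + 1) := by linarith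
    have h3 : V (n + 1) y t ^ 2 * (200 * G * β t ^ n) ≤
        V (n + 1) y t ^ 2 * (200 * G * β t ^ n + V n y t ^ 2) := by
      gcongr; linarith [sq_nonneg (V n y t)]
    have h4 : 201 * G * K * β t ^ (2 * n + 1) = (201 / 200 * K * β t ^ (n + 1)) *
        (200 * G * β t ^ n) := by ring
    rw [h4] at h2
    have h5 := le_of_mul_le_mul_right (h3.trans h2) (by positivity)
    have h6 : 0 ≤ K * β t ^ (n + 1) := by positivity
    linarith
  · have hb := h.continuousOn_beta_fst
    exact (((h.cont (n + 1) (by omega)).pow 2).mul ((continuousOn_const.mul (hb.pow n)).add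
      ((h.cont n (by omega)).pow 2))).sub (continuousOn_const.mul (hb.pow _))
  · intro y
    have hb := h.beta_pos 0 h00
    have h1 : V (n + 1) y 0 ^ 2 * (200 * G * β 0 ^ n + V n y 0 ^ 2) ≤
        K * β 0 ^ (n + 1) * (201 * (G * β 0 ^ n)) := by
      gcongr
      · exact h0 y
      · exact hH 0 h00 y
    have h2 : K * β 0 ^ (n + 1) * (201 * (G * β 0 ^ n)) = 201 * G * K * β 0 ^ (2 * n + 1) := by ring
    linarith
  · exact fun t ht => by linarith [(h.a_bounds (Ioo_subset_Icc_self ht)).1]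
  · intro t ht y
    exact ((((h.dt t ht (n + 1) y).pow 2).mul (((h.beta_pow_deriv ht n).const_mul (200 * G)).add
      ((h.dt t ht n y).pow 2))).sub
      ((h.beta_pow_deriv ht (2 * n + 1)).const_mul (201 * G * K))).congr_deriv
      (by simp only [Pi.pow_apply, Pi.add_apply]; push_cast; ring)
  · intro t ht y
    exact ((((h.dy t ht (n + 1) y).pow 2).mul (((h.dy t ht n y).pow 2).const_add _)).sub_const
      _).congr_deriv (by simp only [Pi.pow_apply]; push_cast; ring)
  · intro t ht y
    have d0 := h.dy t ht n y
    have d1 := h.dy t ht (n + 1) y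
    have d2 := h.dy t ht (n + 2) y
    exact (((((d1.const_mul 2).mul d2).mul ((d0.pow 2).const_add _))).add
      (((d1.pow 3).mul d0).const_mul 2)).congr_deriv
      (by simp only [Pi.pow_apply, Pi.mul_apply]; push_cast; ring)
  · exact fun t _ y => (ellip_pos _).le
  · intro t ht y hpos
    have ht' := Ioo_subset_Icc_self ht
    have hb := h.beta_pos t ht'
    have hHy := hH t ht' y
    -- Since H ≤ 201Gβⁿ, positivity of the test function forces (∂ⁿ⁺¹v)² above Kβⁿ⁺¹; this is why
    -- the differential inequality for f is required only there.
    have hK' : K * β t ^ (n + 1) < V (n + 1) y t ^ 2 := by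
      by_contra! hle
      have h1 : V (n + 1) y t ^ 2 * (200 * G * β t ^ n + V n y t ^ 2) ≤
          K * β t ^ (n + 1) * (201 * (G * β t ^ n)) := by gcongr
      have h2 : K * β t ^ (n + 1) * (201 * (G * β t ^ n)) =
        201 * G * K * β t ^ (2 * n + 1) := by ring
      linarith
    have hA0 := ellip_pos (V 1 y t)
    have hA1 := ellip_le_one (V 1 y t)
    have halg := bernstein_algebra hA0 hA1 (hg t ht' y) rfl (hHy.trans (hs t ht'))
      (hDf t ht y hK') (hDg t ht y)
    have e1 : (2 * n + 1) / m * β t ^ (2 * n + 2) ≤ 1 / 100 * β t ^ (2 * n + 1) := by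
      have h1 : ((2 * n + 1 : ℝ)) / m ≤ 7 := by
        have : (n : ℝ) ≤ 3 := by exact_mod_cast hn
        rw [div_le_iff₀ (by linarith)]; linarith
      calc (2 * n + 1) / m * β t ^ (2 * n + 2) ≤ 7 * β t ^ (2 * n + 2) := by gcongr
        _ = 7 * β t * β t ^ (2 * n + 1) := by ring
        _ ≤ 1 / 100 * β t ^ (2 * n + 1) := by gcongr; exact hβ t ht'
    have e2 : 0 ≤ V (n + 1) y t ^ 2 * (200 * G * (n / m * β t ^ (n + 1))) := by positivity
    have hH0 : 0 ≤ 200 * G * β t ^ n + V n y t ^ 2 := by positivity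
    have hHs := hHy.trans (hs t ht')
    set H := 200 * G * β t ^ n + V n y t ^ 2 with hHdef
    set f := V (n + 1) y t
    set g := V n y t
    set r := V (n + 2) y t
    set A := ellip (V 1 y t)
    set X := β t ^ (2 * n + 1)
    have hX : 0 ≤ X := by positivity
    have e3 : 201 * G * K * ((2 * n + 1) / m * β t ^ (2 * n + 2)) ≤
      201 * G * K * (1 / 100 * X) := by gcongr
    have e4 : 0 ≤ 201 * G * K * X := by positivity
    -- H ≤ 1 makes f⁴ dominate the square of the test function, which turns the gain into quadratic
    -- absorption.
    have e5 : A * (f ^ 2 * H - 201 * G * K * X) ^ 2 ≤ A * f ^ 4 := by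
      have h1 : (f ^ 2 * H - 201 * G * K * X) ^ 2 ≤ (f ^ 2 * 1) ^ 2 := by
        gcongr
        have : f ^ 2 * H ≤ f ^ 2 * 1 := by gcongr; linarith
        linarith
      have h2 : (f ^ 2 * 1) ^ 2 = f ^ 4 := by ring
      rw [h2] at h1
      gcongr
    have e6 : 0 ≤ f ^ 2 * H := by positivity
    -- The second derivative of f²H contains 10f²rg; two units of it match the diffusion hidden in
    -- the equation for g, which leaves the 8 of `bernstein_algebra`.
    have id1 : 2 * f * (N (n + 1) y t - a t * y * r - n * a t * f) * H
        + f ^ 2 * (-(200 * G * (n / m * β t ^ (n + 1)))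
          + 2 * g * (N n y t - a t * y * f + (1 - n) * a t * g)) =
        A * ((2 * r * r + 2 * f * V (n + 3) y t) * H + 10 * (f ^ 2 * (r * g)) + 2 * f ^ 4)
        - a t * y * (2 * f * r * H + 2 * (f ^ 3 * g))
        + (2 * H * (f * (N (n + 1) y t - A * V (n + 3) y t - n * a t * f))
          + 2 * f ^ 2 * (g * (N n y t - A * r + (1 - n) * a t * g))
          - A * (2 * r ^ 2 * H + 8 * (f ^ 2 * (r * g)) + 2 * f ^ 4))
        - f ^ 2 * (200 * G * (n / m * β t ^ (n + 1))) := by ring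
    rw [id1]
    linarith

end NeckFlow

/-! ### The third and fourth derivatives -/

namespace NeckFlow

variable {m S κ : ℝ} {σ a τ β : ℝ → ℝ} {V N : ℕ → ℝ → ℝ → ℝ}

/-- The lower order part of the equation for the third derivative. -/
noncomputable def thirdSource (m v w z : ℝ) : ℝ :=
  ellip₃ w * z ^ 4 - 6 * (m / v ^ 2 * (w * z / v)) + 6 * (m / v ^ 2 * (w ^ 3 / v ^ 2))

/-- With x = Gβ, w² ≤ xv and |z| ≤ x, the terms wz/v and w³/v² are of order x^{3/2}, and z⁴ is much
smaller. This fixes the scale β^{3/2} of the third derivative. The constant comes from 3(1 +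
2·36·32/81) < 99. -/
theorem thirdSource_sq_le {m v w z x : ℝ} (hv : 1 ≤ v) (hm0 : 0 ≤ m / v ^ 2)
    (hm : m / v ^ 2 ≤ 50 / 81) (hx0 : 0 ≤ x) (hx : x ≤ 1 / 10000) (hw : w ^ 2 ≤ x * v)
    (hz : z ^ 2 ≤ x ^ 2) : thirdSource m v w z ^ 2 ≤ 99 * x ^ 3 := by
  have hv0 : 0 < v := by linarith
  have hD : (m / v ^ 2) ^ 2 ≤ 32 / 81 := by nlinarith
  have h1 : (ellip₃ w * z ^ 4) ^ 2 ≤ x ^ 3 := by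
    have h3 : ellip₃ w ^ 2 ≤ 24 ^ 2 := by
      rw [← sq_abs]; exact pow_le_pow_left₀ (abs_nonneg _) (abs_ellip₃_le w) 2
    calc (ellip₃ w * z ^ 4) ^ 2 = ellip₃ w ^ 2 * (z ^ 2) ^ 4 := by ring
      _ ≤ 24 ^ 2 * (x ^ 2) ^ 4 := by gcongr
      _ = 24 ^ 2 * x ^ 5 * x ^ 3 := by ring
      _ ≤ 24 ^ 2 * (1 / 10000) ^ 5 * x ^ 3 := by gcongr
      _ ≤ 1 * x ^ 3 := by gcongr; norm_num
      _ = x ^ 3 := one_mul _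
  have h2 : (m / v ^ 2 * (w * z / v)) ^ 2 ≤ 32 / 81 * x ^ 3 := by
    have : (w * z / v) ^ 2 ≤ x ^ 3 := by
      rw [div_pow, mul_pow, div_le_iff₀ (by positivity)]
      calc w ^ 2 * z ^ 2 ≤ x * v * x ^ 2 := by gcongr
        _ = x ^ 3 * (v * 1) := by ring
        _ ≤ x ^ 3 * (v * v) := by gcongr
        _ = x ^ 3 * v ^ 2 := by ring
    rw [mul_pow]; gcongr
  have h3 : (m / v ^ 2 * (w ^ 3 / v ^ 2)) ^ 2 ≤ 32 / 81 * x ^ 3 := by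
    have : (w ^ 3 / v ^ 2) ^ 2 ≤ x ^ 3 := by
      rw [div_pow, div_le_iff₀ (by positivity)]
      calc (w ^ 3) ^ 2 = (w ^ 2) ^ 3 := by ring
        _ ≤ (x * v) ^ 3 := by gcongr
        _ = x ^ 3 * (v ^ 3 * 1) := by ring
        _ ≤ x ^ 3 * (v ^ 3 * v) := by gcongr
        _ = x ^ 3 * (v ^ 2) ^ 2 := by ring
    rw [mul_pow]; gcongr
  have h4 : 0 ≤ x ^ 3 := by positivity
  unfold thirdSource
  set A := ellip₃ w * z ^ 4
  set B := m / v ^ 2 * (w * z / v)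
  set C := m / v ^ 2 * (w ^ 3 / v ^ 2)
  nlinarith [sq_nonneg (A + 6 * B), sq_nonneg (A - 6 * C), sq_nonneg (6 * B + 6 * C)]

/-- Separates the equation into the terms that `bernstein` distinguishes: a cross term absorbed by
the square of the next derivative, a cubic term absorbed by f⁴, a damping term and a source. It
serves both as the equation for f when n = 2 and for g when n = 3. -/
theorem three_identity (h : NeckFlow m S κ σ a τ β V N) {t : ℝ} (ht : t ∈ Ioo 0 S) (y : ℝ) :
    V 3 y t * (N 3 y t - ellip (V 1 y t) * V 5 y t - 2 * a t * V 3 y t) =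
      4 * (ellip₁ (V 1 y t) * (V 2 y t * (V 3 y t * V 4 y t)))
      + 3 * (ellip₁ (V 1 y t) * V 3 y t ^ 3)
      + 6 * (ellip₂ (V 1 y t) * V 2 y t ^ 2 * V 3 y t ^ 2)
      + (m / V 0 y t ^ 2 - 2 * a t) * V 3 y t ^ 2
      + V 3 y t * thirdSource m (V 0 y t) (V 1 y t) (V 2 y t) := by
  have hv := (h.pos t (Ioo_subset_Icc_self ht) y).ne'
  rw [h.N_three ht y, thirdSource]
  field_simp
  ring

/-- Pointwise facts shared by the estimates for the third and fourth derivatives. -/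
theorem pointwise (h : NeckFlow m S κ σ a τ β V N)
    (hδ : ∀ t ∈ Icc 0 S, (9 + κ ^ 2) * β t ≤ 1 / 10000) {t : ℝ} (ht : t ∈ Icc 0 S) (y : ℝ) :
    0 < (9 + κ ^ 2) * β t ∧ V 1 y t ^ 2 ≤ (9 + κ ^ 2) * β t * V 0 y t ∧
      V 2 y t ^ 2 ≤ ((9 + κ ^ 2) * β t) ^ 2 ∧ |V 2 y t| ≤ (9 + κ ^ 2) * β t := by
  have hb := h.beta_pos t ht
  have h1 := h.deriv_two_sq_le (fun t ht => (hδ t ht).trans (by norm_num)) t ht y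
  have hG : 0 < (9 + κ ^ 2) * β t := by positivity
  refine ⟨hG, h.deriv_one_sq_le (fun t ht => ?_) t ht y, h1, abs_le_of_sq_le_sq h1 hG.le⟩
  nlinarith [hδ t ht, h.beta_pos t ht, mul_nonneg (sq_nonneg κ) (h.beta_pos t ht).le]

/-- The estimate `|∂³v| ≤ C β^{3/2}`. -/
theorem deriv_three_sq_le (h : NeckFlow m S κ σ a τ β V N)
    (hδ : ∀ t ∈ Icc 0 S, (9 + κ ^ 2) * β t ≤ 1 / 10000) :
    ∀ t ∈ Icc 0 S, ∀ y, V 3 y t ^ 2 ≤ 259200 * (9 + κ ^ 2) ^ 3 * β t ^ 3 := by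
  have hpt := fun {t} => h.pointwise hδ (t := t)
  have h00 : (0 : ℝ) ∈ Icc 0 S := ⟨le_rfl, h.time_pos.le⟩
  set G : ℝ := 9 + κ ^ 2 with hG
  have hG9 : 9 ≤ G := by rw [hG]; nlinarith [sq_nonneg κ]
  have hGκ : κ ^ 2 ≤ 129600 * G ^ 3 := by
    have h1 : κ ^ 2 ≤ G := by rw [hG]; linarith
    have h2 : (1 : ℝ) ≤ G ^ 2 := one_le_pow₀ (by linarith)
    nlinarith
  -- K is large enough that beyond the threshold p² > 129600x³ ≥ 100·99x³ the source is at most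
  -- |p|/10, so the damping, at least 49/50 - 50/81, still leaves 1/5.
  have hmain := h.bernstein (n := 2) (by norm_num) (G := G ^ 2) (K := 129600 * G ^ 3)
    (by positivity) (by positivity) ?_ ?_ ?_ ?_ ?_ ?_
  · exact fun t ht y => (hmain t ht y).trans_eq (by ring)
  · intro t ht y
    rw [← mul_pow]; exact (hpt ht y).2.2.1
  · intro y
    have hb := h.beta_pos 0 h00
    refine (h.init_higher 3 ⟨by norm_num, by norm_num⟩ y).trans ?_
    gcongr
  · intro t ht
    have h1 := hδ t ht
    have h2 := (hpt ht 0).1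
    rw [← mul_pow]
    nlinarith
  · intro t ht
    have h1 := hδ t ht
    have h2 := h.beta_pos t ht
    nlinarith
  · intro t ht y hlt
    have ht' := Ioo_subset_Icc_self ht
    obtain ⟨hx, hw, hz, hz'⟩ := hpt ht' y
    have hxs := hδ t ht'
    have hv1 := h.one_le_v ht' y
    obtain ⟨hm0, hm1⟩ := h.div_sq_le ht' y
    obtain ⟨ha1, ha2⟩ := h.a_bounds ht'
    have hS := thirdSource_sq_le hv1 hm0 hm1 hx.le hxs hw hz
    have e0 := h.three_identity ht y
    norm_num only [Nat.cast_ofNat, Nat.reduceAdd] at hlt ⊢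
    rw [e0]
    have hA := ellip_pos (V 1 y t)
    have hA1 := abs_ellip₁_le (V 1 y t)
    have hA2 := abs_ellip₂_le (V 1 y t)
    set s := thirdSource m (V 0 y t) (V 1 y t) (V 2 y t)
    set w := V 1 y t
    set z := V 2 y t
    set p := V 3 y t
    set r := V 4 y t
    set x := G * β t with hxdef
    have e1 : ellip₁ w * (z * (p * r)) ≤ ellip w * (1 / 10000 * (|p| * |r|)) := by
      refine (le_abs_self _).trans ?_
      rw [abs_mul, abs_mul z, abs_mul p]
      gcongr; linarith
    have e2 : ellip₁ w * p ^ 3 ≤ ellip w * |p| ^ 3 := by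
      refine (le_abs_self _).trans ?_
      rw [abs_mul, abs_pow]; gcongr
    have e3 : ellip₂ w * z ^ 2 * p ^ 2 ≤ 6 * (1 / 10000) ^ 2 * p ^ 2 := by
      have : z ^ 2 ≤ (1 / 10000) ^ 2 := hz.trans (by gcongr)
      gcongr; exact (le_abs_self _).trans hA2
    have e4 : (m / V 0 y t ^ 2 - 2 * a t) * p ^ 2 ≤ (50 / 81 - 49 / 50) * p ^ 2 := by
      gcongr; linarith
    have e5 : p * s ≤ 1 / 10 * p ^ 2 := by
      have h1 : s ^ 2 ≤ (1 / 10 * |p|) ^ 2 := by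
        rw [mul_pow, sq_abs]
        have h4 : 0 ≤ x ^ 3 := by positivity
        have : 129600 * x ^ 3 < p ^ 2 := by
          rw [hxdef]; linarith
        linarith
      have h2 : |s| ≤ 1 / 10 * |p| := abs_le_of_sq_le_sq h1 (by positivity)
      calc p * s ≤ |p| * |s| := by rw [← abs_mul]; exact le_abs_self _
        _ ≤ |p| * (1 / 10 * |p|) := by gcongr
        _ = 1 / 10 * p ^ 2 := by rw [← sq_abs p]; ring
    have e6 : 0 ≤ ellip w * (|p| * |r|) := by positivity
    linarith [sq_nonneg p]
  · intro t ht y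
    have ht' := Ioo_subset_Icc_self ht
    obtain ⟨hx, hw, hz, hz'⟩ := hpt ht' y
    have hxs := hδ t ht'
    have hv1 := h.one_le_v ht' y
    have hv0 : 0 < V 0 y t := by linarith
    obtain ⟨hm0, hm1⟩ := h.div_sq_le ht' y
    obtain ⟨ha1, ha2⟩ := h.a_bounds ht'
    have hA := ellip_pos (V 1 y t)
    have hA1 := abs_ellip₁_le (V 1 y t)
    have hA2 := abs_ellip₂_le (V 1 y t)
    have e0 : V 2 y t * (N 2 y t - ellip (V 1 y t) * V (2 + 2) y t
        + (1 - ((2 : ℕ) : ℝ)) * a t * V 2 y t) =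
        3 * (ellip₁ (V 1 y t) * (V 2 y t * (V 2 y t * V 3 y t)))
        + ellip₂ (V 1 y t) * (V 2 y t ^ 2) * V 2 y t ^ 2 + (m / V 0 y t ^ 2 - a t) * V 2 y t ^ 2
        - 2 * (m / V 0 y t ^ 2 * (V 1 y t ^ 2 / V 0 y t * V 2 y t)) := by
      rw [h.N_two ht y]
      push_cast
      field_simp
      ring
    rw [e0]
    norm_num only [Nat.reduceAdd]
    set v := V 0 y t
    set w := V 1 y t
    set z := V 2 y t
    set p := V 3 y t
    rw [show 5 * G ^ 2 * β t ^ 2 = 5 * (G * β t) ^ 2 by ring]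
    set x := G * β t with hxdef
    have e1 : |ellip₁ w * (z * (z * p))| ≤ ellip w * (1 / 10000 * (|z| * |p|)) := by
      rw [abs_mul, abs_mul z, abs_mul z]
      gcongr; linarith
    have e2 : |ellip₂ w * (z ^ 2) * z ^ 2| ≤ 6 * (1 / 10000) ^ 2 * x ^ 2 := by
      have : z ^ 2 ≤ (1 / 10000) ^ 2 := hz.trans (by gcongr)
      rw [abs_mul, abs_mul, abs_of_nonneg (sq_nonneg z)]
      gcongr
    have e3 : |(m / v ^ 2 - a t) * z ^ 2| ≤ 1 * x ^ 2 := by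
      rw [abs_mul, abs_of_nonneg (sq_nonneg z)]
      gcongr; exact abs_le.2 ⟨by linarith, by linarith⟩
    have e4 : |m / v ^ 2 * (w ^ 2 / v * z)| ≤ 1 * (x * x) := by
      have : w ^ 2 / v ≤ x := by rw [div_le_iff₀ hv0]; exact hw
      rw [abs_mul, abs_mul, abs_of_nonneg hm0, abs_of_nonneg (by positivity : 0 ≤ w ^ 2 / v)]
      gcongr; linarith
    have e6 : 0 ≤ ellip w * (|z| * |p|) := by positivity
    have b1 := abs_le.1 e1
    have b2 := abs_le.1 e2
    have b3 := abs_le.1 e3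
    have b4 := abs_le.1 e4
    have hx2 := sq_nonneg x
    rw [abs_le]
    constructor <;> linarith [b1.1, b1.2, b2.1, b2.2, b3.1, b3.2, b4.1, b4.2]

/-- The lower order part of the equation for the fourth derivative. -/
noncomputable def fourthSource (m v w z p : ℝ) : ℝ :=
  15 * (ellip₂ w * (z * p ^ 2)) + 10 * (ellip₃ w * (z ^ 2 * (z * p)))
    + ellip₄ w * (z ^ 2 * z ^ 3) - 8 * (m / v ^ 2 * (w * p / v))
    - 6 * (m / v ^ 2 * (z ^ 2 / v)) + 36 * (m / v ^ 2 * (w ^ 2 / v * z / v))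
    - 24 * (m / v ^ 2 * ((w ^ 2 / v) ^ 2 / v))

/-- All terms fit the scale Y, which becomes a multiple of β². The leading contributions are 15·6Y
from the term z p² and 8Y from w p/v; the others total 690x², which 1000x² ≤ Y makes less than Y. -/
theorem abs_fourthSource_le {m v w z p x Y : ℝ} (hv : 1 ≤ v) (hm0 : 0 ≤ m / v ^ 2)
    (hm : m / v ^ 2 ≤ 50 / 81) (hx0 : 0 ≤ x) (hx : x ≤ 1 / 10000) (hw : w ^ 2 ≤ x * v)
    (hz : |z| ≤ x) (hp1 : |p| ≤ 1) (hp : p ^ 2 ≤ Y) (hxp : x * p ^ 2 ≤ Y ^ 2)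
    (hY : 1000 * x ^ 2 ≤ Y) : |fourthSource m v w z p| ≤ 99 * Y := by
  have hv0 : 0 < v := by linarith
  have hY0 : 0 ≤ Y := (sq_nonneg p).trans hp
  have hz1 : |z| ≤ 1 := by linarith
  have hz2 : z ^ 2 ≤ x ^ 2 := by rw [← sq_abs]; gcongr
  have hwv : w ^ 2 / v ≤ x := by rw [div_le_iff₀ hv0]; exact hw
  have hwv0 : 0 ≤ w ^ 2 / v := by positivity
  have hm' : m / v ^ 2 ≤ 1 := by linarith
  have e1 : |ellip₂ w * (z * p ^ 2)| ≤ 6 * (1 * Y) := by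
    rw [abs_mul, abs_mul z, abs_of_nonneg (sq_nonneg p)]
    gcongr; exact abs_ellip₂_le w
  have e2 : |ellip₃ w * (z ^ 2 * (z * p))| ≤ 24 * (x ^ 2 * (1 * 1)) := by
    rw [abs_mul, abs_mul (z ^ 2), abs_mul z, abs_of_nonneg (sq_nonneg z)]
    gcongr; exact abs_ellip₃_le w
  have e3 : |ellip₄ w * (z ^ 2 * z ^ 3)| ≤ 384 * (x ^ 2 * 1 ^ 3) := by
    rw [abs_mul, abs_mul (z ^ 2), abs_pow z 3, abs_of_nonneg (sq_nonneg z)]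
    gcongr; exact abs_ellip₄_le w
  have e4 : |m / v ^ 2 * (w * p / v)| ≤ 1 * Y := by
    have h1 : |w * p / v| ≤ Y := by
      refine abs_le_of_sq_le_sq ?_ hY0
      rw [div_pow, mul_pow, div_le_iff₀ (by positivity)]
      calc w ^ 2 * p ^ 2 ≤ x * v * p ^ 2 := by gcongr
        _ = x * p ^ 2 * (v * 1) := by ring
        _ ≤ Y ^ 2 * (v * v) := by gcongr
        _ = Y ^ 2 * v ^ 2 := by ring
    rw [abs_mul, abs_of_nonneg hm0]
    gcongr
  have e5 : |m / v ^ 2 * (z ^ 2 / v)| ≤ 1 * (x ^ 2 / 1) := by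
    rw [abs_mul, abs_of_nonneg hm0, abs_of_nonneg (by positivity)]
    gcongr
  have e6 : |m / v ^ 2 * (w ^ 2 / v * z / v)| ≤ 1 * (x * x / 1) := by
    rw [abs_mul, abs_div (w ^ 2 / v * z), abs_mul (w ^ 2 / v), abs_of_nonneg hm0,
      abs_of_nonneg hwv0, abs_of_pos hv0]
    gcongr
  have e7 : |m / v ^ 2 * ((w ^ 2 / v) ^ 2 / v)| ≤ 1 * (x ^ 2 / 1) := by
    rw [abs_mul, abs_of_nonneg hm0, abs_of_nonneg (by positivity)]
    gcongr
  have b1 := abs_le.1 e1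
  have b2 := abs_le.1 e2
  have b3 := abs_le.1 e3
  have b4 := abs_le.1 e4
  have b5 := abs_le.1 e5
  have b6 := abs_le.1 e6
  have b7 := abs_le.1 e7
  unfold fourthSource
  rw [abs_le]
  constructor <;> linarith [b1.1, b1.2, b2.1, b2.2, b3.1, b3.2, b4.1, b4.2, b5.1, b5.2,
    b6.1, b6.2, b7.1, b7.2]

theorem four_identity (h : NeckFlow m S κ σ a τ β V N) {t : ℝ} (ht : t ∈ Ioo 0 S) (y : ℝ) :
    V 4 y t * (N 4 y t - ellip (V 1 y t) * V 6 y t - 3 * a t * V 4 y t) =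
      5 * (ellip₁ (V 1 y t) * (V 2 y t * (V 4 y t * V 5 y t)))
      + 10 * (ellip₁ (V 1 y t) * V 3 y t * V 4 y t ^ 2)
      + 10 * (ellip₂ (V 1 y t) * V 2 y t ^ 2 * V 4 y t ^ 2)
      + (m / V 0 y t ^ 2 - 3 * a t) * V 4 y t ^ 2
      + V 4 y t * fourthSource m (V 0 y t) (V 1 y t) (V 2 y t) (V 3 y t) := by
  have hv := (h.pos t (Ioo_subset_Icc_self ht) y).ne'
  rw [h.N_four ht y, fourthSource]
  field_simp
  ring

/-- The estimate `|∂⁴v| ≤ C β²`. -/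
theorem deriv_four_sq_le (h : NeckFlow m S κ σ a τ β V N)
    (hδ : ∀ t ∈ Icc 0 S, (9 + κ ^ 2) * β t ≤ 1 / 10000) :
    ∀ t ∈ Icc 0 S, ∀ y,
      V 4 y t ^ 2 ≤ 2 * (1000 * (259200 * (9 + κ ^ 2) ^ 3)) ^ 2 * β t ^ 4 := by
  have hpt := fun {t} => h.pointwise hδ (t := t)
  have h00 : (0 : ℝ) ∈ Icc 0 S := ⟨le_rfl, h.time_pos.le⟩
  have hthree := h.deriv_three_sq_le hδ
  set G : ℝ := 9 + κ ^ 2 with hG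
  have hG9 : 9 ≤ G := by rw [hG]; nlinarith [sq_nonneg κ]
  set P : ℝ := 259200 * G ^ 3 with hP
  have hGP : 259200 * G ^ 2 ≤ P := by
    rw [hP]; nlinarith [sq_nonneg G]
  have hG2 : (1 : ℝ) ≤ G ^ 2 := one_le_pow₀ (by linarith)
  have hP1 : 1 ≤ P := by linarith
  have hκP : κ ^ 2 ≤ (1000 * P) ^ 2 := by
    have h1 : κ ^ 2 ≤ G := by rw [hG]; linarith
    have h2 : G ≤ P := by nlinarith
    nlinarith
  have hPs : ∀ t ∈ Icc 0 S, P * β t ^ 3 ≤ 1 / 1000000 := by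
    intro t ht
    have h1 : (G * β t) ^ 3 ≤ (1 / 10000) ^ 3 :=
      pow_le_pow_left₀ (hpt ht 0).1.le (hδ t ht) 3
    have h2 : P * β t ^ 3 = 259200 * (G * β t) ^ 3 := by rw [hP]; ring
    rw [h2]; linarith
  have hβ1 : ∀ t ∈ Icc 0 S, 7 * β t ≤ 1 / 100 := by
    intro t ht
    nlinarith [hδ t ht, h.beta_pos t ht]
  have hp1 : ∀ t ∈ Icc 0 S, ∀ y, |V 3 y t| ≤ 1 / 1000 := by
    intro t ht y
    refine abs_le_of_sq_le_sq ((hthree t ht y).trans ((hPs t ht).trans ?_)) (by norm_num)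
    norm_num
  -- With K = (1000P)², the threshold |∂⁴v| > 1000Pβ² makes the source, at most 99Pβ², smaller than
  -- a tenth of |∂⁴v|.
  have hmain := h.bernstein (n := 3) (by norm_num) (G := P) (K := (1000 * P) ^ 2)
    (by positivity) (by positivity) hthree ?_ ?_ hβ1 ?_ ?_
  · exact fun t ht y => hmain t ht y
  · intro y
    have hb := h.beta_pos 0 h00
    refine (h.init_higher 4 ⟨by norm_num, by norm_num⟩ y).trans ?_
    gcongr
  · intro t ht
    linarith [hPs t ht]
  · intro t ht y hlt
    have ht' := Ioo_subset_Icc_self ht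
    obtain ⟨hx, hw, hz, hz'⟩ := hpt ht' y
    have hxs := hδ t ht'
    have hb := h.beta_pos t ht'
    have hb1 := hβ1 t ht'
    have hv1 := h.one_le_v ht' y
    obtain ⟨hm0, hm1⟩ := h.div_sq_le ht' y
    obtain ⟨ha1, ha2⟩ := h.a_bounds ht'
    have hp := hthree t ht' y
    have hp' := hp1 t ht' y
    have hβ2 : β t ^ 3 ≤ β t ^ 2 := by nlinarith [sq_nonneg (β t)]
    have hS : |fourthSource m (V 0 y t) (V 1 y t) (V 2 y t) (V 3 y t)| ≤ 99 * (P * β t ^ 2) := by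
      refine abs_fourthSource_le hv1 hm0 hm1 hx.le hxs hw hz' (hp'.trans (by norm_num)) ?_ ?_ ?_
      · exact hp.trans (by gcongr)
      · calc G * β t * V 3 y t ^ 2 ≤ P * β t * (P * β t ^ 3) := by
              gcongr; nlinarith
          _ = (P * β t ^ 2) ^ 2 := by ring
      · calc 1000 * (G * β t) ^ 2 = (1000 * G ^ 2) * β t ^ 2 := by ring
          _ ≤ P * β t ^ 2 := by gcongr; linarith
    have e0 := h.four_identity ht y
    norm_num only [Nat.cast_ofNat, Nat.reduceAdd] at hlt ⊢
    rw [e0]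
    have hA := ellip_pos (V 1 y t)
    have hA1 := abs_ellip₁_le (V 1 y t)
    have hA1' := ellip_le_one (V 1 y t)
    have hA2 := abs_ellip₂_le (V 1 y t)
    set s := fourthSource m (V 0 y t) (V 1 y t) (V 2 y t) (V 3 y t)
    set w := V 1 y t
    set z := V 2 y t
    set p := V 3 y t
    set r := V 4 y t
    have e1 : ellip₁ w * (z * (r * V 5 y t)) ≤ ellip w * (1 / 10000 * (|r| * |V 5 y t|)) := by
      refine (le_abs_self _).trans ?_
      rw [abs_mul, abs_mul z, abs_mul r]
      gcongr; linarith
    have e2 : ellip₁ w * p * r ^ 2 ≤ 1 * (1 / 1000) * r ^ 2 := by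
      have : ellip₁ w * p ≤ 1 * (1 / 1000) := by
        refine (le_abs_self _).trans ?_
        rw [abs_mul]; gcongr; linarith
      gcongr
    have e3 : ellip₂ w * z ^ 2 * r ^ 2 ≤ 6 * (1 / 10000) ^ 2 * r ^ 2 := by
      have : z ^ 2 ≤ (1 / 10000) ^ 2 := hz.trans (by gcongr)
      gcongr; exact (le_abs_self _).trans hA2
    have e4 : (m / V 0 y t ^ 2 - 3 * a t) * r ^ 2 ≤ (50 / 81 - 147 / 100) * r ^ 2 := by
      gcongr; linarith
    have e5 : r * s ≤ 1 / 10 * r ^ 2 := by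
      have h1 : 1000 * P * β t ^ 2 ≤ |r| := by
        refine le_of_lt (lt_of_pow_lt_pow_left₀ 2 (abs_nonneg _) ?_)
        rw [sq_abs]
        calc (1000 * P * β t ^ 2) ^ 2 = (1000 * P) ^ 2 * β t ^ 4 := by ring
          _ < r ^ 2 := by linarith
      have h2 : |s| ≤ 1 / 10 * |r| := by
        have : 0 ≤ P * β t ^ 2 := by positivity
        linarith
      calc r * s ≤ |r| * |s| := by rw [← abs_mul]; exact le_abs_self _
        _ ≤ |r| * (1 / 10 * |r|) := by gcongr
        _ = 1 / 10 * r ^ 2 := by rw [← sq_abs r]; ring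
    have e6 : 0 ≤ ellip w * (|r| * |V 5 y t|) := by positivity
    have e7 : 0 ≤ ellip w * |r| ^ 3 := by positivity
    linarith [sq_nonneg r]
  · intro t ht y
    have ht' := Ioo_subset_Icc_self ht
    obtain ⟨hx, hw, hz, hz'⟩ := hpt ht' y
    have hxs := hδ t ht'
    have hb := h.beta_pos t ht'
    have hv1 := h.one_le_v ht' y
    obtain ⟨hm0, hm1⟩ := h.div_sq_le ht' y
    obtain ⟨ha1, ha2⟩ := h.a_bounds ht'
    have hp := hthree t ht' y
    have hp' := hp1 t ht' y
    have hS := thirdSource_sq_le hv1 hm0 hm1 hx.le hxs hw hz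
    have e0 : V 3 y t * (N 3 y t - ellip (V 1 y t) * V (3 + 2) y t
        + (1 - ((3 : ℕ) : ℝ)) * a t * V 3 y t) =
        V 3 y t * (N 3 y t - ellip (V 1 y t) * V 5 y t - 2 * a t * V 3 y t) := by
      push_cast; ring
    rw [e0, h.three_identity ht y]
    norm_num only [Nat.reduceAdd]
    have hA := ellip_pos (V 1 y t)
    have hA1 := abs_ellip₁_le (V 1 y t)
    have hA1' := ellip_le_one (V 1 y t)
    have hA2 := abs_ellip₂_le (V 1 y t)
    set s := thirdSource m (V 0 y t) (V 1 y t) (V 2 y t)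
    set w := V 1 y t
    set z := V 2 y t
    set p := V 3 y t
    set r := V 4 y t
    have hs : s ^ 2 ≤ P * β t ^ 3 := by
      have h1 : P * β t ^ 3 = 259200 * (G * β t) ^ 3 := by rw [hP]; ring
      have h2 : 0 ≤ (G * β t) ^ 3 := by positivity
      rw [h1]; linarith
    set Y := P * β t ^ 3 with hY
    have hY5 : 5 * P * β t ^ 3 = 5 * Y := by rw [hY]; ring
    rw [hY5]
    have hp1' : |p| ≤ 1 := hp'.trans (by norm_num)
    have e1 : |ellip₁ w * (z * (p * r))| ≤ ellip w * (1 / 10000 * (|p| * |r|)) := by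
      rw [abs_mul, abs_mul z, abs_mul p]
      gcongr; linarith
    have e2 : |ellip₁ w * p ^ 3| ≤ 1 * (1 / 1000 * Y) := by
      rw [abs_mul, show |p ^ 3| = |p| * p ^ 2 by rw [abs_pow, ← sq_abs p]; ring]
      gcongr; linarith
    have e3 : |ellip₂ w * z ^ 2 * p ^ 2| ≤ 6 * (1 / 10000) ^ 2 * Y := by
      have : z ^ 2 ≤ (1 / 10000) ^ 2 := hz.trans (by gcongr)
      rw [abs_mul, abs_mul, abs_of_nonneg (sq_nonneg z), abs_of_nonneg (sq_nonneg p)]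
      gcongr
    have e4 : |(m / V 0 y t ^ 2 - 2 * a t) * p ^ 2| ≤ 51 / 50 * Y := by
      rw [abs_mul, abs_of_nonneg (sq_nonneg p)]
      gcongr; exact abs_le.2 ⟨by linarith, by linarith⟩
    have e5 : |p * s| ≤ Y := by
      rw [abs_mul]
      have := two_mul_le_add_sq |p| |s|
      rw [sq_abs, sq_abs] at this
      linarith
    have e6 : 0 ≤ ellip w * (|p| * |r|) := by positivity
    have hY0 : 0 ≤ Y := (sq_nonneg p).trans hp
    obtain ⟨b1, b1'⟩ := abs_le.1 e1
    obtain ⟨b2, b2'⟩ := abs_le.1 e2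
    obtain ⟨b3, b3'⟩ := abs_le.1 e3
    obtain ⟨b4, b4'⟩ := abs_le.1 e4
    obtain ⟨b5, b5'⟩ := abs_le.1 e5
    clear e1 e2 e3 e4 e5 hs hS hp hp' hm0 hm1 ha1 ha2 hz hw
    rw [abs_le]
    constructor <;> linarith

end NeckFlow

/-! ### Mixed derivatives of smooth functions of two variables -/

theorem hasDerivAt_fst_of_differentiableAt {G : ℝ × ℝ → ℝ} {x t : ℝ}
    (h : DifferentiableAt ℝ G (x, t)) :
    HasDerivAt (fun ξ => G (ξ, t)) (fderiv ℝ G (x, t) (1, 0)) x :=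
  h.hasFDerivAt.comp_hasDerivAt x ((hasDerivAt_id' x).prodMk (hasDerivAt_const x t))

theorem hasDerivAt_snd_of_differentiableAt {G : ℝ × ℝ → ℝ} {x t : ℝ}
    (h : DifferentiableAt ℝ G (x, t)) :
    HasDerivAt (fun s => G (x, s)) (fderiv ℝ G (x, t) (0, 1)) t :=
  h.hasFDerivAt.comp_hasDerivAt t ((hasDerivAt_const t x).prodMk (hasDerivAt_id' t))

/-- The mixed second derivatives of a smooth function agree. -/
theorem hasDerivAt_mixed {G : ℝ × ℝ → ℝ} {x t : ℝ} (h : ContDiffAt ℝ ∞ G (x, t)) :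
    ∃ D : ℝ, HasDerivAt (fun s => fderiv ℝ G (x, s) (1, 0)) D t ∧
      HasDerivAt (fun ξ => fderiv ℝ G (ξ, t) (0, 1)) D x := by
  have hd : DifferentiableAt ℝ (fderiv ℝ G) (x, t) :=
    (h.fderiv_right (m := 1) (by norm_cast)).differentiableAt one_ne_zero
  have hs : IsSymmSndFDerivAt ℝ G (x, t) := h.isSymmSndFDerivAt (by simp; norm_cast)
  refine ⟨fderiv ℝ (fderiv ℝ G) (x, t) (0, 1) (1, 0), ?_, ?_⟩
  · have h1 := hd.hasFDerivAt.comp_hasDerivAt t ((hasDerivAt_const t x).prodMk (hasDerivAt_id' t))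
    have h2 := h1.clm_apply (hasDerivAt_const t ((1, 0) : ℝ × ℝ))
    simpa using h2
  · have h1 := hd.hasFDerivAt.comp_hasDerivAt x ((hasDerivAt_id' x).prodMk (hasDerivAt_const x t))
    have h2 := h1.clm_apply (hasDerivAt_const x ((0, 1) : ℝ × ℝ))
    rw [hs.eq]
    simpa using h2

namespace NeckPinch

section Smoothness

variable {d : ℕ} {u : ℝ → ℝ → ℝ} {T : ℝ}

theorem isOpen_slab (T : ℝ) : IsOpen ((univ : Set ℝ) ×ˢ Ioo 0 T) := isOpen_univ.prod isOpen_Ioo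

theorem IsMCFSolution.contDiffOn_iteratedDeriv (hu : IsMCFSolution d u T) (n : ℕ) :
    ContDiffOn ℝ ∞ (fun z : ℝ × ℝ => iteratedDeriv n (fun x => u x z.2) z.1)
      (univ ×ˢ Ioo 0 T) := by
  induction n with
  | zero => simpa using hu.smooth
  | succ n ih =>
    refine ((ih.fderiv_of_isOpen (isOpen_slab T) (m := ∞) (by simp)).clm_apply
      (contDiffOn_const (c := ((1, 0) : ℝ × ℝ)))).congr fun z hz => ?_
    have h1 := (ih.differentiableOn (by simp)).differentiableAt ((isOpen_slab T).mem_nhds hz)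
    rw [iteratedDeriv_succ]
    exact (hasDerivAt_fst_of_differentiableAt (x := z.1) (t := z.2) h1).deriv

theorem IsMCFSolution.contDiffAt_iteratedDeriv (hu : IsMCFSolution d u T) (n : ℕ) {t : ℝ}
    (ht : t ∈ Ioo 0 T) (x : ℝ) :
    ContDiffAt ℝ ∞ (fun z : ℝ × ℝ => iteratedDeriv n (fun x => u x z.2) z.1) (x, t) :=
  (hu.contDiffOn_iteratedDeriv n).contDiffAt ((isOpen_slab T).mem_nhds ⟨mem_univ _, ht⟩)

theorem IsMCFSolution.differentiableAt_iteratedDeriv (hu : IsMCFSolution d u T) (n : ℕ) {t : ℝ}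
    (ht : t ∈ Ioo 0 T) (x : ℝ) :
    DifferentiableAt ℝ (fun z : ℝ × ℝ => iteratedDeriv n (fun x => u x z.2) z.1) (x, t) :=
  (hu.contDiffAt_iteratedDeriv n ht x).differentiableAt (by simp)

theorem IsMCFSolution.hasDerivAt_iteratedDeriv (hu : IsMCFSolution d u T) (n : ℕ) {t : ℝ}
    (ht : t ∈ Ioo 0 T) (x : ℝ) :
    HasDerivAt (iteratedDeriv n fun ξ => u ξ t) (iteratedDeriv (n + 1) (fun ξ => u ξ t) x) x := by
  have h := hasDerivAt_fst_of_differentiableAt (hu.differentiableAt_iteratedDeriv n ht x)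
  rw [iteratedDeriv_succ, h.deriv]
  exact h

theorem IsMCFSolution.fderiv_fst (hu : IsMCFSolution d u T) (n : ℕ) {t : ℝ}
    (ht : t ∈ Ioo 0 T) (x : ℝ) :
    fderiv ℝ (fun z : ℝ × ℝ => iteratedDeriv n (fun x => u x z.2) z.1) (x, t) (1, 0) =
      iteratedDeriv (n + 1) (fun ξ => u ξ t) x :=
  (hasDerivAt_fst_of_differentiableAt (hu.differentiableAt_iteratedDeriv n ht x)).unique
    (hu.hasDerivAt_iteratedDeriv n ht x)

/-- The time derivative of the `n`-th space derivative. -/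
noncomputable def timeDeriv (u : ℝ → ℝ → ℝ) (n : ℕ) (x t : ℝ) : ℝ :=
  deriv (fun s => iteratedDeriv n (fun ξ => u ξ s) x) t

theorem IsMCFSolution.fderiv_snd (hu : IsMCFSolution d u T) (n : ℕ) {t : ℝ}
    (ht : t ∈ Ioo 0 T) (x : ℝ) :
    fderiv ℝ (fun z : ℝ × ℝ => iteratedDeriv n (fun x => u x z.2) z.1) (x, t) (0, 1) =
      timeDeriv u n x t :=
  ((hasDerivAt_snd_of_differentiableAt (hu.differentiableAt_iteratedDeriv n ht x)).deriv).symm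

/-- Symmetry of second derivatives: ∂_x∂_t∂_xⁿu = ∂_t∂_xⁿ⁺¹u. Thus the right-hand side of the
equation may be differentiated in space without a separate computation. -/
theorem IsMCFSolution.hasDerivAt_timeDeriv (hu : IsMCFSolution d u T) (n : ℕ) {t : ℝ}
    (ht : t ∈ Ioo 0 T) (x : ℝ) :
    HasDerivAt (fun ξ => timeDeriv u n ξ t) (timeDeriv u (n + 1) x t) x := by
  obtain ⟨D, h1, h2⟩ := hasDerivAt_mixed (hu.contDiffAt_iteratedDeriv n ht x)
  have e1 : (fun s => fderiv ℝ (fun z : ℝ × ℝ => iteratedDeriv n (fun x => u x z.2) z.1)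
      (x, s) (1, 0)) =ᶠ[𝓝 t] fun s => iteratedDeriv (n + 1) (fun ξ => u ξ s) x := by
    filter_upwards [Ioo_mem_nhds ht.1 ht.2] with s hs using hu.fderiv_fst n hs x
  have e2 : D = timeDeriv u (n + 1) x t := by
    rw [timeDeriv, ← e1.deriv_eq, h1.deriv]
  rw [← e2]
  simpa only [hu.fderiv_snd n ht] using h2

/-- The derivative along a curve `s ↦ (l s y, s)`. -/
theorem IsMCFSolution.hasDerivAt_comp_curve (hu : IsMCFSolution d u T) (n : ℕ) {t : ℝ}
    (ht : t ∈ Ioo 0 T) {l : ℝ → ℝ} {l' : ℝ} (hl : HasDerivAt l l' t) (y : ℝ) :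
    HasDerivAt (fun s => iteratedDeriv n (fun ξ => u ξ s) (l s * y))
      (l' * y * iteratedDeriv (n + 1) (fun ξ => u ξ t) (l t * y) + timeDeriv u n (l t * y) t) t := by
  have h1 := HasFDerivAt.comp_hasDerivAt (f := fun s => (l s * y, s)) t
    (hu.differentiableAt_iteratedDeriv n ht (l t * y)).hasFDerivAt
    ((hl.mul_const y).prodMk (hasDerivAt_id' t))
  refine h1.congr_deriv ?_
  have : ((l' * y, 1) : ℝ × ℝ) = (l' * y) • ((1, 0) : ℝ × ℝ) + (0, 1) := by simp
  rw [this, map_add, map_smul, hu.fderiv_fst n ht, hu.fderiv_snd n ht, smul_eq_mul]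

theorem iteratedDeriv_rescaled {lam : ℝ → ℝ} {n : ℕ} {t : ℝ}
    (h : ContDiff ℝ n (fun x => u x t)) (y : ℝ) :
    iteratedDeriv n (rescaled u lam t) y =
      (lam t)⁻¹ * (lam t ^ n * iteratedDeriv n (fun ξ => u ξ t) (lam t * y)) := by
  have e : rescaled u lam t = fun y => (lam t)⁻¹ * (fun y => (fun x => u x t) (lam t * y)) y := rfl
  rw [e, iteratedDeriv_const_mul_field, iteratedDeriv_comp_const_mul h]

theorem IsMCFSolution.contDiff_slice_of_mem_Ioo (hu : IsMCFSolution d u T) {t : ℝ}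
    (ht : t ∈ Ioo 0 T) (n : ℕ) : ContDiff ℝ n (fun x => u x t) := by
  have h : ContDiff ℝ ∞ (fun x => u x t) := by
    refine contDiff_iff_contDiffAt.2 fun x => ?_
    have h1 : ContDiffAt ℝ ∞ (fun z : ℝ × ℝ => u z.1 z.2) (x, t) :=
      hu.smooth.contDiffAt ((isOpen_slab T).mem_nhds ⟨mem_univ _, ht⟩)
    exact h1.comp x (contDiffAt_id.prodMk contDiffAt_const)
  exact h.of_le (by exact_mod_cast le_top)

end Smoothness

/-! ### From the original solution to the rescaled flow -/

/-- A solution of the mean curvature flow equation gives a rescaled flow. -/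
theorem rescaledFlow_of_isMCFSolution {d : ℕ} {u : ℝ → ℝ → ℝ} {lam a b : ℝ → ℝ} {T S : ℝ}
    (hu : IsMCFSolution d u T) (hA : ConditionA d u lam a b T) (hS : 0 < S) (hST : S ≤ T) :
    RescaledFlow ((d : ℝ) - 1) S (fun t => (lam t ^ 2)⁻¹) a
      (fun n y t => iteratedDeriv n (rescaled u lam t) y)
      (fun n y t => lam t ^ (n + 1) * timeDeriv u n (lam t * y) t) := by
  have hsub : Icc 0 S ⊆ Icc 0 T := Icc_subset_Icc le_rfl hST
  have hsub' : Ioo 0 S ⊆ Ioo 0 T := Ioo_subset_Ioo le_rfl hST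
  have hlamc : ContinuousOn lam (Icc 0 S) := fun t ht =>
    ((hA.lam_deriv t (hsub ht)).continuousWithinAt).mono hsub
  have hlam : ∀ t ∈ Icc 0 S, 0 < lam t := fun t ht => hA.lam_pos t (hsub ht)
  have hlamd : ∀ t ∈ Ioo 0 S, HasDerivAt lam (-(a t) / lam t) t := fun t ht =>
    (hA.lam_deriv t (hsub (Ioo_subset_Icc_self ht))).hasDerivAt
      (Icc_mem_nhds (hsub' ht).1 (hsub' ht).2)
  refine ⟨hS, ?_, ?_, ?_, ?_, ?_, ?_, ?_⟩
  · intro t ht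
    have := hlam t (Ioo_subset_Icc_self ht)
    positivity
  · intro t ht y
    have h1 := hlam t ht
    have h2 := hu.pos t (hsub ht) (lam t * y)
    simp only [iteratedDeriv_zero, rescaled]
    positivity
  · intro n hn
    have h1 : ContinuousOn (fun z : ℝ × ℝ => lam z.2) (univ ×ˢ Icc 0 S) :=
      hlamc.comp continuousOn_snd fun _ hz => hz.2
    have h2 : ContinuousOn (fun z : ℝ × ℝ => (lam z.2 * z.1, z.2)) (univ ×ˢ Icc 0 S) :=
      (h1.mul continuousOn_fst).prodMk continuousOn_snd
    have h3 := (hu.continuousOn_deriv n hn).comp h2 fun z hz => ⟨mem_univ _, hsub hz.2⟩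
    refine ((h1.inv₀ fun z hz => (hlam z.2 hz.2).ne').mul ((h1.pow n).mul h3)).congr ?_
    intro z hz
    exact iteratedDeriv_rescaled ((hu.contDiff_slice z.2 (hsub hz.2)).of_le
      (by exact_mod_cast hn)) z.1
  · intro t ht n y
    have e : ∀ k y, iteratedDeriv k (rescaled u lam t) y =
        (lam t)⁻¹ * (lam t ^ k * iteratedDeriv k (fun ξ => u ξ t) (lam t * y)) := fun k y =>
      iteratedDeriv_rescaled (hu.contDiff_slice_of_mem_Ioo (hsub' ht) k) y
    simp only [e]
    have h1 := (hu.hasDerivAt_iteratedDeriv n (hsub' ht) (lam t * y)).comp y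
      ((hasDerivAt_id' y).const_mul (lam t))
    exact ((h1.const_mul (lam t ^ n)).const_mul (lam t)⁻¹).congr_deriv (by ring)
  · intro t ht n y
    have h1 := (hu.hasDerivAt_timeDeriv n (hsub' ht) (lam t * y)).comp y
      ((hasDerivAt_id' y).const_mul (lam t))
    exact (h1.const_mul (lam t ^ (n + 1))).congr_deriv (by ring)
  · intro t ht y
    have hl := hlam t (Ioo_subset_Icc_self ht)
    have e : ∀ k y, iteratedDeriv k (rescaled u lam t) y =
        (lam t)⁻¹ * (lam t ^ k * iteratedDeriv k (fun ξ => u ξ t) (lam t * y)) := fun k y =>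
      iteratedDeriv_rescaled (hu.contDiff_slice_of_mem_Ioo (hsub' ht) k) y
    have h1 := hu.eqn t (hsub' ht) (lam t * y)
    have h2 := hu.pos t (hsub (Ioo_subset_Icc_self ht)) (lam t * y)
    simp only [e, timeDeriv, iteratedDeriv_zero, iteratedDeriv_one]
    rw [h1, ellip, zero_add, pow_one]
    field_simp
  · intro t ht n y
    have hl := hlam t (Ioo_subset_Icc_self ht)
    have e : ∀ k, ∀ s ∈ Ioo 0 S, iteratedDeriv k (rescaled u lam s) y =
        (lam s)⁻¹ * (lam s ^ k * iteratedDeriv k (fun ξ => u ξ s) (lam s * y)) := fun k s hs =>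
      iteratedDeriv_rescaled (hu.contDiff_slice_of_mem_Ioo (hsub' hs) k) y
    -- Here ∂_yⁿv = λⁿ⁻¹∂_xⁿu and ∂_τ = λ²∂_t, which explains the factor λⁿ⁺¹ in `N n`. The relation
    -- λ' = -a/λ produces the terms in a: one from the moving point λy, one from the power λⁿ⁻¹.
    have h1 := hu.hasDerivAt_comp_curve n (hsub' ht) (hlamd t ht) y
    have h2 := ((hlamd t ht).inv hl.ne').mul (((hlamd t ht).pow n).mul h1)
    have h3 : (fun s => iteratedDeriv n (rescaled u lam s) y) =ᶠ[𝓝 t] fun s =>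
        (lam s)⁻¹ * (lam s ^ n * iteratedDeriv n (fun ξ => u ξ s) (lam s * y)) := by
      filter_upwards [Ioo_mem_nhds ht.1 ht.2] with s hs using e n s hs
    refine (HasDerivAt.congr_of_eventuallyEq h2 h3).congr_deriv ?_
    rw [e n t ht, e (n + 1) t ht]
    simp only [Pi.mul_apply, Pi.pow_apply, Pi.inv_apply]
    -- The power rule involves the truncated exponent n - 1, so n = 0 is treated apart.
    cases n with
    | zero => simp; field_simp; ring
    | succ k => simp only [Nat.add_sub_cancel]; push_cast; field_simp; ring

end NeckPinch

namespace NeckPinch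

/-! ### The almost solution -/

section AlmostSolution

variable {d : ℕ} {a b : ℝ}

theorem almostSol_arg_pos (hd : 1 ≤ (d : ℝ) - 1) (ha : 0 < a + 1 / 2) (hb : 0 < b) (y : ℝ) :
    0 < (2 * ((d : ℝ) - 1) + b * y ^ 2) / (a + 1 / 2) := by positivity

theorem almostSol_sq (hd : 1 ≤ (d : ℝ) - 1) (ha : 0 < a + 1 / 2) (hb : 0 < b) (y : ℝ) :
    almostSol d a b y ^ 2 = (2 * ((d : ℝ) - 1) + b * y ^ 2) / (a + 1 / 2) :=
  Real.sq_sqrt (almostSol_arg_pos hd ha hb y).le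

theorem almostSol_pos (hd : 1 ≤ (d : ℝ) - 1) (ha : 0 < a + 1 / 2) (hb : 0 < b) (y : ℝ) :
    0 < almostSol d a b y := Real.sqrt_pos.2 (almostSol_arg_pos hd ha hb y)

theorem almostSol_contDiff (hd : 1 ≤ (d : ℝ) - 1) (ha : 0 < a + 1 / 2) (hb : 0 < b)
    (n : WithTop ℕ∞) : ContDiff ℝ n (almostSol d a b) := by
  refine ContDiff.sqrt ?_ fun y => (almostSol_arg_pos hd ha hb y).ne'
  fun_prop

theorem almostSol_hasDerivAt (hd : 1 ≤ (d : ℝ) - 1) (ha : 0 < a + 1 / 2) (hb : 0 < b) (y : ℝ) :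
    HasDerivAt (almostSol d a b) (b / (a + 1 / 2) * y / almostSol d a b y) y := by
  have h1 := (((((hasDerivAt_id' y).pow 2).const_mul b).const_add
    (2 * ((d : ℝ) - 1))).div_const (a + 1 / 2)).sqrt (almostSol_arg_pos hd ha hb y).ne'
  refine h1.congr_deriv ?_
  have h2 := almostSol_pos hd ha hb y
  change _ / (2 * almostSol d a b y) = _
  field_simp; norm_num

/-- With c = b/(a + 1/2), W² = α + cy² and W' = cy/W, so W'² = c · cy²/W² ≤ c. -/
theorem almostSol_iteratedDeriv_one_sq_le (hd : 1 ≤ (d : ℝ) - 1) (ha : 0 < a + 1 / 2)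
    (hb : 0 < b) (y : ℝ) : iteratedDeriv 1 (almostSol d a b) y ^ 2 ≤ b / (a + 1 / 2) := by
  rw [iteratedDeriv_one, (almostSol_hasDerivAt hd ha hb y).deriv, div_pow, almostSol_sq hd ha hb]
  rw [div_le_iff₀ (almostSol_arg_pos hd ha hb y)]
  have : b / (a + 1 / 2) * ((2 * ((d : ℝ) - 1) + b * y ^ 2) / (a + 1 / 2)) =
    (b / (a + 1 / 2) * y) ^ 2 + b / (a + 1 / 2) * (2 * ((d : ℝ) - 1) / (a + 1 / 2)) := by
    field_simp; ring
  rw [this]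
  have : 0 ≤ b / (a + 1 / 2) * (2 * ((d : ℝ) - 1) / (a + 1 / 2)) := by positivity
  linarith

/-- In the same notation W'' = cα/W³, and α ≤ W² ≤ W³ because a ≤ 3/2 forces α ≥ 1. -/
theorem abs_almostSol_iteratedDeriv_two_le (hd : 1 ≤ (d : ℝ) - 1) (ha : 0 < a + 1 / 2)
    (ha1 : a ≤ 3 / 2) (hb : 0 < b) (y : ℝ) :
    |iteratedDeriv 2 (almostSol d a b) y| ≤ b / (a + 1 / 2) := by
  have h0 := almostSol_pos hd ha hb y
  have hsq := almostSol_sq hd ha hb y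
  have hb' : 0 < b / (a + 1 / 2) := by positivity
  have e : deriv (almostSol d a b) = fun y => b / (a + 1 / 2) * y / almostSol d a b y :=
    funext fun y => (almostSol_hasDerivAt hd ha hb y).deriv
  have h2 : HasDerivAt (fun y => b / (a + 1 / 2) * y / almostSol d a b y)
      (b / (a + 1 / 2) * (2 * ((d : ℝ) - 1) / (a + 1 / 2)) / almostSol d a b y ^ 3) y := by
    refine (((hasDerivAt_id' y).const_mul (b / (a + 1 / 2))).div
      (almostSol_hasDerivAt hd ha hb y) h0.ne').congr_deriv ?_
    have h3 : 2 * ((d : ℝ) - 1) / (a + 1 / 2) =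
        almostSol d a b y ^ 2 - b / (a + 1 / 2) * y ^ 2 := by rw [hsq]; field_simp; ring
    rw [h3]
    generalize b / (a + 1 / 2) = c
    field_simp
  rw [iteratedDeriv_succ, iteratedDeriv_one, e, h2.deriv, abs_of_nonneg (by positivity),
    div_le_iff₀ (by positivity)]
  have hα : 1 ≤ 2 * ((d : ℝ) - 1) / (a + 1 / 2) := by rw [le_div_iff₀ ha]; linarith
  have hα' : 2 * ((d : ℝ) - 1) / (a + 1 / 2) ≤ almostSol d a b y ^ 2 := by
    rw [hsq]; gcongr; nlinarith [sq_nonneg y]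
  have h4 : 1 ≤ almostSol d a b y := by nlinarith
  gcongr
  calc 2 * ((d : ℝ) - 1) / (a + 1 / 2) ≤ almostSol d a b y ^ 2 * 1 := by linarith
    _ ≤ almostSol d a b y ^ 2 * almostSol d a b y := by gcongr
    _ = almostSol d a b y ^ 3 := by ring

end AlmostSolution

/-! ### Reading off the majorants -/

/-- The supremum up to τ(t) includes the time t itself, so a majorant bound β^q gives a pointwise
bound β^{p+q}. -/
theorem le_of_majorant_le {d : ℕ} {lam b : ℝ → ℝ} {T p q : ℝ} {F : ℝ → ENNReal} {t : ℝ}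
    (ht : t ∈ Icc 0 T) (hβ : 0 < betaFun d (b 0) (tau lam t))
    (h : majorant d lam b T p F (tau lam t) ≤
      ENNReal.ofReal (betaFun d (b 0) (tau lam t) ^ q)) :
    F t ≤ ENNReal.ofReal (betaFun d (b 0) (tau lam t) ^ (p + q)) := by
  have h1 : ENNReal.ofReal (betaFun d (b 0) (tau lam t) ^ (-p)) * F t ≤
      ENNReal.ofReal (betaFun d (b 0) (tau lam t) ^ q) :=
    le_trans (le_iSup₂ (f := fun t (_ : t ∈ {s : ℝ | s ∈ Icc 0 T ∧ tau lam s ≤ tau lam _}) =>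
      ENNReal.ofReal (betaFun d (b 0) (tau lam t) ^ (-p)) * F t) t ⟨ht, le_rfl⟩) h
  set β := betaFun d (b 0) (tau lam t)
  have h2 : ENNReal.ofReal (β ^ p) * ENNReal.ofReal (β ^ (-p)) = 1 := by
    rw [← ENNReal.ofReal_mul (by positivity), ← Real.rpow_add hβ]; simp
  calc F t = ENNReal.ofReal (β ^ p) * (ENNReal.ofReal (β ^ (-p)) * F t) := by
        rw [← mul_assoc, h2, one_mul]
    _ ≤ ENNReal.ofReal (β ^ p) * ENNReal.ofReal (β ^ q) := by gcongr
    _ = ENNReal.ofReal (β ^ (p + q)) := by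
        rw [← ENNReal.ofReal_mul (by positivity), ← Real.rpow_add hβ]

theorem bracket_pos (y : ℝ) : 0 < bracket y := Real.sqrt_pos.2 (by positivity)

theorem bracket_sq (y : ℝ) : bracket y ^ 2 = 1 + y ^ 2 := Real.sq_sqrt (by positivity)

theorem abs_le_of_wnorm_le {m n : ℕ} {f : ℝ → ℝ} {X : ℝ} (hX : 0 ≤ X)
    (h : wnorm m n f ≤ ENNReal.ofReal X) (y : ℝ) : |iteratedDeriv n f y| ≤ X * bracket y ^ m := by
  have h1 : ENNReal.ofReal |bracket y ^ (-(m : ℝ)) * iteratedDeriv n f y| ≤ ENNReal.ofReal X :=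
    (le_iSup (fun y => ENNReal.ofReal |bracket y ^ (-(m : ℝ)) * iteratedDeriv n f y|) y).trans h
  have h2 := (ENNReal.ofReal_le_ofReal_iff hX).1 h1
  have hb := bracket_pos y
  rw [Real.rpow_neg hb.le, Real.rpow_natCast, abs_mul, abs_of_pos (by positivity),
    inv_mul_le_iff₀ (by positivity)] at h2
  linarith

/-! ### Bounds at a fixed time -/

/-- Here s stands for β^{1/4}: the bounds on A and B by β^{-1/4} read β^{2 - 1/4} = s⁷ and β^{7/4 -
1/4} = s⁶, both small against the quantities they perturb. -/
theorem parameter_bounds {m a b β s : ℝ} (hm : 1 ≤ m) (hs : 0 < s) (hs1 : s ≤ 1 / 100)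
    (hsβ : s ^ 4 = β) (ha : |a - 1 / 2 + 1 / m * b| ≤ s ^ 7) (hb : |b - β| ≤ s ^ 6) :
    |a - 1 / 2| ≤ 1 / 100 ∧ 99 / 100 * β ≤ b ∧ b ≤ 101 / 100 * β := by
  have hβ : 0 < β := by rw [← hsβ]; positivity
  have hβ1 : β ≤ 1 / 1000 := by
    have : s ^ 4 ≤ (1 / 100) ^ 4 := by gcongr
    linarith
  have h6 : s ^ 6 ≤ 1 / 100 * β := by
    calc s ^ 6 = s ^ 2 * β := by rw [← hsβ]; ring
      _ ≤ 1 / 100 * β := by gcongr; nlinarith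
  have h7 : s ^ 7 ≤ 1 / 1000 := by
    have : s ^ 7 ≤ (1 / 100) ^ 7 := by gcongr
    linarith
  have hb' := abs_le.1 hb
  have hbl : 99 / 100 * β ≤ b := by linarith [hb'.1]
  have hbu : b ≤ 101 / 100 * β := by linarith [hb'.2]
  refine ⟨?_, hbl, hbu⟩
  have hb0 : 0 ≤ b := by linarith
  have h8 : 1 / m * b ≤ 1 * b := by
    gcongr; rw [div_le_one (by linarith)]; exact hm
  have h9 : 0 ≤ 1 / m * b := by positivity
  have ha' := abs_le.1 ha
  exact abs_le.2 ⟨by linarith [ha'.1], by linarith [ha'.2]⟩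

/-- In the inner region s²q = (β(1 + y²))^{1/2} is at most M = 21m. Hence the errors s⁷q³, s⁷q², s⁷q
are at most M³s, M²s·s² and Ms·s⁴: small relative to the sizes 1, β^{1/2} and β of v, ∂v and ∂²v.
The condition on M³s is what determines the smallness of b(0). -/
theorem inner_bounds {m a b β s y q v w z W W₁ W₂ : ℝ} (hm : 1 ≤ m) (hs : 0 < s)
    (hsm : (21 * m) ^ 3 * s ≤ 1 / 100) (hsβ : s ^ 4 = β)
    (ha : |a - 1 / 2 + 1 / m * b| ≤ s ^ 7) (hb : |b - β| ≤ s ^ 6)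
    (hq : 0 < q) (hq2 : q ^ 2 = 1 + y ^ 2)
    (hW0 : 0 < W) (hW : W ^ 2 = (2 * m + b * y ^ 2) / (a + 1 / 2))
    (hW₁ : W₁ ^ 2 ≤ b / (a + 1 / 2)) (hW₂ : |W₂| ≤ b / (a + 1 / 2))
    (hv : |v - W| ≤ s ^ 7 * q ^ 3) (hw : |w - W₁| ≤ s ^ 7 * q ^ 2) (hz : |z - W₂| ≤ s ^ 7 * q ^ 1)
    (hy : β * y ^ 2 ≤ 20 * m) :
    81 / 50 * m ≤ v ^ 2 ∧ w ^ 2 ≤ 9 * β * v ∧ |z| ≤ 4 * β ∧ (β * y ^ 2 = 20 * m → 16 * m < v ^ 2) := by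
  set M : ℝ := 21 * m with hM
  have hM1 : 1 ≤ M := by linarith
  have hM2 : 1 ≤ M ^ 2 := one_le_pow₀ hM1
  have hMs : M * s ≤ 1 / 100 := by
    have : M * s * 1 ≤ M * s * M ^ 2 := by gcongr
    linarith
  have hM2s : M ^ 2 * s ≤ 1 / 100 := by
    have : M ^ 2 * s * 1 ≤ M ^ 2 * s * M := by gcongr
    linarith
  have hs1 : s ≤ 1 / 100 := by
    have : 1 * s ≤ M * s := by gcongr
    linarith
  obtain ⟨ha1, hbl, hbu⟩ := parameter_bounds hm hs hs1 hsβ ha hb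
  obtain ⟨ha1, ha2⟩ := abs_le.1 ha1
  have hβ : 0 < β := by rw [← hsβ]; positivity
  have hβ1 : β ≤ 1 / 1000 := by
    have : s ^ 4 ≤ (1 / 100) ^ 4 := by gcongr
    linarith
  have ha0 : 0 < a + 1 / 2 := by linarith
  have hc : b / (a + 1 / 2) ≤ 11 / 10 * β := by
    have : β * (99 / 100) ≤ β * (a + 1 / 2) := by gcongr; linarith
    rw [div_le_iff₀ ha0]; linarith
  have hsq : s ^ 2 * q ≤ M := by
    refine le_of_sq_le_sq ?_ (by linarith)
    have h1 : (s ^ 2 * q) ^ 2 = β + β * y ^ 2 := by rw [mul_pow, hq2, ← hsβ]; ring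
    have h2 : 21 * m * 1 ≤ 21 * m * (21 * m) := by gcongr
    rw [h1, hM, sq]; linarith
  have hsq0 : 0 ≤ s ^ 2 * q := by positivity
  have hφ0 : s ^ 7 * q ^ 3 ≤ 1 / 100 := by
    calc s ^ 7 * q ^ 3 = (s ^ 2 * q) ^ 3 * s := by ring
      _ ≤ M ^ 3 * s := by gcongr
      _ ≤ 1 / 100 := hsm
  have hφ1 : s ^ 7 * q ^ 2 ≤ 1 / 100 * s ^ 2 := by
    calc s ^ 7 * q ^ 2 = (s ^ 2 * q) ^ 2 * s * s ^ 2 := by ring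
      _ ≤ M ^ 2 * s * s ^ 2 := by gcongr
      _ ≤ 1 / 100 * s ^ 2 := by gcongr
  have hφ2 : s ^ 7 * q ^ 1 ≤ 1 / 100 * β := by
    calc s ^ 7 * q ^ 1 = (s ^ 2 * q) * s * s ^ 4 := by ring
      _ ≤ M * s * s ^ 4 := by gcongr
      _ ≤ 1 / 100 * β := by rw [hsβ]; gcongr
  have hWm : 99 / 50 * m ≤ W ^ 2 := by
    have h1 : 0 ≤ b * y ^ 2 := mul_nonneg (by linarith) (sq_nonneg y)
    have h2 : m * (a + 1 / 2) ≤ m * (101 / 100) := by gcongr; linarith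
    rw [hW, le_div_iff₀ ha0]; linarith
  have hW1 : 1 ≤ W := (one_le_sq_iff₀ hW0.le).1 (by linarith)
  have hvW : W - 1 / 100 ≤ v := by linarith [(abs_le.1 hv).1]
  have hv2 : 49 / 50 * W ^ 2 ≤ v ^ 2 := by
    have h1 : (W - 1 / 100) ^ 2 ≤ v ^ 2 := pow_le_pow_left₀ (by linarith) hvW 2
    have h2 : W ≤ W ^ 2 := le_self_pow₀ hW1 two_ne_zero
    linarith
  have hv1 : 9 / 10 ≤ v := by linarith
  refine ⟨by linarith, ?_, ?_, ?_⟩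
  · have h1 : (w - W₁) ^ 2 ≤ (1 / 100 * s ^ 2) ^ 2 := by
      rw [← sq_abs]
      exact pow_le_pow_left₀ (abs_nonneg _) (hw.trans hφ1) 2
    have h2 : (1 / 100 * s ^ 2) ^ 2 = 1 / 10000 * β := by rw [← hsβ]; ring
    have h3 : w ^ 2 ≤ 3 * β := by linarith [sq_nonneg (w - 2 * W₁)]
    have h4 : β * (9 / 10) ≤ β * v := by gcongr
    linarith
  · have h1 := abs_le.1 (hz.trans hφ2)
    have h2 := abs_le.1 hW₂
    exact abs_le.2 ⟨by linarith [h1.1, h2.1], by linarith [h1.2, h2.2]⟩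
  · intro hy'
    -- At the interface W² is about 22m, well above 16m; the gap absorbs the errors in a, b and v.
    have h1 : 20 * m ≤ W ^ 2 := by
      rw [hW, le_div_iff₀ ha0]
      have : 99 / 100 * β * y ^ 2 ≤ b * y ^ 2 := by gcongr
      have h2 : m * (a + 1 / 2) ≤ m * (101 / 100) := by gcongr; linarith
      have h3 : 99 / 100 * β * y ^ 2 = 99 / 100 * (20 * m) := by rw [← hy']; ring
      linarith
    linarith

end NeckPinch

namespace NeckPinch

/-! ### The rescaled clock and the comparison function -/

section Clock

variable {d : ℕ} {u : ℝ → ℝ → ℝ} {lam a b : ℝ → ℝ} {T : ℝ}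

theorem ConditionA.continuousOn_rate (hA : ConditionA d u lam a b T) :
    ContinuousOn (fun t => (lam t ^ 2)⁻¹) (Icc 0 T) := by
  have h : ContinuousOn lam (Icc 0 T) := fun t ht => (hA.lam_deriv t ht).continuousWithinAt
  exact (h.pow 2).inv₀ fun t ht => pow_ne_zero 2 (hA.lam_pos t ht).ne'

theorem tau_zero (lam : ℝ → ℝ) : tau lam 0 = 0 := intervalIntegral.integral_same

theorem ConditionA.tau_continuousOn (hA : ConditionA d u lam a b T) (hT : 0 < T) :
    ContinuousOn (tau lam) (Icc 0 T) := by
  have h := intervalIntegral.continuousOn_primitive_interval (μ := volume) (a := 0) (b := T)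
    (f := fun t => (lam t ^ 2)⁻¹)
    (by rw [uIcc_of_le hT.le]; exact hA.continuousOn_rate.integrableOn_Icc)
  rwa [uIcc_of_le hT.le] at h

theorem ConditionA.tau_hasDerivAt (hA : ConditionA d u lam a b T) {t : ℝ} (ht : t ∈ Ioo 0 T) :
    HasDerivAt (tau lam) ((lam t ^ 2)⁻¹) t := by
  have hc : ContinuousOn (fun t => (lam t ^ 2)⁻¹) (Ioo 0 T) :=
    hA.continuousOn_rate.mono Ioo_subset_Icc_self
  refine intervalIntegral.integral_hasDerivAt_right ?_
    (hc.stronglyMeasurableAtFilter isOpen_Ioo t ht) (hc.continuousAt (Ioo_mem_nhds ht.1 ht.2))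
  refine (hA.continuousOn_rate.mono ?_).intervalIntegrable
  rw [uIcc_of_le ht.1.le]
  exact Icc_subset_Icc le_rfl ht.2.le

theorem ConditionA.tau_monotoneOn (hA : ConditionA d u lam a b T) (hT : 0 < T) :
    MonotoneOn (tau lam) (Icc 0 T) := by
  refine monotoneOn_of_deriv_nonneg (convex_Icc 0 T) (hA.tau_continuousOn hT) ?_ ?_
  · rw [interior_Icc]
    exact fun t ht => (hA.tau_hasDerivAt ht).differentiableAt.differentiableWithinAt
  · rw [interior_Icc]
    intro t ht
    rw [(hA.tau_hasDerivAt ht).deriv]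
    positivity

theorem ConditionA.tau_nonneg (hA : ConditionA d u lam a b T) (hT : 0 < T) {t : ℝ}
    (ht : t ∈ Icc 0 T) : 0 ≤ tau lam t := by
  rw [← tau_zero lam]
  exact hA.tau_monotoneOn hT ⟨le_rfl, hT.le⟩ ht ht.1

theorem betaFun_zero {b₀ : ℝ} : betaFun d b₀ 0 = b₀ := by simp [betaFun]

theorem betaFun_denom_pos (hd : 1 ≤ (d : ℝ) - 1) {b₀ τ : ℝ} (hb : 0 < b₀) (hτ : 0 ≤ τ) :
    0 < 1 / b₀ + τ / ((d : ℝ) - 1) := by positivity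

theorem betaFun_pos (hd : 1 ≤ (d : ℝ) - 1) {b₀ τ : ℝ} (hb : 0 < b₀) (hτ : 0 ≤ τ) :
    0 < betaFun d b₀ τ := one_div_pos.2 (betaFun_denom_pos hd hb hτ)

theorem betaFun_anti (hd : 1 ≤ (d : ℝ) - 1) {b₀ τ τ' : ℝ} (hb : 0 < b₀) (hτ : 0 ≤ τ)
    (h : τ ≤ τ') : betaFun d b₀ τ' ≤ betaFun d b₀ τ := by
  unfold betaFun
  have := betaFun_denom_pos hd hb hτ
  gcongr

theorem betaFun_hasDerivAt (hd : 1 ≤ (d : ℝ) - 1) {b₀ τ : ℝ} (hb : 0 < b₀) (hτ : 0 ≤ τ) :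
    HasDerivAt (betaFun d b₀) (-(betaFun d b₀ τ ^ 2 / ((d : ℝ) - 1))) τ := by
  have h0 := betaFun_denom_pos hd hb hτ
  refine ((hasDerivAt_const τ (1 : ℝ)).div
    (((hasDerivAt_id' τ).div_const ((d : ℝ) - 1)).const_add (1 / b₀)) h0.ne').congr_deriv ?_
  rw [betaFun, div_pow]
  set D := 1 / b₀ + τ / ((d : ℝ) - 1)
  field_simp; ring

end Clock

/-! ### From the hypotheses to the rescaled flow -/

section Hypotheses

variable {d : ℕ} {u : ℝ → ℝ → ℝ} {lam a b : ℝ → ℝ} {T : ℝ}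

theorem rpow_quarter_pow {β : ℝ} (hβ : 0 < β) (n : ℕ) :
    (β ^ (1 / 4 : ℝ)) ^ n = β ^ ((n : ℝ) / 4) := by
  rw [← Real.rpow_natCast, ← Real.rpow_mul hβ.le]; congr 1; ring

/-- The bound on `∂ⁿφ` in the norm `‖·‖_{m,n}` with `m + n = 3`. -/
theorem fluct_bound {m n : ℕ} (hmn : m + n = 3) {t : ℝ} (ht : t ∈ Icc 0 T)
    (hβ : 0 < betaFun d (b 0) (tau lam t))
    (hfl : ∀ y, iteratedDeriv n (fluct d u lam a b t) y =
      iteratedDeriv n (rescaled u lam t) y - iteratedDeriv n (almostSol d (a t) (b t)) y)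
    (h : majM d u lam a b T m n (tau lam t) ≤
      ENNReal.ofReal (betaFun d (b 0) (tau lam t) ^ (-(1 / 4) : ℝ))) (y : ℝ) :
    |iteratedDeriv n (rescaled u lam t) y - iteratedDeriv n (almostSol d (a t) (b t)) y| ≤
      (betaFun d (b 0) (tau lam t) ^ (1 / 4 : ℝ)) ^ 7 * bracket y ^ m := by
  have h1 := le_of_majorant_le ht hβ h
  have e : ((m : ℝ) + n + 1) / 2 + -(1 / 4) = ((7 : ℕ) : ℝ) / 4 := by
    have : (m : ℝ) + n = 3 := by exact_mod_cast hmn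
    rw [this]; norm_num
  rw [e] at h1
  rw [← hfl, rpow_quarter_pow hβ]
  exact abs_le_of_wnorm_le (by positivity) h1 y

theorem fluct_iteratedDeriv (hd : 1 ≤ (d : ℝ) - 1) (hu : IsMCFSolution d u T)
    (hA : ConditionA d u lam a b T) {t : ℝ} (ht : t ∈ Icc 0 T) {n : ℕ} (hn : n ≤ 4) (y : ℝ) :
    iteratedDeriv n (fluct d u lam a b t) y =
      iteratedDeriv n (rescaled u lam t) y - iteratedDeriv n (almostSol d (a t) (b t)) y := by
  have ha := hA.a_pos t ht
  have h1 : ContDiff ℝ n (rescaled u lam t) := by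
    have : ContDiff ℝ n (fun x => u x t) := (hu.contDiff_slice t ht).of_le (by exact_mod_cast hn)
    exact contDiff_const.mul (this.comp (contDiff_const.mul contDiff_id))
  have h2 := almostSol_contDiff hd (by linarith : 0 < a t + 1 / 2) (hA.b_pos t ht) n
  exact iteratedDeriv_sub h1.contDiffAt h2.contDiffAt

theorem abs_sub_le_of_majorant {p X : ℝ} {F : ℝ → ℝ} {t : ℝ} {n : ℕ} (ht : t ∈ Icc 0 T)
    (hβ : 0 < betaFun d (b 0) (tau lam t)) (hp : p + -(1 / 4) = (n : ℝ) / 4)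
    (hX : F t = X)
    (h : majorant d lam b T p (fun t => ENNReal.ofReal |F t|) (tau lam t) ≤
      ENNReal.ofReal (betaFun d (b 0) (tau lam t) ^ (-(1 / 4) : ℝ))) :
    |X| ≤ (betaFun d (b 0) (tau lam t) ^ (1 / 4 : ℝ)) ^ n := by
  have h1 := le_of_majorant_le ht hβ h
  rw [hp, ← rpow_quarter_pow hβ] at h1
  rw [← hX]
  exact (ENNReal.ofReal_le_ofReal_iff (by positivity)).1 h1

theorem sq_of_rpow_half {β : ℝ} (hβ : 0 < β) (n : ℕ) : (β ^ ((n : ℝ) / 2)) ^ 2 = β ^ n := by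
  rw [← Real.rpow_natCast, ← Real.rpow_mul hβ.le, ← Real.rpow_natCast]
  congr 1; push_cast; ring

theorem sq_of_rpow_one_half {β : ℝ} (hβ : 0 < β) : (β ^ (1 / 2 : ℝ)) ^ 2 = β := by
  have := sq_of_rpow_half hβ 1
  simpa using this

theorem sq_of_rpow_neg_half {v : ℝ} (hv : 0 < v) : (v ^ (-(1 / 2) : ℝ)) ^ 2 = v⁻¹ := by
  rw [Real.rpow_neg hv.le, inv_pow, sq_of_rpow_one_half hv]

theorem barrier_le_iff {y b₀ v : ℝ} (hd : 1 ≤ (d : ℝ) - 1) (hv : 0 ≤ v) :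
    barrier d y b₀ ≤ v ↔
      if b₀ * y ^ 2 < 20 * ((d : ℝ) - 1) then 81 / 50 * ((d : ℝ) - 1) ≤ v ^ 2
      else 16 * ((d : ℝ) - 1) ≤ v ^ 2 := by
  have hm : 0 ≤ (d : ℝ) - 1 := by linarith
  unfold barrier
  split_ifs
  · rw [← pow_le_pow_iff_left₀ (by positivity) hv two_ne_zero, mul_pow, Real.sq_sqrt (by positivity)]
    constructor <;> intro h <;> linarith
  · rw [← pow_le_pow_iff_left₀ (by positivity) hv two_ne_zero, mul_pow, Real.sq_sqrt hm]
    constructor <;> intro h <;> linarith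

/-- All the analytic hypotheses are consumed here: M, A and B give the inner bounds and the growth
at infinity, and the initial conditions are squared. The bound on b(0) is (21m)³β^{1/4} ≤ 1/100 in
disguise, and it persists because β decreases. -/
theorem neckFlow_of_hypotheses {κ₀ τ₁ S : ℝ} (hd : 1 ≤ (d : ℝ) - 1) (hT : 0 < T)
    (hu : IsMCFSolution d u T) (hA : ConditionA d u lam a b T)
    (hb0 : b 0 ≤ (1 / (100 * (21 * ((d : ℝ) - 1)) ^ 3)) ^ 4)
    (hI : InitialBounds d κ₀ (b 0) (rescaled u lam 0)) (hS : 0 < S) (hST : S ≤ T)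
    (hSτ : tau lam S ≤ τ₁)
    (hmaj : ∀ τ ∈ Icc 0 τ₁,
      majMsum d u lam a b T τ ≤ ENNReal.ofReal (betaFun d (b 0) τ ^ (-(1 / 4) : ℝ)) ∧
      majA d lam a b T τ ≤ ENNReal.ofReal (betaFun d (b 0) τ ^ (-(1 / 4) : ℝ)) ∧
      majB d lam b T τ ≤ ENNReal.ofReal (betaFun d (b 0) τ ^ (-(1 / 4) : ℝ)))
    (hsp : SpaceCondition (rescaled u lam 0)) :
    NeckFlow ((d : ℝ) - 1) S κ₀ (fun t => (lam t ^ 2)⁻¹) a (tau lam)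
      (fun t => betaFun d (b 0) (tau lam t))
      (fun n y t => iteratedDeriv n (rescaled u lam t) y)
      (fun n y t => lam t ^ (n + 1) * timeDeriv u n (lam t * y) t) := by
  have hsub : Icc 0 S ⊆ Icc 0 T := Icc_subset_Icc le_rfl hST
  have hsub' : Ioo 0 S ⊆ Ioo 0 T := Ioo_subset_Ioo le_rfl hST
  have h0T : (0 : ℝ) ∈ Icc 0 T := ⟨le_rfl, hT.le⟩
  have hbpos : 0 < b 0 := hA.b_pos 0 h0T
  have hτ0 : ∀ t ∈ Icc 0 T, 0 ≤ tau lam t := fun t ht => hA.tau_nonneg hT ht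
  have hβ : ∀ t ∈ Icc 0 T, 0 < betaFun d (b 0) (tau lam t) := fun t ht =>
    betaFun_pos hd hbpos (hτ0 t ht)
  have hτ1 : ∀ t ∈ Icc 0 S, tau lam t ≤ τ₁ := fun t ht =>
    (hA.tau_monotoneOn hT (hsub ht) ⟨hS.le, hST⟩ ht.2).trans hSτ
  have hflow := rescaledFlow_of_isMCFSolution hu hA hS hST
  have hsm : ∀ t ∈ Icc 0 T, (21 * ((d : ℝ) - 1)) ^ 3 * betaFun d (b 0) (tau lam t) ^ (1 / 4 : ℝ) ≤
      1 / 100 := by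
    intro t ht
    have h1 : betaFun d (b 0) (tau lam t) ≤ b 0 := by
      have := betaFun_anti hd hbpos le_rfl (hτ0 t ht)
      rwa [betaFun_zero] at this
    have h2 : betaFun d (b 0) (tau lam t) ^ (1 / 4 : ℝ) ≤ 1 / (100 * (21 * ((d : ℝ) - 1)) ^ 3) := by
      refine le_of_pow_le_pow_left₀ (n := 4) (by norm_num) (by positivity) ?_
      rw [rpow_quarter_pow (hβ t ht)]
      norm_num only [Nat.cast_ofNat, div_self, Real.rpow_one]
      exact h1.trans hb0
    rw [le_div_iff₀ (by positivity)] at h2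
    linarith
  have hs4 : ∀ t ∈ Icc 0 T, (betaFun d (b 0) (tau lam t) ^ (1 / 4 : ℝ)) ^ 4 =
      betaFun d (b 0) (tau lam t) := by
    intro t ht
    rw [rpow_quarter_pow (hβ t ht)]; norm_num
  have hs0 : ∀ t ∈ Icc 0 T, 0 < betaFun d (b 0) (tau lam t) ^ (1 / 4 : ℝ) := fun t ht =>
    Real.rpow_pos_of_pos (hβ t ht) _
  have hs1 : ∀ t ∈ Icc 0 T, betaFun d (b 0) (tau lam t) ^ (1 / 4 : ℝ) ≤ 1 / 100 := by
    intro t ht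
    have h1 : (1 : ℝ) ≤ (21 * ((d : ℝ) - 1)) ^ 3 := one_le_pow₀ (by linarith)
    have h2 := hsm t ht
    have h3 := mul_le_mul_of_nonneg_right h1 (hs0 t ht).le
    linarith
  have hmA : ∀ t ∈ Icc 0 S, |a t - 1 / 2 + 1 / ((d : ℝ) - 1) * b t| ≤
      (betaFun d (b 0) (tau lam t) ^ (1 / 4 : ℝ)) ^ 7 := fun t ht =>
    abs_sub_le_of_majorant (F := fun t => a t - 1 / 2 + 1 / ((d : ℝ) - 1) * b t) (p := 2)
      (hsub ht) (hβ t (hsub ht)) (by norm_num) rfl (hmaj _ ⟨hτ0 t (hsub ht), hτ1 t ht⟩).2.1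
  have hmB : ∀ t ∈ Icc 0 S, |b t - betaFun d (b 0) (tau lam t)| ≤
      (betaFun d (b 0) (tau lam t) ^ (1 / 4 : ℝ)) ^ 6 := fun t ht =>
    abs_sub_le_of_majorant (F := fun t => b t - betaFun d (b 0) (tau lam t)) (p := 7 / 4)
      (hsub ht) (hβ t (hsub ht)) (by norm_num) rfl (hmaj _ ⟨hτ0 t (hsub ht), hτ1 t ht⟩).2.2
  have hpar := fun t (ht : t ∈ Icc 0 S) => parameter_bounds hd (hs0 t (hsub ht)) (hs1 t (hsub ht))
    (hs4 t (hsub ht)) (hmA t ht) (hmB t ht)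
  have hfl : ∀ m n : ℕ, m + n = 3 → n ≤ 2 → ∀ t ∈ Icc 0 S, ∀ y,
      |iteratedDeriv n (rescaled u lam t) y - iteratedDeriv n (almostSol d (a t) (b t)) y| ≤
      (betaFun d (b 0) (tau lam t) ^ (1 / 4 : ℝ)) ^ 7 * bracket y ^ m := by
    intro m n hmn hn t ht y
    refine fluct_bound hmn (hsub ht) (hβ t (hsub ht))
      (fluct_iteratedDeriv hd hu hA (hsub ht) (by omega)) (le_trans ?_
      (hmaj _ ⟨hτ0 t (hsub ht), hτ1 t ht⟩).1) y
    unfold majMsum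
    interval_cases n
    · obtain rfl : m = 3 := by omega
      exact le_add_right (le_add_right (le_add_right (by norm_num)))
    · obtain rfl : m = 2 := by omega
      exact le_add_left (by norm_num)
    · obtain rfl : m = 1 := by omega
      exact le_add_right (le_add_left (by norm_num))
  have hWpos : ∀ t ∈ Icc 0 S, 0 < a t + 1 / 2 := fun t ht => by
    linarith [hA.a_pos t (hsub ht)]
  have hW1 := fun t (ht : t ∈ Icc 0 S) y =>
    almostSol_iteratedDeriv_one_sq_le hd (hWpos t ht) (hA.b_pos t (hsub ht)) y
  have hW2 := fun t (ht : t ∈ Icc 0 S) y =>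
    abs_almostSol_iteratedDeriv_two_le hd (hWpos t ht)
      (by linarith [(abs_le.1 (hpar t ht).1).2]) (hA.b_pos t (hsub ht)) y
  have hinner := fun t (ht : t ∈ Icc 0 S) y => inner_bounds hd (hs0 t (hsub ht)) (hsm t (hsub ht))
    (hs4 t (hsub ht)) (hmA t ht) (hmB t ht) (bracket_pos y) (bracket_sq y)
    (almostSol_pos hd (hWpos t ht) (hA.b_pos t (hsub ht)) y)
    (almostSol_sq hd (hWpos t ht) (hA.b_pos t (hsub ht)) y) (hW1 t ht y) (hW2 t ht y)
    (by simpa using hfl 3 0 rfl (by norm_num) t ht y) (hfl 2 1 rfl (by norm_num) t ht y)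
    (hfl 1 2 rfl (by norm_num) t ht y)
  have hv0 : ∀ y, 0 < rescaled u lam 0 y := fun y => by
    have := hflow.pos 0 ⟨le_rfl, hS.le⟩ y
    simpa using this
  refine
    { toRescaledFlow := hflow
      one_le := hd
      clock_cont := (hA.tau_continuousOn hT).mono hsub
      clock_nonneg := fun t ht => hτ0 t (hsub ht)
      clock_deriv := fun t ht => hA.tau_hasDerivAt (hsub' ht)
      beta_cont := ?_
      beta_pos := fun t ht => hβ t (hsub ht)
      beta_anti := fun t ht s hs hts => betaFun_anti hd hbpos (hτ0 t (hsub ht))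
        (hA.tau_monotoneOn hT (hsub ht) (hsub hs) hts)
      beta_deriv := fun t ht => (betaFun_hasDerivAt hd hbpos
        (hτ0 t (hsub (Ioo_subset_Icc_self ht)))).comp t (hA.tau_hasDerivAt (hsub' ht))
      a_near := fun t ht => (hpar t ht).1
      inner_lower := fun t ht y hy => by simpa using (hinner t ht y hy).1
      inner_one := fun t ht y hy => by simpa using (hinner t ht y hy).2.1
      inner_two := fun t ht y hy => (hinner t ht y hy).2.2.1
      boundary := fun t ht y hy => by simpa using (hinner t ht y hy.le).2.2.2 hy
      -- The almost solution has first and second derivatives at most 1, and the fluctuation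
      -- contributes at most 1 + y² and 1 + |y|; so 3 is enough.
      growth := ⟨3, fun t ht y => ?_⟩
      init_lower := fun y hy => ?_
      init_one := fun y => ?_
      init_bdd := ?_
      init_higher := fun n hn y => ?_ }
  · intro t ht
    exact ((betaFun_hasDerivAt hd hbpos (hτ0 t (hsub ht))).continuousAt).comp_continuousWithinAt
      (((hA.tau_continuousOn hT).mono hsub) t ht)
  · have hb1 : b t / (a t + 1 / 2) ≤ 1 := by
      obtain ⟨h1, h2, h3⟩ := hpar t ht
      have h4 : betaFun d (b 0) (tau lam t) ≤ 1 / 100 := by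
        rw [← hs4 t (hsub ht)]
        refine (pow_le_pow_left₀ (hs0 t (hsub ht)).le (hs1 t (hsub ht)) 4).trans (by norm_num)
      rw [div_le_one (hWpos t ht)]
      linarith [(abs_le.1 h1).1]
    have hs7 : (betaFun d (b 0) (tau lam t) ^ (1 / 4 : ℝ)) ^ 7 ≤ 1 :=
      pow_le_one₀ (hs0 t (hsub ht)).le ((hs1 t (hsub ht)).trans (by norm_num))
    constructor
    · have h1 := hfl 2 1 rfl (by norm_num) t ht y
      have h2 : |iteratedDeriv 1 (almostSol d (a t) (b t)) y| ≤ 1 :=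
        abs_le_of_sq_le_sq (by rw [one_pow]; exact (hW1 t ht y).trans hb1) zero_le_one
      rw [bracket_sq] at h1
      have h3 : (betaFun d (b 0) (tau lam t) ^ (1 / 4 : ℝ)) ^ 7 * (1 + y ^ 2) ≤
        1 * (1 + y ^ 2) := by gcongr
      have h4 := abs_sub_abs_le_abs_sub (iteratedDeriv 1 (rescaled u lam t) y)
        (iteratedDeriv 1 (almostSol d (a t) (b t)) y)
      nlinarith [sq_nonneg y]
    · have h1 := hfl 1 2 rfl (by norm_num) t ht y
      have h2 := (hW2 t ht y).trans hb1
      have hbr : bracket y ≤ 1 + |y| := by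
        refine le_of_sq_le_sq ?_ (by positivity)
        rw [bracket_sq]; nlinarith [abs_nonneg y, sq_abs y]
      have h3 : (betaFun d (b 0) (tau lam t) ^ (1 / 4 : ℝ)) ^ 7 * bracket y ^ 1 ≤
        1 * (1 + |y|) := by
        rw [pow_one]; exact mul_le_mul hs7 hbr (bracket_pos y).le zero_le_one
      have h4 := abs_sub_abs_le_abs_sub (iteratedDeriv 2 (rescaled u lam t) y)
        (iteratedDeriv 2 (almostSol d (a t) (b t)) y)
      linarith [abs_nonneg y]
  · have h1 := hI.lower y
    rw [barrier_le_iff hd (hv0 y).le, if_neg] at h1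
    · simpa using h1
    · rw [tau_zero, betaFun_zero] at hy
      exact not_lt.2 hy
  · have h1 := hI.deriv_one y
    rw [tau_zero, betaFun_zero]
    simp only [iteratedDeriv_zero, iteratedDeriv_one]
    have h2 : (deriv (rescaled u lam 0) y * rescaled u lam 0 y ^ (-(1 / 2) : ℝ)) ^ 2 ≤
        (κ₀ * b 0 ^ (1 / 2 : ℝ)) ^ 2 := by
      rw [← sq_abs]; exact pow_le_pow_left₀ (abs_nonneg _) h1 2
    rw [mul_pow, mul_pow, sq_of_rpow_neg_half (hv0 y), sq_of_rpow_one_half hbpos,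
      ← div_eq_mul_inv, div_le_iff₀ (hv0 y)] at h2
    exact h2
  · obtain ⟨K, hK⟩ := hsp.deriv_one
    exact ⟨K, fun y => by simpa only [iteratedDeriv_one] using hK y⟩
  · have h1 := hI.deriv_higher n hn y
    rw [tau_zero, betaFun_zero]
    have h2 : iteratedDeriv n (rescaled u lam 0) y ^ 2 ≤ (κ₀ * b 0 ^ ((n : ℝ) / 2)) ^ 2 := by
      rw [← sq_abs]; exact pow_le_pow_left₀ (abs_nonneg _) h1 2
    rwa [mul_pow, sq_of_rpow_half hbpos] at h2

end Hypotheses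

end NeckPinch

end Auxiliary

/-! ### The main theorem -/

open NeckPinch in
theorem mainTheorem3 (d : ℕ) (hd : 2 ≤ d) (κ₀ : ℝ) :
    ∃ δ : ℝ, 0 < δ ∧ ∃ C : ℝ, 0 < C ∧
      ∀ (u : ℝ → ℝ → ℝ) (lam a b : ℝ → ℝ) (T τ₁ : ℝ),
        0 < T →
        IsMCFSolution d u T →
        ConditionA d u lam a b T →
        b 0 ≤ δ →
        InitialBounds d κ₀ (b 0) (rescaled u lam 0) →
        0 < τ₁ → τ₁ ≤ tau lam T →
        (∀ τ ∈ Set.Icc 0 τ₁,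
          majMsum d u lam a b T τ ≤ ENNReal.ofReal (betaFun d (b 0) τ ^ (-(1 / 4) : ℝ)) ∧
          majA d lam a b T τ ≤ ENNReal.ofReal (betaFun d (b 0) τ ^ (-(1 / 4) : ℝ)) ∧
          majB d lam b T τ ≤ ENNReal.ofReal (betaFun d (b 0) τ ^ (-(1 / 4) : ℝ))) →
        (∀ t ∈ Set.Icc 0 T, tau lam t ≤ τ₁ → SpaceCondition (rescaled u lam t)) →
        ∀ t ∈ Set.Icc 0 T, tau lam t ≤ τ₁ → ∀ y : ℝ,
          barrier d y (betaFun d (b 0) (tau lam t)) ≤ rescaled u lam t y ∧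
          |rescaled u lam t y ^ (-(1 / 2) : ℝ) * deriv (rescaled u lam t) y|
            ≤ C * betaFun d (b 0) (tau lam t) ^ (1 / 2 : ℝ) ∧
          ∀ n ∈ Set.Icc 2 4,
            |iteratedDeriv n (rescaled u lam t) y|
              ≤ C * betaFun d (b 0) (tau lam t) ^ ((n : ℝ) / 2) := by
  have hm : 1 ≤ (d : ℝ) - 1 := by
    have : (2 : ℝ) ≤ d := by exact_mod_cast hd
    linarith
  set G : ℝ := 9 + κ₀ ^ 2 with hG
  have hG9 : 9 ≤ G := by rw [hG]; nlinarith [sq_nonneg κ₀]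
  -- The factor 2 makes C² dominate the constant 2(1000·259200G³)² of the fourth derivative, the
  -- largest one.
  set C : ℝ := 2 * (1000 * (259200 * G ^ 3)) with hC
  have hGC : G ≤ C := by
    have h1 : G ≤ G ^ 3 := le_self_pow₀ (by linarith) (by norm_num)
    linarith
  have hκC : κ₀ ≤ C := by nlinarith [sq_nonneg (κ₀ - 1)]
  -- The first bound makes the inner region close to the almost solution; the second gives Gβ ≤
  -- 1/10000, the smallness used in the derivative estimates.
  refine ⟨min ((1 / (100 * (21 * ((d : ℝ) - 1)) ^ 3)) ^ 4) (1 / (10000 * G)), by positivity,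
    C, by positivity, ?_⟩
  intro u lam a b T τ₁ hT hu hA hb0 hI hτ₁ hτT hmaj hsp t ht htτ y
  have h0T : (0 : ℝ) ∈ Icc 0 T := ⟨le_rfl, hT.le⟩
  have hbpos : 0 < b 0 := hA.b_pos 0 h0T
  rcases ht.1.eq_or_lt with rfl | htpos
  · rw [tau_zero, betaFun_zero]
    refine ⟨hI.lower y, ?_, fun n hn => ?_⟩
    · rw [mul_comm]
      exact (hI.deriv_one y).trans (by gcongr)
    · exact (hI.deriv_higher n hn y).trans (by gcongr)
  · have hflow := neckFlow_of_hypotheses hm hT hu hA (hb0.trans (min_le_left _ _)) hI htpos ht.2 htτ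
      hmaj (hsp 0 h0T (by rw [tau_zero]; exact hτ₁.le))
    have hδ : ∀ s ∈ Icc 0 t, G * betaFun d (b 0) (tau lam s) ≤ 1 / 10000 := by
      intro s hs
      have h1 : betaFun d (b 0) (tau lam s) ≤ b 0 := by
        have := hflow.beta_anti ⟨le_rfl, htpos.le⟩ hs hs.1
        simpa only [tau_zero, betaFun_zero] using this
      have h2 := h1.trans (hb0.trans (min_le_right _ _))
      rw [le_div_iff₀ (by positivity)] at h2
      linarith
    have htt : t ∈ Icc 0 t := ⟨htpos.le, le_rfl⟩
    obtain ⟨-, hone, htwo, -⟩ := hflow.pointwise hδ htt y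
    have hthree := hflow.deriv_three_sq_le hδ t htt y
    have hfour := hflow.deriv_four_sq_le hδ t htt y
    have hlow := hflow.lower t htt y
    have hout := hflow.outer_lower t htt y
    have hv := hflow.pos t htt y
    have hβ := hflow.beta_pos t htt
    simp only [iteratedDeriv_zero, iteratedDeriv_one] at hone hlow hout hv hβ
    set β := betaFun d (b 0) (tau lam t)
    have hC1 : 1 ≤ C := by linarith
    have hGC2 : G ≤ C ^ 2 := hGC.trans (le_self_pow₀ hC1 two_ne_zero)
    refine ⟨?_, ?_, ?_⟩
    · rw [barrier_le_iff hm hv.le]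
      split_ifs with h
      · exact hlow
      · exact hout (not_lt.1 h)
    · refine abs_le_of_sq_le_sq ?_ (by positivity)
      rw [mul_pow, mul_pow, sq_of_rpow_neg_half hv, sq_of_rpow_one_half hβ,
        inv_mul_le_iff₀ hv]
      refine hone.trans ?_
      rw [mul_comm (rescaled u lam t y)]
      gcongr
    · have key : ∀ n : ℕ, iteratedDeriv n (rescaled u lam t) y ^ 2 ≤ C ^ 2 * β ^ n →
          |iteratedDeriv n (rescaled u lam t) y| ≤ C * β ^ ((n : ℝ) / 2) := by
        intro n h
        refine abs_le_of_sq_le_sq ?_ (by positivity)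
        rwa [mul_pow, sq_of_rpow_half hβ]
      rintro n ⟨hn2, hn4⟩
      refine key n ?_
      interval_cases n
      · refine htwo.trans ?_
        rw [mul_pow]
        gcongr
      · refine hthree.trans ?_
        have h1 : 259200 * G ^ 3 ≤ C := by
          have : 0 ≤ G ^ 3 := by positivity
          linarith
        have h2 := h1.trans (le_self_pow₀ hC1 two_ne_zero)
        gcongr
      · refine hfour.trans ?_
        have h1 : 2 * (1000 * (259200 * G ^ 3)) ^ 2 ≤ C ^ 2 := by
          rw [hC, mul_pow 2]
          nlinarith [sq_nonneg (1000 * (259200 * G ^ 3))]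
        gcongr
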